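/- Let $k$ be a field of characteristic zero and let $s\ge 1$. Let $[s]^*_+$ be the set of nonempty words $w=(i_1\dots i_n)$ in the alphabet $\{1,\dots,s\}$, $|w|=n$, and let $\mathfrak G^s_+(k)$ be the set of families $f=(f_w)_{w\in[s]^*_+}$ in $k$ with $f_w=1$ whenever $|w|=1$. *Boxed convolution.* $(f\boxtimes g)_w=\sum_{\pi\in NC(|w|)}\prod_{V\in\pi}f_{w|V}\prod_{V\in K(\pi)}g_{w|V}$, where $NC(n)$ is the set of non-crossing partitions of $\{1,\dots,n\}$, $K(\pi)$ is the Kreweras complement and $w|V$ is the subword of $w$ at the positions in $V$. Let $(\underline 1_s,\underline 0)$ be the family equal to $1$ on words of length one and to $0$ on longer words, and let $\mathrm{Zeta}=\underline 1$ be the family equal to $1$ on all words. *Free multiplicative convolution.* $(f\boxtimes_V g)_{i_1\dots i_n}=(f\bullet_{\mathrm F}g)(x_{i_1}y_{i_1}\cdots x_{i_n}y_{i_n})$. Here $f\bullet_{\mathrm F}g$ is the free product of the unital functionals with values $f$ on words in the $x_i$ and $g$ on words in the $y_i$: $(f\bullet_{\mathrm F}g)(1)=1$, and if a nonempty word has the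 maximal one-coloured subwords $a_1,\dots,a_m$ then $$(f\bullet_{\mathrm F} g)(a_1\cdots a_m)=\sum_{I\subsetneq\{1,\dots,m\}}(-1)^{m-|I|+1}(f\bullet_{\mathrm F}g)\Big(\prod_{i\in I}a_i\Big)\prod_{i\notin I}\varphi_i(a_i),$$ with $\varphi_i=f$ if $a_i$ is a word in the $x$'s and $\varphi_i=g$ if it is a word in the $y$'s. *Lie theoretic notions.* Each of the operations $\boxtimes_V$ (with unit $e=\underline1$) and $\boxtimes$ (with unit $e=(\underline 1_s,\underline 0)$) is polynomial. Use the co-ordinates $X_w=f_w-e_w$, $|w|\ge2$, on $\mathfrak G^s_+(k)$, with values in $k^{\{w:|w|\ge 2\}}$. Let $J(x)$ be the Jacobian matrix at the origin of the left translation $y\mapsto x\circ y$ in these co-ordinates; its columns are the Jacobian basis of the left invariant vector fields. Identify the Lie algebra with $k^{\{w:|w|\ge2\}}$ by means of this basis. $\mathrm{EXP}(\xi)$ is the value at $t=1$ of the polynomial solution of $\gamma'(t)=J(\gamma(t))\xi$, $\gamma(0)=0$, regarded as a point of $\mathfrak G^s_+(k)$; $\mathrm{LOG}$ is the inverse of $\mathrm{EXP}$;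 and $X\circ Y=X+Y+\frac12[X,Y]+\cdots$ is the Baker-Campbell-Hausdorff (BCH) series, in Dynkin's form, in the Lie bracket. Write $\mathrm{EXP}_{\boxtimes},\mathrm{LOG}_{\boxtimes_V},\circ_{\boxtimes},\circ_{\boxtimes_V}$, etc. **Theorem.** 1. Zeta has a two-sided $\boxtimes$-inverse $\mathrm{Moeb}$. Put $\mathcal R(f)=f\boxtimes\mathrm{Moeb}$. Then $(\mathfrak G^s_+(k),\boxtimes_V,\underline1)$ and $(\mathfrak G^s_+(k),\boxtimes,(\underline1_s,\underline0))$ are groups, and $\mathcal R$ restricts to a group isomorphism from the first onto the second. 2. For both groups the following holds: for every $\xi$ the polynomial curve $\gamma$ exists and is unique; $\mathrm{EXP}$ is a bijection from $k^{\{w:|w|\ge2\}}$ onto $\mathfrak G^s_+(k)$; and in the co-ordinate $w$ the terms of degree $\ge|w|$ of the BCH series vanish. The differential $d\mathcal R$ of $\mathcal R$ at $\underline 1$ is given by a matrix $(A_{w,v})$, $|w|,|v|\ge2$, which is lower-triangular with unit diagonal: $A_{w,w}=1$, and $A_{w,v}=0$ if $v\ne w$ and $|v|\ge|w|$. This linear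 change of co-ordinates carries one BCH law into the other: $$d\mathcal R(X\circ_{\boxtimes_V}Y)=d\mathcal R(X)\circ_{\boxtimes}d\mathcal R(Y)\qquad\text{for all }X,Y.$$ 3. $\mathrm{EXP}_\boxtimes\circ d\mathcal R\circ\mathrm{LOG}_{\boxtimes_V}=\mathcal R$ on $\mathfrak G^s_+(k)$. -/

import Mathlib

open Finset

universe u

noncomputable section

namespace FreeMul

/-! ### Words, coefficient families and the set `GPlus` -/

/-- The nonempty words in the alphabet `[s]`. -/
abbrev NWord (s : ℕ) : Type := {w : List (Fin s) // w ≠ []}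

/-- Families of coefficients indexed by the nonempty words. -/
abbrev Series (s : ℕ) (R : Type*) : Type _ := NWord s → R

/-- The families all of whose coefficients at words of length one are equal to `1`. -/
def GPlus (s : ℕ) (R : Type*) [CommRing R] : Set (Series s R) :=
  {f | ∀ w : NWord s, w.1.length = 1 → f w = 1}

/-- The coefficients on all words, with constant term `1`. (For the boxed convolution, where the
constant term plays no role, only the values at nonempty words are ever used.) -/
def coeff {s : ℕ} {R : Type*} [CommRing R] (f : Series s R) (w : List (Fin s)) : R :=
  if h : w = [] then 1 else f ⟨w, h⟩

/-- The sublist of `l` at the positions in `I`, in increasing order of positions. -/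
def restrict {α : Type*} (l : List α) (I : Finset (Fin l.length)) : List α :=
  (I.sort (· ≤ ·)).map l.get

/-! ### Non-crossing partitions, Kreweras complement, boxed convolution -/

/-- `π` is non-crossing. -/
def IsNoncrossing {n : ℕ} (π : Finpartition (univ : Finset (Fin n))) : Prop :=
  ∀ a b c d : Fin n, a < b → b < c → c < d → ∀ U ∈ π.parts, ∀ V ∈ π.parts,
    a ∈ U → c ∈ U → b ∈ V → d ∈ V → U = V

/-- The equivalence relation underlying the Kreweras complement. On the circle with points
`1, 1', 2, 2', …, n, n'` (in this order), `i` and `j` are equivalent iff the chord from `i'` to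
`j'` does not separate two elements of one block of `π`. -/
def krewerasSetoid {n : ℕ} (π : Finpartition (univ : Finset (Fin n))) : Setoid (Fin n) where
  r i j := ∀ V ∈ π.parts, ∀ a ∈ V, ∀ b ∈ V, ((i < a ↔ j < a) ↔ (i < b ↔ j < b))
  iseqv :=
    { refl := fun i V _ a _ b _ => by simp
      symm := fun {i j} h V hV a ha b hb => by
        have := h V hV a ha b hb
        tauto
      trans := fun {i j l} h h' V hV a ha b hb => by
        have h1 := h V hV a ha b hb
        have h2 := h' V hV a ha b hb
        tauto }

open Classical in
/-- The Kreweras complement `K(π)`. -/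
def kreweras {n : ℕ} (π : Finpartition (univ : Finset (Fin n))) :
    Finpartition (univ : Finset (Fin n)) :=
  Finpartition.ofSetoid (krewerasSetoid π)

open Classical in
/-- The boxed convolution: the coefficient at `w` is
`∑ π ∈ NC(|w|), ∏ V ∈ π, f (w|V) * ∏ V ∈ K(π), g (w|V)`. -/
def box {s : ℕ} {R : Type*} [CommRing R] (f g : Series s R) : Series s R := fun w =>
  ∑ π ∈ (univ : Finset (Finpartition (univ : Finset (Fin w.1.length)))).filter IsNoncrossing,
    (∏ V ∈ π.parts, coeff f (restrict w.1 V)) * ∏ V ∈ (kreweras π).parts, coeff g (restrict w.1 V)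

/-- The neutral element of the boxed convolution: `1` at words of length one, `0` elsewhere. -/
def boxUnit (s : ℕ) (R : Type*) [CommRing R] : Series s R := fun w =>
  if w.1.length = 1 then 1 else 0

/-- The Zeta series, all of whose coefficients are `1`. -/
def zeta (s : ℕ) (R : Type*) [CommRing R] : Series s R := fun _ => 1

/-- The Moebius series: the inverse of the Zeta series for the boxed convolution. -/
def moeb (s : ℕ) (R : Type*) [CommRing R] : Series s R :=
  Classical.epsilon fun m => box (zeta s R) m = boxUnit s R ∧ box m (zeta s R) = boxUnit s R

/-- The `𝓡`-transform `f ↦ f ⊠ Moeb`. -/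
def rTransform {s : ℕ} {R : Type*} [CommRing R] (f : Series s R) : Series s R :=
  box f (moeb s R)

/-! ### The free product of functionals and the free multiplicative convolution -/

/-- The decomposition of a word in the letters `x_i = inl i`, `y_i = inr i` into its maximal
subwords containing only `x`'s or only `y`'s. -/
def runs {s : ℕ} (v : List (Fin s ⊕ Fin s)) : List (List (Fin s ⊕ Fin s)) :=
  v.splitBy fun a b => a.isLeft == b.isLeft

/-- The value on a one-coloured word: `f` on words in the `x`'s and `g` on words in the `y`'s. -/
def runValue {s : ℕ} {R : Type*} [CommRing R] (f g : Series s R)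
    (v : List (Fin s ⊕ Fin s)) : R :=
  if v.all Sum.isLeft then coeff f (v.map (Sum.elim id id))
  else coeff g (v.map (Sum.elim id id))

theorem length_flatten_restrict_lt {α : Type*} (l : List (List α)) (hl : [] ∉ l)
    (I : Finset (Fin l.length)) (hI : I ≠ univ) :
    (restrict l I).flatten.length < l.flatten.length := by
  have h1 : (restrict l I).flatten.length = ∑ i ∈ I, (l.get i).length := by
    rw [List.length_flatten, restrict, List.map_map, Finset.sum, ← Finset.sort_eq I (· ≤ ·),
      Multiset.map_coe, Multiset.sum_coe]
    rfl
  have h2 : l.flatten.length = ∑ i : Fin l.length, (l.get i).length := by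
    rw [List.length_flatten, ← List.sum_ofFn]
    congr 1
    apply List.ext_get <;> simp
  rw [h1, h2]
  obtain ⟨i, hi⟩ : ∃ i, i ∉ I := by
    by_contra! h
    exact hI (Finset.eq_univ_iff_forall.2 h)
  refine Finset.sum_lt_sum_of_subset (Finset.subset_univ I) (Finset.mem_univ i) hi ?_ ?_
  · rw [List.length_pos_iff]
    intro h
    exact hl (h ▸ List.get_mem l i)
  · intros
    exact Nat.zero_le _

/-- The free product `f • g` of the unital functionals given by `f` on the words in the `x`'s and
by `g` on the words in the `y`'s, evaluated at an arbitrary word in the `x`'s and `y`'s: if the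
word has the maximal one-coloured subwords `a_1, …, a_m` (`m ≥ 1`), then
`(f • g)(a_1 ⋯ a_m) = ∑_{I ⊊ [m]} (-1)^(m-|I|+1) (f • g)(∏_{i ∈ I} a_i) ∏_{i ∉ I} φ_i(a_i)`,
where `φ_i` is `f` or `g` according to the colour of `a_i`. -/
def freeProd {s : ℕ} {R : Type*} [CommRing R] (f g : Series s R)
    (v : List (Fin s ⊕ Fin s)) : R :=
  if v = [] then 1
  else ∑ I : Finset (Fin (runs v).length),
    if h : I = univ then 0
    else (-1) ^ ((runs v).length - I.card + 1) * freeProd f g (restrict (runs v) I).flatten *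
      ∏ i ∈ Iᶜ, runValue f g ((runs v).get i)
termination_by v.length
decreasing_by
  have := length_flatten_restrict_lt (runs v) (List.nil_notMem_splitBy _ v) I h
  rwa [show (runs v).flatten = v from List.flatten_splitBy _ v] at this

/-- The free multiplicative convolution `f ⊠_V g = (f • g) ∘ Δ_m`, where `Δ_m` sends a word
`i_1 ⋯ i_n` to `x_{i_1} y_{i_1} ⋯ x_{i_n} y_{i_n}`. -/
def boxV {s : ℕ} {R : Type*} [CommRing R] (f g : Series s R) : Series s R := fun w =>
  freeProd f g (w.1.flatMap fun i => [Sum.inl i, Sum.inr i])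

/-! ### Co-ordinates, Jacobian basis, exponential map and Baker-Campbell-Hausdorff law -/

/-- The words of length at least two. -/
abbrev LWord (s : ℕ) : Type := {w : List (Fin s) // 2 ≤ w.length}

/-- Co-ordinate families, indexed by the words of length at least two. -/
abbrev Coord (s : ℕ) (R : Type*) : Type _ := LWord s → R

theorem LWord.ne_nil {s : ℕ} (w : LWord s) : w.1 ≠ [] := by
  intro h
  have := w.2
  simp [h] at this

/-- A word of length at least two, as a nonempty word. -/
def LWord.toNWord {s : ℕ} (w : LWord s) : NWord s := ⟨w.1, w.ne_nil⟩

/-- The point of `GPlus` with co-ordinates `X` centred at `e`. -/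
def point {s : ℕ} {R : Type*} [CommRing R] (e : Series s R) (X : Coord s R) : Series s R :=
  fun w => if h : 2 ≤ w.1.length then e w + X ⟨w.1, h⟩ else 1

theorem point_mem {s : ℕ} {R : Type*} [CommRing R] (e : Series s R) (X : Coord s R) :
    point e X ∈ GPlus s R := by
  intro w hw
  simp [point, hw]

/-- A binary operation on families of coefficients, given functorially in the coefficient ring,
together with its unit. -/
structure Law (s : ℕ) where
  op : ∀ {R : Type u} [CommRing R], Series s R → Series s R → Series s R
  unit : ∀ (R : Type u) [CommRing R], Series s R

/-- `⊠` with unit `(1,…,1,0,0,…)`. -/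
def lawBox (s : ℕ) : Law.{u} s := ⟨fun f g => box f g, fun R _ => boxUnit s R⟩

/-- `⊠_V` with unit `(1,1,1,…)`. -/
def lawBoxV (s : ℕ) : Law.{u} s := ⟨fun f g => boxV f g, fun R _ => zeta s R⟩

namespace Law

variable {s : ℕ} (L : Law.{u} s)

/-- The group law on co-ordinates centred at the unit (the formal group law). -/
def mul {R : Type u} [CommRing R] (X Y : Coord s R) : Coord s R := fun w =>
  L.op (point (L.unit R) X) (point (L.unit R) Y) w.toNWord - L.unit R w.toNWord

/-- `J(x) ξ`, where `J(x)` is the Jacobian matrix at the origin of the left translation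
`y ↦ x ∘ y`. The derivative is the `ε`-coefficient of `x ∘ (ε ξ)` over the dual numbers `R[ε]`.
The columns of `J` form the Jacobian basis of the left invariant vector fields, so that
`x ↦ J(x) ξ` is the left invariant vector field with co-ordinates `ξ` in that basis. -/
def leftJac {R : Type u} [CommRing R] (x ξ : Coord s R) : Coord s R := fun w =>
  (L.mul (R := DualNumber R) (fun v => TrivSqZeroExt.inl (x v))
    (fun v => TrivSqZeroExt.inr (ξ v)) w).snd

variable {k : Type u} [Field k]

/-- The derivative of `x ↦ J(x) Y` at the origin in the direction `X`. -/
def bilin (X Y : Coord s k) : Coord s k := fun w =>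
  (L.leftJac (R := DualNumber k) (fun v => TrivSqZeroExt.inr (X v))
    (fun v => TrivSqZeroExt.inl (Y v)) w).snd

/-- The bracket of the Lie algebra (the commutator of left invariant vector fields), in
co-ordinates with respect to the Jacobian basis. -/
def bracket (X Y : Coord s k) : Coord s k := L.bilin X Y - L.bilin Y X

/-- `[Z_1, [Z_2, … [Z_{m-1}, Z_m] … ]]`. -/
def nested : List (Coord s k) → Coord s k
  | [] => 0
  | [Z] => Z
  | Z :: Z' :: l => L.bracket Z (nested (Z' :: l))

/-- The part of degree `N` of the Baker-Campbell-Hausdorff series in Dynkin's form: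
`∑_{n} (-1)^(n-1)/n ∑ 1/(N ∏ r_i! t_i!) [X^{r_1} Y^{t_1} ⋯ X^{r_n} Y^{t_n}]`, where the inner sum
is over all `((r_i, t_i))_{i ≤ n}` with `r_i + t_i > 0` and `∑ (r_i + t_i) = N`. -/
def bchPart (N : ℕ) (X Y : Coord s k) : Coord s k :=
  ∑ n ∈ Icc 1 N, ∑ p ∈ (Fintype.piFinset fun _ : Fin n => range (N + 1) ×ˢ range (N + 1)).filter
      (fun p => (∀ i, 0 < (p i).1 + (p i).2) ∧ ∑ i, ((p i).1 + (p i).2) = N),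
    ((-1) ^ (n - 1) / ((n : k) * (N : k) *
        ∏ i, (((p i).1.factorial : k) * ((p i).2.factorial : k)))) •
      L.nested ((List.ofFn p).flatMap fun q => List.replicate q.1 X ++ List.replicate q.2 Y)

/-- The Baker-Campbell-Hausdorff law on the Lie algebra; in each co-ordinate the sum is finite. -/
def bch (X Y : Coord s k) : Coord s k := fun w => ∑ᶠ N : ℕ, L.bchPart N X Y w

/-- `γ` is the (polynomial) integral curve through the unit of the left invariant vector field
with co-ordinates `ξ`: `γ(0) = 0` and `γ'(t) = J(γ(t)) ξ`. -/
def IsFlow (ξ : Coord s k) (γ : Coord s (Polynomial k)) : Prop :=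
  (∀ w, (γ w).eval 0 = 0) ∧
    ∀ w, Polynomial.derivative (γ w) = L.leftJac γ (fun v => Polynomial.C (ξ v)) w

/-- `EXP`: the time-one value of the integral curve. -/
def EXP (ξ : Coord s k) : GPlus s k :=
  ⟨point (L.unit k) fun w => (Classical.epsilon (L.IsFlow ξ) w).eval 1, point_mem _ _⟩

/-- `LOG`: the inverse of `EXP`. -/
def LOG : GPlus s k → Coord s k := Function.invFun L.EXP

end Law

/-- The differential of the `𝓡`-transform at the unit `(1,1,1,…)` of `⊠_V`: the
`ε`-coefficient of `𝓡(1 + ε ξ)` over the dual numbers `k[ε]`. -/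
def dR {s : ℕ} {k : Type*} [Field k] (ξ : Coord s k) : Coord s k := fun w =>
  (rTransform (point (zeta s (DualNumber k)) fun v => TrivSqZeroExt.inr (ξ v)) w.toNWord).snd

end FreeMul

end

/-! Two facts carry the algebra: `⊠` is associative (`box_assoc`), and `f ⊠_V g = 𝓡(f) ⊠ g`
(`boxV_eq`). Together they give `𝓡(f ⊠_V g) = 𝓡(f) ⊠ g ⊠ Moeb = 𝓡(f) ⊠ 𝓡(g)`, so `⊠_V` is `⊠`
transported along the bijection `𝓡`. Inverses for `⊠`, Moeb among them, exist because the
coefficient of `f ⊠ g` at a word `w` of length at least two is `f w + g w` up to a function of the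
coefficients at shorter words (`box_sub_box`); translations are therefore inverted length by length.

Both facts start from one recursion. The smallest point `m` of a non-crossing partition either is a
block by itself, or its block goes on at some `k`, and then the arc from `m` to `k` cuts off an
independent partition (`ncSumOpen_eq`). Read on words, this is `IsBoxSystem`. Its solution in
non-commuting power series is `f ⊠ g = g(aX) = f(Xh)` with `a_i = f^{[i]}(Xh)` and `h_i =
g_{[i]}(aX)`, where the shifts `f^{[i]}`, `g_{[i]}` strip a last, respectively a first, letter `i`.
For a triple product both bracketings lead to the same system for four families of series. The
system is contractive in the degree, hence has one solution, and associativity follows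
(`IsFactorPair.assoc`).

For the free product, let `κ = 𝓡(f)` be the cumulants of `f`. The sum `stackSum` extends `κ ⊠ g`
from the words `x_i y_i x_j y_j ⋯` to all words in the `x`'s and `y`'s. It restricts to `f` and `g`
on one-coloured words and vanishes at products of centered words of alternating colours
(`centered_stackSum`). Multiplied out, this vanishing is exactly the recursion that defines the free
product.

The Lie theoretic part uses only that the laws are natural in the ring, unital, and unitriangular
for the length of words (`Law.IsUnipotent`). By unitriangularity, integral curves are found one word
length at a time, `EXP` is unitriangular and hence bijective, and every bracket pushes supports to
longer words, so that the BCH series is finite in each co-ordinate. Naturality takes the place of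
calculus: derivatives are values over dual numbers, so a natural homomorphism such as `𝓡` carries
flows to flows and brackets to brackets through its differential (`map_isFlow`, `map_bracket`). This
gives the formula for `EXP` and `LOG` and the compatibility of the BCH laws. -/

namespace FreeMul

/-! ### Sums over non-crossing partitions of finite sets -/

section NoncrossingSums

variable {α : Type*} [LinearOrder α]

/-- `P` is the set of blocks of a non-crossing partition of `S`. -/
structure IsNCPart (P : Finset (Finset α)) (S : Finset α) : Prop where
  nonempty : ∀ B ∈ P, B.Nonempty
  subset : ∀ B ∈ P, B ⊆ S
  cover : ∀ x ∈ S, ∃ B ∈ P, x ∈ B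
  unique : ∀ B ∈ P, ∀ C ∈ P, ∀ x, x ∈ B → x ∈ C → B = C
  noncrossing : ∀ a b c d : α, a < b → b < c → c < d → ∀ U ∈ P, ∀ V ∈ P,
    a ∈ U → c ∈ U → b ∈ V → d ∈ V → U = V

open Classical in
/-- The non-crossing partitions of `S`. -/
noncomputable def ncParts (S : Finset α) : Finset (Finset (Finset α)) :=
  S.powerset.powerset.filter fun P => IsNCPart P S

theorem mem_ncParts {S : Finset α} {P : Finset (Finset α)} : P ∈ ncParts S ↔ IsNCPart P S := by
  classical
  simp only [ncParts, mem_filter, mem_powerset, and_iff_right_iff_imp]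
  intro h B hB
  exact mem_powerset.2 (h.subset B hB)

/-- The chord from just after `i` to just after `j` separates no block of `P`. -/
def KrewerasRel (P : Finset (Finset α)) (i j : α) : Prop :=
  ∀ V ∈ P, ∀ a ∈ V, ∀ b ∈ V, ((i < a ↔ j < a) ↔ (i < b ↔ j < b))

theorem KrewerasRel.refl (P : Finset (Finset α)) (i : α) : KrewerasRel P i i := by
  intro V _ a _ b _
  simp

theorem KrewerasRel.symm {P : Finset (Finset α)} {i j : α} (h : KrewerasRel P i j) :
    KrewerasRel P j i := by
  intro V hV a ha b hb
  have := h V hV a ha b hb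
  tauto

open Classical in
/-- The classes of `KrewerasRel P` on `W`. -/
noncomputable def krewerasClasses (W : Finset α) (P : Finset (Finset α)) : Finset (Finset α) :=
  W.image fun x => W.filter fun y => KrewerasRel P x y

theorem krewerasClasses_union {W₁ W₂ : Finset α} {P P₁ P₂ : Finset (Finset α)}
    (h₁ : ∀ i ∈ W₁, ∀ j ∈ W₁, KrewerasRel P i j ↔ KrewerasRel P₁ i j)
    (h₂ : ∀ i ∈ W₂, ∀ j ∈ W₂, KrewerasRel P i j ↔ KrewerasRel P₂ i j)
    (h : ∀ i ∈ W₁, ∀ j ∈ W₂, ¬ KrewerasRel P i j) :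
    krewerasClasses (W₁ ∪ W₂) P = krewerasClasses W₁ P₁ ∪ krewerasClasses W₂ P₂ := by
  classical
  unfold krewerasClasses
  rw [image_union]
  congr 1
  · refine image_congr fun x hx => ?_
    ext y
    simp only [mem_filter, mem_union]
    constructor
    · rintro ⟨hy | hy, hxy⟩
      · exact ⟨hy, (h₁ x hx y hy).1 hxy⟩
      · exact absurd hxy (h x hx y hy)
    · rintro ⟨hy, hxy⟩
      exact ⟨Or.inl hy, (h₁ x hx y hy).2 hxy⟩
  · refine image_congr fun x hx => ?_
    ext y
    simp only [mem_filter, mem_union]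
    constructor
    · rintro ⟨hy | hy, hxy⟩
      · exact absurd hxy.symm (h y hy x hx)
      · exact ⟨hy, (h₂ x hx y hy).1 hxy⟩
    · rintro ⟨hy, hxy⟩
      exact ⟨Or.inr hy, (h₂ x hx y hy).2 hxy⟩

theorem disjoint_krewerasClasses {W₁ W₂ : Finset α} (P₁ P₂ : Finset (Finset α))
    (h : Disjoint W₁ W₂) : Disjoint (krewerasClasses W₁ P₁) (krewerasClasses W₂ P₂) := by
  classical
  rw [disjoint_left]
  intro C h1 h2
  simp only [krewerasClasses, mem_image] at h1 h2
  obtain ⟨x, hx, rfl⟩ := h1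
  obtain ⟨y, hy, e⟩ := h2
  have : x ∈ W₂.filter fun z => KrewerasRel P₂ y z := by
    rw [e]; exact mem_filter.2 ⟨hx, KrewerasRel.refl _ _⟩
  exact disjoint_left.1 h hx (mem_filter.1 this).1

theorem krewerasClasses_congr {W : Finset α} {P P' : Finset (Finset α)}
    (h : ∀ i ∈ W, ∀ j ∈ W, KrewerasRel P i j ↔ KrewerasRel P' i j) :
    krewerasClasses W P = krewerasClasses W P' := by
  classical
  unfold krewerasClasses
  refine image_congr fun x hx => ?_
  ext y
  simp only [mem_filter]
  exact and_congr_right fun hy => h x hx y hy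

variable {R : Type*} [CommRing R] (F G : Finset α → R)

/-- The sum over the non-crossing partitions of `S` of the product of the weights `F` of the
blocks and the weights `G` of the classes of the complement on `Q ∪ S`. -/
noncomputable def ncSum (Q S : Finset α) : R :=
  ∑ P ∈ ncParts S, (∏ B ∈ P, F B) * ∏ C ∈ krewerasClasses (Q ∪ S) P, G C

open Classical in
/-- The analogue of `ncSum` for `insert m S`, where the block of `m` is enlarged by `V`. -/
noncomputable def ncSumOpen (V Q : Finset α) (m : α) (S : Finset α) : R :=
  ∑ P ∈ ncParts (insert m S), (∏ B ∈ P, F (if m ∈ B then V ∪ B else B)) *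
    ∏ C ∈ krewerasClasses (Q ∪ insert m S) P, G C

theorem ncSum_insert (Q S : Finset α) (m : α) :
    ncSum F G Q (insert m S) = ncSumOpen F G ∅ Q m S := by
  simp [ncSum, ncSumOpen]

theorem ncParts_empty : ncParts (∅ : Finset α) = {∅} := by
  ext P
  rw [mem_ncParts, mem_singleton]
  constructor
  · intro h
    rw [eq_empty_iff_forall_notMem]
    intro B hB
    obtain ⟨x, hx⟩ := h.nonempty B hB
    simpa using h.subset B hB hx
  · rintro rfl
    constructor <;> simp

/-- Without blocks nothing is separated, so `Q` is a single class. For empty `Q` there would be no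
class at all, and the sum would be `1`. -/
theorem ncSum_empty {Q : Finset α} (hQ : Q.Nonempty) : ncSum F G Q ∅ = G Q := by
  classical
  have : krewerasClasses Q (∅ : Finset (Finset α)) = {Q} := by
    ext C
    simp only [krewerasClasses, KrewerasRel, mem_image, mem_singleton]
    constructor
    · rintro ⟨x, _, rfl⟩
      simp
    · rintro rfl
      obtain ⟨x, hx⟩ := hQ
      exact ⟨x, hx, by simp⟩
  simp [ncSum, ncParts_empty, this]

/-- `k` is the successor of `m` in its block. -/
def IsNextInBlock (P : Finset (Finset α)) (m k : α) : Prop :=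
  ∃ B ∈ P, m ∈ B ∧ k ∈ B ∧ ∀ x ∈ B, x = m ∨ k ≤ x

open Classical in
/-- A sum over the non-crossing partitions of `insert m S`, split according to the successor
of the minimum `m` in its block. -/
theorem sum_ncParts_insert {S : Finset α} {m : α} (hm : ∀ x ∈ S, m < x)
    (X : Finset (Finset α) → R) :
    ∑ P ∈ ncParts (insert m S), X P =
      ∑ P ∈ (ncParts (insert m S)).filter (fun P => {m} ∈ P), X P +
      ∑ k ∈ S, ∑ P ∈ (ncParts (insert m S)).filter (fun P => IsNextInBlock P m k), X P := by
  simp_rw [sum_filter]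
  rw [sum_comm, ← sum_add_distrib]
  refine sum_congr rfl fun P hP => ?_
  rw [mem_ncParts] at hP
  obtain ⟨B, hB, hmB⟩ := hP.cover m (mem_insert_self _ _)
  by_cases h : B = {m}
  · subst h
    rw [if_pos hB, sum_eq_zero, add_zero]
    intro k hk
    rw [if_neg]
    rintro ⟨C, hC, hmC, hkC, -⟩
    have := hP.unique _ hB _ hC m (by simp) hmC
    subst this
    have := hm k hk
    simp_all
  · have hne : (B.erase m).Nonempty := by
      rw [nonempty_iff_ne_empty]
      intro h0
      rw [erase_eq_empty_iff] at h0
      rcases h0 with rfl | h0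
      · simp at hmB
      · exact h h0
    have hmS : {m} ∉ P := fun h' => h (hP.unique _ hB _ h' m hmB (by simp))
    set k := (B.erase m).min' hne with hk
    have hkB : k ∈ B.erase m := min'_mem _ _
    have hkS : k ∈ S := by
      have := hP.subset B hB (mem_of_mem_erase hkB)
      exact mem_of_mem_insert_of_ne this (ne_of_mem_erase hkB)
    rw [if_neg hmS, zero_add, sum_eq_single k, if_pos]
    · refine ⟨B, hB, hmB, mem_of_mem_erase hkB, fun x hx => ?_⟩
      by_cases hxm : x = m
      · exact Or.inl hxm
      · exact Or.inr (min'_le _ _ (mem_erase.2 ⟨hxm, hx⟩))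
    · intro l hl hlk
      rw [if_neg]
      rintro ⟨C, hC, hmC, hlC, hmin⟩
      have := hP.unique _ hB _ hC m hmB hmC
      subst this
      apply hlk
      apply le_antisymm
      · rcases hmin k (mem_of_mem_erase hkB) with h' | h'
        · exact absurd h' (ne_of_mem_erase hkB)
        · exact h'
      · exact min'_le _ _ (mem_erase.2 ⟨(hm l hl).ne', hlC⟩)
    · intro h'
      exact absurd hkS h'

end NoncrossingSums

/-! ### Removing the minimum: a singleton block, or a cut at its successor -/

section NoncrossingSums

variable {α : Type*} [LinearOrder α]

theorem IsNCPart.erase_singleton {P : Finset (Finset α)} {S : Finset α} {m : α}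
    (hm : ∀ x ∈ S, m < x) (h : IsNCPart P (insert m S)) (hP : {m} ∈ P) :
    IsNCPart (P.erase {m}) S := by
  have key : ∀ B ∈ P.erase {m}, m ∉ B := fun B hB hmB =>
    (mem_erase.1 hB).1 (h.unique _ (mem_erase.1 hB).2 _ hP m hmB (by simp))
  constructor
  · exact fun B hB => h.nonempty B (mem_of_mem_erase hB)
  · intro B hB x hx
    refine mem_of_mem_insert_of_ne (h.subset B (mem_of_mem_erase hB) hx) ?_
    rintro rfl
    exact key B hB hx
  · intro x hx
    obtain ⟨B, hB, hxB⟩ := h.cover x (mem_insert_of_mem hx)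
    refine ⟨B, mem_erase.2 ⟨?_, hB⟩, hxB⟩
    rintro rfl
    exact absurd (mem_singleton.1 hxB) (hm x hx).ne'
  · exact fun B hB C hC => h.unique B (mem_of_mem_erase hB) C (mem_of_mem_erase hC)
  · exact fun a b c d hab hbc hcd U hU V hV =>
      h.noncrossing a b c d hab hbc hcd U (mem_of_mem_erase hU) V (mem_of_mem_erase hV)

theorem IsNCPart.insert_singleton {P : Finset (Finset α)} {S : Finset α} {m : α}
    (hm : ∀ x ∈ S, m < x) (h : IsNCPart P S) : IsNCPart (insert {m} P) (insert m S) := by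
  have key : ∀ B ∈ P, m ∉ B := fun B hB hmB => lt_irrefl _ (hm m (h.subset B hB hmB))
  constructor
  · intro B hB
    rcases mem_insert.1 hB with rfl | hB
    · simp
    · exact h.nonempty B hB
  · intro B hB
    rcases mem_insert.1 hB with rfl | hB
    · simp
    · exact (h.subset B hB).trans (subset_insert _ _)
  · intro x hx
    rcases mem_insert.1 hx with rfl | hx
    · exact ⟨{x}, by simp, by simp⟩
    · obtain ⟨B, hB, hxB⟩ := h.cover x hx
      exact ⟨B, mem_insert_of_mem hB, hxB⟩
  · intro B hB C hC x hxB hxC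
    rcases mem_insert.1 hB with rfl | kB <;> rcases mem_insert.1 hC with rfl | kC
    · rfl
    · rw [mem_singleton] at hxB
      subst hxB
      exact absurd hxC (key C kC)
    · rw [mem_singleton] at hxC
      subst hxC
      exact absurd hxB (key B kB)
    · exact h.unique B kB C kC x hxB hxC
  · intro a b c d hab hbc hcd U hU V hV ha hc hb hd
    rcases mem_insert.1 hU with rfl | hU
    · rw [mem_singleton] at ha hc
      exact absurd (hab.trans hbc) (by simp [ha, hc])
    rcases mem_insert.1 hV with rfl | hV
    · rw [mem_singleton] at hb hd
      exact absurd (hbc.trans hcd) (by simp [hb, hd])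
    exact h.noncrossing a b c d hab hbc hcd U hU V hV ha hc hb hd

theorem krewerasRel_insert_singleton (P : Finset (Finset α)) (m i j : α) :
    KrewerasRel (insert {m} P) i j ↔ KrewerasRel P i j := by
  simp [KrewerasRel]

variable {R : Type*} [CommRing R] (F G : Finset α → R)

-- A singleton block separates nothing, so its removal leaves the complement relation unchanged. The
-- point `m` survives only as a point of the complement and joins `Q`.
open Classical in
theorem sum_filter_singleton_mem {S : Finset α} {m : α} (hm : ∀ x ∈ S, m < x) (V Q : Finset α) :
    ∑ P ∈ (ncParts (insert m S)).filter (fun P => {m} ∈ P),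
      (∏ B ∈ P, F (if m ∈ B then V ∪ B else B)) *
        ∏ C ∈ krewerasClasses (Q ∪ insert m S) P, G C =
      F (V ∪ {m}) * ncSum F G (insert m Q) S := by
  rw [ncSum, mul_sum]
  refine sum_nbij' (fun P => P.erase {m}) (fun P => insert {m} P) ?_ ?_ ?_ ?_ ?_
  · intro P hP
    rw [mem_filter, mem_ncParts] at hP
    exact mem_ncParts.2 (hP.1.erase_singleton hm hP.2)
  · intro P hP
    rw [mem_ncParts] at hP
    rw [mem_filter, mem_ncParts]
    exact ⟨hP.insert_singleton hm, mem_insert_self _ _⟩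
  · intro P hP
    exact insert_erase (mem_filter.1 hP).2
  · intro P hP
    rw [mem_ncParts] at hP
    refine erase_insert fun h => ?_
    exact lt_irrefl _ (hm m (hP.subset _ h (by simp)))
  · intro P hP
    rw [mem_filter, mem_ncParts] at hP
    have h2 := hP.1.erase_singleton hm hP.2
    rw [← mul_prod_erase P _ hP.2, if_pos (mem_singleton_self m), mul_assoc]
    congr 2
    · refine prod_congr rfl fun B hB => ?_
      rw [if_neg]
      exact fun hmB => lt_irrefl _ (hm m (h2.subset B hB hmB))
    · rw [show Q ∪ insert m S = insert m Q ∪ S by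
        rw [union_insert, insert_union]]
      refine prod_congr (krewerasClasses_congr fun i _ j _ => ?_) fun _ _ => rfl
      conv_lhs => rw [← insert_erase hP.2]
      exact krewerasRel_insert_singleton _ _ _ _

/-- Add `m` to the block containing `k`. -/
def glue (m k : α) (B : Finset α) : Finset α := if k ∈ B then insert m B else B

theorem mem_glue {m k x : α} {B : Finset α} : x ∈ glue m k B ↔ x ∈ B ∨ (x = m ∧ k ∈ B) := by
  unfold glue
  split_ifs with h <;> simp [h, or_comm]

theorem erase_glue {m k : α} {B : Finset α} (h : m ∉ B) : (glue m k B).erase m = B := by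
  unfold glue
  split_ifs <;> simp [h]

section Split

variable {S : Finset α} {m k : α} (hm : ∀ x ∈ S, m < x) (hk : k ∈ S)
include hm hk

theorem IsNCPart.join {P₁ P₂ : Finset (Finset α)} (h₁ : IsNCPart P₁ (S.filter (· < k)))
    (h₂ : IsNCPart P₂ (insert k (S.filter (k < ·)))) :
    IsNCPart (P₁ ∪ P₂.image (glue m k)) (insert m S) := by
  have hmk := hm k hk
  have b₁ : ∀ B ∈ P₁, ∀ x ∈ B, x ∈ S ∧ x < k := fun B hB x hx =>
    mem_filter.1 (h₁.subset B hB hx)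
  have b₂ : ∀ B ∈ P₂, ∀ x ∈ B, x ∈ S ∧ k ≤ x := fun B hB x hx => by
    rcases mem_insert.1 (h₂.subset B hB hx) with rfl | h
    · exact ⟨hk, le_rfl⟩
    · exact ⟨(mem_filter.1 h).1, (mem_filter.1 h).2.le⟩
  have g₂ : ∀ B ∈ P₂, ∀ x ∈ glue m k B, x = m ∨ k ≤ x := fun B hB x hx => by
    rcases mem_glue.1 hx with h | h
    · exact Or.inr (b₂ B hB x h).2
    · exact Or.inl h.1
  have hkm : ∀ B ∈ P₂, m ∈ glue m k B → k ∈ B := fun B hB h => by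
    rcases mem_glue.1 h with h | h
    · exact absurd (b₂ B hB m h).2 hmk.not_ge
    · exact h.2
  have hx1 : ∀ B ∈ P₁, ∀ C ∈ P₂, ∀ x, x ∈ B → x ∉ glue m k C := by
    intro B hB C hC x hx hx'
    have h1 := b₁ B hB x hx
    rcases g₂ C hC x hx' with rfl | h
    · exact lt_irrefl _ (hm _ h1.1)
    · exact absurd h h1.2.not_ge
  constructor
  · intro B hB
    rcases mem_union.1 hB with hB | hB
    · exact h₁.nonempty B hB
    · obtain ⟨C, hC, rfl⟩ := mem_image.1 hB
      obtain ⟨x, hx⟩ := h₂.nonempty C hC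
      exact ⟨x, mem_glue.2 (Or.inl hx)⟩
  · intro B hB x hx
    rcases mem_union.1 hB with hB | hB
    · exact mem_insert_of_mem (b₁ B hB x hx).1
    · obtain ⟨C, hC, rfl⟩ := mem_image.1 hB
      rcases mem_glue.1 hx with h | h
      · exact mem_insert_of_mem (b₂ C hC x h).1
      · rw [h.1]; exact mem_insert_self _ _
  · intro x hx
    rcases mem_insert.1 hx with rfl | hx
    · obtain ⟨B, hB, hkB⟩ := h₂.cover k (mem_insert_self _ _)
      exact ⟨_, mem_union_right _ (mem_image_of_mem _ hB), mem_glue.2 (Or.inr ⟨rfl, hkB⟩)⟩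
    · rcases lt_or_ge x k with h | h
      · obtain ⟨B, hB, hxB⟩ := h₁.cover x (mem_filter.2 ⟨hx, h⟩)
        exact ⟨B, mem_union_left _ hB, hxB⟩
      · obtain ⟨B, hB, hxB⟩ := h₂.cover x (by
          rcases h.eq_or_lt with rfl | h
          · exact mem_insert_self _ _
          · exact mem_insert_of_mem (mem_filter.2 ⟨hx, h⟩))
        exact ⟨_, mem_union_right _ (mem_image_of_mem _ hB), mem_glue.2 (Or.inl hxB)⟩
  · intro B hB C hC x hxB hxC
    rcases mem_union.1 hB with hB | hB <;> rcases mem_union.1 hC with hC | hC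
    · exact h₁.unique B hB C hC x hxB hxC
    · obtain ⟨C, kC, rfl⟩ := mem_image.1 hC
      exact absurd hxC (hx1 B hB C kC x hxB)
    · obtain ⟨B, kB, rfl⟩ := mem_image.1 hB
      exact absurd hxB (hx1 C hC B kB x hxC)
    · obtain ⟨C, kC, rfl⟩ := mem_image.1 hC
      obtain ⟨B, kB, rfl⟩ := mem_image.1 hB
      congr 1
      rcases mem_glue.1 hxB with h | ⟨rfl, h⟩
      · rcases mem_glue.1 hxC with h' | ⟨rfl, h'⟩
        · exact h₂.unique B kB C kC x h h'
        · exact absurd (b₂ B kB _ h).2 hmk.not_ge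
      · exact h₂.unique B kB C kC k h (hkm C kC hxC)
  · intro a b c d hab hbc hcd U hU V hV ha hc hb hd
    rcases mem_union.1 hU with hU | hU <;> rcases mem_union.1 hV with hV | hV
    · exact h₁.noncrossing a b c d hab hbc hcd U hU V hV ha hc hb hd
    · obtain ⟨V, kV, rfl⟩ := mem_image.1 hV
      have h1 := b₁ U hU a ha
      have h2 := b₁ U hU c hc
      rcases g₂ V kV b hb with rfl | h
      · exact absurd (hm a h1.1) hab.not_gt
      · exact absurd (hbc.trans h2.2) h.not_gt
    · obtain ⟨U, kU, rfl⟩ := mem_image.1 hU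
      have h1 := b₁ V hV b hb
      have h2 := b₁ V hV d hd
      rcases g₂ U kU c hc with rfl | h
      · exact absurd (hm b h1.1) hbc.not_gt
      · exact absurd (hcd.trans h2.2) h.not_gt
    · obtain ⟨U, kU, rfl⟩ := mem_image.1 hU
      obtain ⟨V, kV, rfl⟩ := mem_image.1 hV
      have hmin : ∀ B ∈ P₂, ∀ x ∈ glue m k B, m ≤ x := fun B hB x hx => by
        rcases g₂ B hB x hx with rfl | h
        · exact le_rfl
        · exact hmk.le.trans h
      have hpure : ∀ B ∈ P₂, ∀ x ∈ glue m k B, m < x → x ∈ B := fun B hB x hx hlt => by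
        rcases mem_glue.1 hx with h | ⟨rfl, -⟩
        · exact h
        · exact absurd hlt (lt_irrefl _)
      have hmb := (hmin U kU a ha).trans_lt hab
      have hb' := hpure V kV b hb hmb
      have hc' := hpure U kU c hc (hmb.trans hbc)
      have hd' := hpure V kV d hd ((hmb.trans hbc).trans hcd)
      congr 1
      rcases mem_glue.1 ha with h | ⟨rfl, h⟩
      · exact h₂.noncrossing a b c d hab hbc hcd U kU V kV h hc' hb' hd'
      -- Only the first of the four points can be `m`. Before gluing, `k` lies in the block in
      -- question and takes the place of `m` in the crossing, unless `b = k`, when the two blocks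
      -- meet.
      · rcases (b₂ V kV b hb').2.eq_or_lt with rfl | hkb
        · exact h₂.unique U kU V kV _ h hb'
        · exact h₂.noncrossing k b c d hkb hbc hcd U kU V kV h hc' hb' hd'

omit hm hk in
theorem isNextInBlock_join {P₁ P₂ : Finset (Finset α)}
    (h₂ : IsNCPart P₂ (insert k (S.filter (k < ·)))) :
    IsNextInBlock (P₁ ∪ P₂.image (glue m k)) m k := by
  obtain ⟨B, hB, hkB⟩ := h₂.cover k (mem_insert_self _ _)
  refine ⟨_, mem_union_right _ (mem_image_of_mem _ hB), mem_glue.2 (Or.inr ⟨rfl, hkB⟩),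
    mem_glue.2 (Or.inl hkB), fun x hx => ?_⟩
  rcases mem_glue.1 hx with h | h
  · right
    rcases mem_insert.1 (h₂.subset B hB h) with rfl | h
    · exact le_rfl
    · exact (mem_filter.1 h).2.le
  · exact Or.inl h.1

/-- A block with points on both sides of `k`, other than the block of `m`, would cross the arc from
`m` to `k`. Hence every block lies either under the arc or outside it. -/
theorem IsNCPart.dichotomy {P : Finset (Finset α)} (h : IsNCPart P (insert m S))
    (hn : IsNextInBlock P m k) {B : Finset α} (hB : B ∈ P) :
    (B ⊆ S.filter (· < k)) ∨ ((∀ x ∈ B, x = m ∨ (x ∈ S ∧ k ≤ x)) ∧ ∃ x ∈ B, k ≤ x) := by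
  obtain ⟨A, hA, hmA, hkA, hAmin⟩ := hn
  have hmk := hm k hk
  by_cases hBA : B = A
  · subst hBA
    refine Or.inr ⟨fun x hx => ?_, k, hkA, le_rfl⟩
    rcases hAmin x hx with rfl | h'
    · exact Or.inl rfl
    · rcases mem_insert.1 (h.subset _ hB hx) with rfl | h''
      · exact Or.inl rfl
      · exact Or.inr ⟨h'', h'⟩
  · have hmB : ∀ x ∈ B, x ∈ S := fun x hx => by
      rcases mem_insert.1 (h.subset _ hB hx) with rfl | h''
      · exact absurd (h.unique B hB A hA _ hx hmA) hBA
      · exact h''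
    have hkB : k ∉ B := fun hx => hBA (h.unique B hB A hA _ hx hkA)
    by_cases hex : ∃ x ∈ B, k ≤ x
    · refine Or.inr ⟨fun x hx => Or.inr ⟨hmB x hx, ?_⟩, hex⟩
      by_contra hlt
      obtain ⟨y, hy, hky⟩ := hex
      have hky' : k < y := hky.lt_of_ne (fun e => hkB (e ▸ hy))
      exact hBA (h.noncrossing m x k y (hm x (hmB x hx)) (not_le.1 hlt) hky' A hA B hB hmA hkA
        hx hy).symm
    · left
      intro x hx
      refine mem_filter.2 ⟨hmB x hx, ?_⟩
      by_contra hge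
      exact hex ⟨x, hx, not_lt.1 hge⟩

theorem IsNCPart.left {P : Finset (Finset α)} (h : IsNCPart P (insert m S))
    (hn : IsNextInBlock P m k) :
    IsNCPart (P.filter (· ⊆ S.filter (· < k))) (S.filter (· < k)) := by
  constructor
  · exact fun B hB => h.nonempty B (mem_filter.1 hB).1
  · exact fun B hB => (mem_filter.1 hB).2
  · intro x hx
    obtain ⟨B, hB, hxB⟩ := h.cover x (mem_insert_of_mem (mem_filter.1 hx).1)
    refine ⟨B, mem_filter.2 ⟨hB, ?_⟩, hxB⟩
    rcases h.dichotomy hm hk hn hB with h' | h'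
    · exact h'
    · rcases h'.1 x hxB with rfl | h''
      · exact absurd (hm _ (mem_filter.1 hx).1) (lt_irrefl _)
      · exact absurd (mem_filter.1 hx).2 h''.2.not_gt
  · exact fun B hB C hC => h.unique B (mem_filter.1 hB).1 C (mem_filter.1 hC).1
  · exact fun a b c d hab hbc hcd U hU V hV =>
      h.noncrossing a b c d hab hbc hcd U (mem_filter.1 hU).1 V (mem_filter.1 hV).1

theorem IsNCPart.right {P : Finset (Finset α)} (h : IsNCPart P (insert m S))
    (hn : IsNextInBlock P m k) :
    IsNCPart ((P.filter (¬ · ⊆ S.filter (· < k))).image (fun B => B.erase m))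
      (insert k (S.filter (k < ·))) := by
  have hmk := hm k hk
  have key : ∀ B ∈ P.filter (¬ · ⊆ S.filter (· < k)),
      B ∈ P ∧ (∀ x ∈ B, x = m ∨ (x ∈ S ∧ k ≤ x)) ∧ ∃ x ∈ B, k ≤ x := fun B hB =>
    ⟨(mem_filter.1 hB).1,
      (h.dichotomy hm hk hn (mem_filter.1 hB).1).resolve_left (mem_filter.1 hB).2⟩
  constructor
  · intro C hC
    obtain ⟨B, hB, rfl⟩ := mem_image.1 hC
    obtain ⟨x, hx, hkx⟩ := (key B hB).2.2
    exact ⟨x, mem_erase.2 ⟨(hmk.trans_le hkx).ne', hx⟩⟩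
  · intro C hC x hx
    obtain ⟨B, hB, rfl⟩ := mem_image.1 hC
    rw [mem_erase] at hx
    obtain ⟨h1, h2⟩ := ((key B hB).2.1 x hx.2).resolve_left hx.1
    rcases h2.eq_or_lt with rfl | h2
    · exact mem_insert_self _ _
    · exact mem_insert_of_mem (mem_filter.2 ⟨h1, h2⟩)
  · intro x hx
    have hx' : x ∈ S ∧ k ≤ x := by
      rcases mem_insert.1 hx with rfl | hx
      · exact ⟨hk, le_rfl⟩
      · exact ⟨(mem_filter.1 hx).1, (mem_filter.1 hx).2.le⟩
    obtain ⟨B, hB, hxB⟩ := h.cover x (mem_insert_of_mem hx'.1)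
    refine ⟨B.erase m, mem_image_of_mem _ (mem_filter.2 ⟨hB, fun hs => ?_⟩),
      mem_erase.2 ⟨(hm x hx'.1).ne', hxB⟩⟩
    exact absurd (mem_filter.1 (hs hxB)).2 hx'.2.not_gt
  · intro C hC C' hC' x hx hx'
    obtain ⟨B, hB, rfl⟩ := mem_image.1 hC
    obtain ⟨B', hB', rfl⟩ := mem_image.1 hC'
    rw [h.unique B (key B hB).1 B' (key B' hB').1 x (mem_of_mem_erase hx) (mem_of_mem_erase hx')]
  · intro a b c d hab hbc hcd U hU V hV ha hc hb hd
    obtain ⟨B, hB, rfl⟩ := mem_image.1 hU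
    obtain ⟨B', hB', rfl⟩ := mem_image.1 hV
    rw [h.noncrossing a b c d hab hbc hcd B (key B hB).1 B' (key B' hB').1 (mem_of_mem_erase ha)
      (mem_of_mem_erase hc) (mem_of_mem_erase hb) (mem_of_mem_erase hd)]

end Split

end NoncrossingSums

/-! ### The complement across the cut, and the resulting recursion -/

section NoncrossingSums

variable {α : Type*} [LinearOrder α]

section Split

variable {S : Finset α} {m k : α} (hm : ∀ x ∈ S, m < x) (hk : k ∈ S)
include hm hk

/-- A complement point sits just after the point of the same name. So the one of `m` lies under the
arc from `m` to `k`, together with those of `S` below `k`, while the one of `k` lies outside; the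
arc separates the two groups. Points outside cannot tell `m` from `k`, so gluing `m` changes no
relation among them, and `Q` may be continued beyond the arc. -/
theorem krewerasClasses_join {P₁ P₂ : Finset (Finset α)} {Q : Finset α}
    (hQ : ∀ x ∈ Q, x < m) (h₁ : IsNCPart P₁ (S.filter (· < k)))
    (h₂ : IsNCPart P₂ (insert k (S.filter (k < ·)))) :
    krewerasClasses (Q ∪ insert m S) (P₁ ∪ P₂.image (glue m k)) =
      krewerasClasses ({m} ∪ S.filter (· < k)) P₁ ∪
        krewerasClasses (Q ∪ insert k (S.filter (k < ·))) P₂ := by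
  have hmk := hm k hk
  have b₁ : ∀ B ∈ P₁, ∀ x ∈ B, x ∈ S ∧ x < k := fun B hB x hx =>
    mem_filter.1 (h₁.subset B hB hx)
  have b₂ : ∀ B ∈ P₂, ∀ x ∈ B, k ≤ x := fun B hB x hx => by
    rcases mem_insert.1 (h₂.subset B hB hx) with rfl | h
    · exact le_rfl
    · exact (mem_filter.1 h).2.le
  have w₁ : ∀ x ∈ {m} ∪ S.filter (· < k), m ≤ x ∧ x < k := fun x hx => by
    rcases mem_union.1 hx with h | h
    · rw [mem_singleton.1 h]; exact ⟨le_rfl, hmk⟩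
    · exact ⟨(hm x (mem_filter.1 h).1).le, (mem_filter.1 h).2⟩
  have w₂ : ∀ x ∈ Q ∪ insert k (S.filter (k < ·)), x < m ∨ k ≤ x := fun x hx => by
    rcases mem_union.1 hx with h | h
    · exact Or.inl (hQ x h)
    · rcases mem_insert.1 h with rfl | h
      · exact Or.inr le_rfl
      · exact Or.inr (mem_filter.1 h).2.le
  have hW : Q ∪ insert m S =
      ({m} ∪ S.filter (· < k)) ∪ (Q ∪ insert k (S.filter (k < ·))) := by
    ext x
    simp only [mem_union, mem_insert, mem_filter, mem_singleton]
    rcases lt_trichotomy x k with h | h | h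
    · simp [h, h.ne, h.not_gt]; tauto
    · subst h; simp [hk]
    · simp [h, h.ne', h.not_gt]; tauto
  rw [hW]
  refine krewerasClasses_union (fun i hi j hj => ?_) (fun i hi j hj => ?_) fun i hi j hj => ?_
  · constructor
    · exact fun h V hV => h V (mem_union_left _ hV)
    · intro h V hV a ha b hb
      rcases mem_union.1 hV with hV | hV
      · exact h V hV a ha b hb
      · obtain ⟨C, hC, rfl⟩ := mem_image.1 hV
        have key : ∀ a ∈ glue m k C, (i < a ↔ j < a) := fun a ha => by
          rcases mem_glue.1 ha with h' | ⟨rfl, -⟩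
          · have h1 := b₂ C hC a h'
            simp [(w₁ i hi).2.trans_le h1, (w₁ j hj).2.trans_le h1]
          · simp [(w₁ i hi).1.not_gt, (w₁ j hj).1.not_gt]
        simp [key a ha, key b hb]
  · constructor
    · intro h V hV a ha b hb
      exact h _ (mem_union_right _ (mem_image_of_mem _ hV)) a (mem_glue.2 (Or.inl ha)) b
        (mem_glue.2 (Or.inl hb))
    · intro h V hV a ha b hb
      have conv : ∀ i ∈ Q ∪ insert k (S.filter (k < ·)), (i < m ↔ i < k) := fun i hi => by
        rcases w₂ i hi with h | h
        · simp [h, h.trans hmk]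
        · simp [h.not_gt, (hmk.trans_le h).not_gt]
      rcases mem_union.1 hV with hV | hV
      · have key : ∀ i ∈ Q ∪ insert k (S.filter (k < ·)), ∀ a ∈ V, (i < a ↔ i < m) :=
          fun i hi a ha => by
            have h1 := b₁ V hV a ha
            rcases w₂ i hi with h | h
            · simp [h, h.trans (hm a h1.1)]
            · simp [(hmk.trans_le h).not_gt, (h1.2.trans_le h).not_gt]
        simp [key i hi a ha, key j hj a ha, key i hi b hb, key j hj b hb]
      · obtain ⟨C, hC, rfl⟩ := mem_image.1 hV
        rcases mem_glue.1 ha with ka | ⟨rfl, ka⟩ <;> rcases mem_glue.1 hb with kb | ⟨rfl, kb⟩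
        · exact h C hC a ka b kb
        · rw [conv i hi, conv j hj]
          exact h C hC a ka k kb
        · rw [conv i hi, conv j hj]
          exact h C hC k ka b kb
        · simp
  -- The chord from a point under the arc to a point outside separates `m` from `k`, which lie in
  -- one block.
  · intro h
    obtain ⟨B, hB, hkB⟩ := h₂.cover k (mem_insert_self _ _)
    have := h _ (mem_union_right _ (mem_image_of_mem _ hB)) m (mem_glue.2 (Or.inr ⟨rfl, hkB⟩)) k
      (mem_glue.2 (Or.inl hkB))
    have h1 := w₁ i hi
    rcases w₂ j hj with h2 | h2
    · simp [h1.1.not_gt, h1.2, h2, h2.trans hmk] at this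
    · simp [h1.1.not_gt, h1.2, h2.not_gt, (hmk.trans_le h2).not_gt] at this

variable {R : Type*} [CommRing R] (F G : Finset α → R)

-- Cutting along the arc from `m` to `k`: the inner partition has `m` as a bare complement point in
-- front, and the outer one is open at `k`, with `V ∪ {m}` as the part of the block already read.
open Classical in
theorem sum_filter_isNextInBlock {Q : Finset α} (hQ : ∀ x ∈ Q, x < m) (V : Finset α) :
    ∑ P ∈ (ncParts (insert m S)).filter (fun P => IsNextInBlock P m k),
      (∏ B ∈ P, F (if m ∈ B then V ∪ B else B)) *
        ∏ C ∈ krewerasClasses (Q ∪ insert m S) P, G C =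
      ncSum F G {m} (S.filter (· < k)) *
        ncSumOpen F G (V ∪ {m}) Q k (S.filter (k < ·)) := by
  have hmk := hm k hk
  have hmT : m ∉ insert k (S.filter (k < ·)) := by
    rw [mem_insert, mem_filter]
    rintro (h | h)
    · exact hmk.ne h
    · exact hmk.not_gt h.2
  rw [ncSum, ncSumOpen, sum_mul_sum, ← sum_product']
  symm
  have hdisj : ∀ P₁ P₂, IsNCPart P₁ (S.filter (· < k)) →
      IsNCPart P₂ (insert k (S.filter (k < ·))) → ∀ B ∈ P₂, ¬ glue m k B ⊆ S.filter (· < k) := by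
    intro P₁ P₂ h₁ h₂ B hB hs
    obtain ⟨x, hx⟩ := h₂.nonempty B hB
    have h1 := (mem_filter.1 (hs (mem_glue.2 (Or.inl hx)))).2
    rcases mem_insert.1 (h₂.subset B hB hx) with rfl | h
    · exact lt_irrefl _ h1
    · exact h1.not_gt (mem_filter.1 h).2
  have hnot : ∀ P₂, IsNCPart P₂ (insert k (S.filter (k < ·))) → ∀ B ∈ P₂, m ∉ B :=
    fun P₂ h₂ B hB h => hmT (h₂.subset B hB h)
  refine sum_nbij' (fun p => p.1 ∪ p.2.image (glue m k))
    (fun P => (P.filter (· ⊆ S.filter (· < k)),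
      (P.filter (¬ · ⊆ S.filter (· < k))).image (fun B => B.erase m))) ?_ ?_ ?_ ?_ ?_
  · rintro ⟨P₁, P₂⟩ hp
    simp only [mem_product, mem_ncParts] at hp
    rw [mem_filter, mem_ncParts]
    exact ⟨hp.1.join hm hk hp.2, isNextInBlock_join hp.2⟩
  · intro P hP
    rw [mem_filter, mem_ncParts] at hP
    rw [mem_product, mem_ncParts, mem_ncParts]
    exact ⟨hP.1.left hm hk hP.2, hP.1.right hm hk hP.2⟩
  · rintro ⟨P₁, P₂⟩ hp
    simp only [mem_product, mem_ncParts] at hp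
    obtain ⟨h₁, h₂⟩ := hp
    have hd := hdisj P₁ P₂ h₁ h₂
    refine Prod.ext ?_ ?_
    · ext B
      simp only [mem_filter, mem_union, mem_image]
      constructor
      · rintro ⟨h | ⟨C, hC, rfl⟩, hs⟩
        · exact h
        · exact absurd hs (hd C hC)
      · exact fun h => ⟨Or.inl h, h₁.subset B h⟩
    · ext B
      simp only [mem_filter, mem_union, mem_image]
      constructor
      · rintro ⟨C, ⟨h | ⟨D, hD, rfl⟩, hs⟩, rfl⟩
        · exact absurd (h₁.subset C h) hs
        · rwa [erase_glue (hnot P₂ h₂ D hD)]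
      · intro h
        exact ⟨_, ⟨Or.inr ⟨B, h, rfl⟩, hd B h⟩, erase_glue (hnot P₂ h₂ B h)⟩
  · intro P hP
    rw [mem_filter, mem_ncParts] at hP
    obtain ⟨h, hn⟩ := hP
    obtain ⟨A, hA, hmA, hkA, -⟩ := id hn
    rw [image_image]
    have : image ((glue m k) ∘ fun B => B.erase m) (P.filter (¬ · ⊆ S.filter (· < k))) =
        P.filter (¬ · ⊆ S.filter (· < k)) := by
      conv_rhs => rw [← image_id (s := P.filter (¬ · ⊆ S.filter (· < k)))]
      refine image_congr fun B hB => ?_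
      have hB' := (mem_filter.1 hB).1
      simp only [Function.comp, id, glue]
      by_cases hkB : k ∈ B
      · have := h.unique B hB' A hA k hkB hkA
        subst this
        rw [if_pos (mem_erase.2 ⟨hmk.ne', hkB⟩), insert_erase hmA]
      · rw [if_neg (fun h' => hkB (mem_of_mem_erase h')), erase_eq_of_notMem]
        intro hmB
        exact hkB (h.unique B hB' A hA m hmB hmA ▸ hkA)
    rw [this]
    exact filter_union_filter_not_eq _ _
  · rintro ⟨P₁, P₂⟩ hp
    simp only [mem_product, mem_ncParts] at hp
    obtain ⟨h₁, h₂⟩ := hp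
    have hd := hdisj P₁ P₂ h₁ h₂
    have hd1 : Disjoint P₁ (P₂.image (glue m k)) := by
      rw [disjoint_left]
      intro B hB hB'
      obtain ⟨C, hC, rfl⟩ := mem_image.1 hB'
      exact hd C hC (h₁.subset _ hB)
    have hinj : Set.InjOn (glue m k) P₂ := fun B hB C hC e => by
      rw [← erase_glue (k := k) (hnot P₂ h₂ B hB), e, erase_glue (hnot P₂ h₂ C hC)]
    have hd2 : Disjoint ({m} ∪ S.filter (· < k)) (Q ∪ insert k (S.filter (k < ·))) := by
      rw [disjoint_left]
      intro x hx hx'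
      simp only [mem_union, mem_singleton, mem_filter, mem_insert] at hx hx'
      rcases hx with rfl | hx
      · rcases hx' with h | h | h
        · exact lt_irrefl _ (hQ _ h)
        · exact hmk.ne h
        · exact hmk.not_gt h.2
      · rcases hx' with h | h | h
        · exact (hQ _ h).not_gt (hm _ hx.1)
        · exact hx.2.ne h
        · exact hx.2.not_gt h.2
    dsimp only
    rw [prod_union hd1, prod_image hinj, krewerasClasses_join hm hk hQ h₁ h₂,
      prod_union (disjoint_krewerasClasses _ _ hd2)]
    have e1 : ∏ B ∈ P₁, F (if m ∈ B then V ∪ B else B) = ∏ B ∈ P₁, F B := by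
      refine prod_congr rfl fun B hB => ?_
      rw [if_neg]
      exact fun h => lt_irrefl _ (hm m (mem_filter.1 (h₁.subset B hB h)).1)
    have e2 : ∏ B ∈ P₂, F (if m ∈ glue m k B then V ∪ glue m k B else glue m k B) =
        ∏ B ∈ P₂, F (if k ∈ B then V ∪ {m} ∪ B else B) := by
      refine prod_congr rfl fun B hB => ?_
      congr 1
      have hmB := hnot P₂ h₂ B hB
      unfold glue
      by_cases hkB : k ∈ B
      · simp only [hkB, if_true, mem_insert_self]
        rw [union_assoc]
        rfl
      · simp [hkB, hmB]
    rw [e1, e2]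
    ring

end Split

variable {R : Type*} [CommRing R] (F G : Finset α → R)

/-- All later arguments use non-crossing sums only through this recursion. Since only intervals of
`S` occur on the right, it can be read on words. -/
theorem ncSumOpen_eq {S Q : Finset α} {m : α} (hm : ∀ x ∈ S, m < x) (hQ : ∀ x ∈ Q, x < m)
    (V : Finset α) :
    ncSumOpen F G V Q m S = F (V ∪ {m}) * ncSum F G (insert m Q) S +
      ∑ k ∈ S, ncSum F G {m} (S.filter (· < k)) *
        ncSumOpen F G (V ∪ {m}) Q k (S.filter (k < ·)) := by
  classical
  conv_lhs => rw [ncSumOpen]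
  rw [sum_ncParts_insert hm, sum_filter_singleton_mem F G hm]
  congr 1
  refine sum_congr rfl fun k hk => ?_
  convert sum_filter_isNextInBlock hm hk F G hQ V

end NoncrossingSums

/-! ### The boxed convolution as a recursion on words -/

section Recursion

variable {A : Type*} {R : Type*} [CommRing R]

/-- The convolution of functions of words:
`conv a b w = ∑ a u * b v` over all factorizations `w = u ++ v`. -/
def conv (a b : List A → R) : List A → R
  | [] => a [] * b []
  | i :: u => a [] * b (i :: u) + conv (fun v => a (i :: v)) b u

/-- The recursion on words satisfied by sums over non-crossing partitions. In `N q u` the outer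
class of the complement is preceded by `q`, and in `M p q u` the first block is moreover
preceded by `p`. -/
structure IsBoxSystem (f g : List A → R) (N : List A → List A → R)
    (M : List A → List A → List A → R) : Prop where
  N_nil : ∀ q, N q [] = g q
  N_cons : ∀ q i u, N q (i :: u) = M [] q (i :: u)
  M_nil : ∀ p q, M p q [] = 0
  M_cons : ∀ p q i u, M p q (i :: u) =
    f (p ++ [i]) * N (q ++ [i]) u + conv (N [i]) (M (p ++ [i]) q) u

variable {α : Type*} [LinearOrder α] (w : α → A)

/-- The word with letters `w x`, for `x ∈ S` in increasing order. -/
def wordOn (S : Finset α) : List A := (S.sort (· ≤ ·)).map w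

@[simp]
theorem wordOn_empty : wordOn w (∅ : Finset α) = [] := by simp [wordOn]

@[simp]
theorem wordOn_singleton (m : α) : wordOn w {m} = [w m] := by simp [wordOn]

theorem wordOn_insert {S : Finset α} {m : α} (hm : ∀ x ∈ S, m < x) :
    wordOn w (insert m S) = w m :: wordOn w S := by
  rw [wordOn, sort_insert _ (fun b hb => (hm b hb).le) fun h => lt_irrefl _ (hm m h)]
  rfl

theorem wordOn_union {S T : Finset α} (h : ∀ x ∈ S, ∀ y ∈ T, x < y) :
    wordOn w (S ∪ T) = wordOn w S ++ wordOn w T := by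
  induction S using Finset.induction_on_min with
  | empty => simp
  | insert m S hm ih =>
    rw [insert_union, wordOn_insert w, wordOn_insert w hm,
      ih fun x hx => h x (mem_insert_of_mem hx), List.cons_append]
    intro x hx
    rcases mem_union.1 hx with hx | hx
    · exact hm x hx
    · exact h m (mem_insert_self _ _) x hx

/-- As `b [] = 0`, only factorizations with nonempty second factor count, and these are indexed by
its first letter. -/
theorem conv_wordOn (a b : List A → R) (hb : b [] = 0) (S : Finset α) :
    conv a b (wordOn w S) =
      ∑ k ∈ S, a (wordOn w (S.filter (· < k))) * b (w k :: wordOn w (S.filter (k < ·))) := by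
  induction S using Finset.induction_on_min generalizing a with
  | empty => simp [conv, hb]
  | insert m S hm ih =>
    rw [wordOn_insert w hm, conv, ih, sum_insert fun h => lt_irrefl _ (hm m h)]
    congr 1
    · congr 2
      · rw [filter_eq_empty_iff.2, wordOn_empty]
        intro x hx
        rcases mem_insert.1 hx with rfl | hx
        · exact lt_irrefl _
        · exact (hm x hx).not_gt
      · congr 2
        rw [filter_insert, if_neg (lt_irrefl _), filter_true_of_mem hm]
    · refine sum_congr rfl fun k hk => ?_
      rw [filter_insert, if_pos (hm k hk), filter_insert, if_neg (hm k hk).not_gt,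
        wordOn_insert w fun x hx => hm x (mem_filter.1 hx).1]

variable {w}

/-- The closed and the open sum obey the same recursion as `N` and `M`, each feeding the other, so
they are identified together. The case of `Q` and `S` both empty must be excluded: the sum is then
`1`, whereas `N [] [] = g []`. -/
theorem IsBoxSystem.ncSum_eq {f g : List A → R} {N : List A → List A → R}
    {M : List A → List A → List A → R} (h : IsBoxSystem f g N M) (n : ℕ) :
    ∀ S : Finset α, S.card = n →
      (∀ Q : Finset α, (∀ x ∈ Q, ∀ y ∈ S, x < y) → (Q.Nonempty ∨ S.Nonempty) →
        ncSum (fun B => f (wordOn w B)) (fun C => g (wordOn w C)) Q S =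
          N (wordOn w Q) (wordOn w S)) ∧
      (∀ (V Q : Finset α) (m : α), (∀ x ∈ S, m < x) → (∀ x ∈ Q, x < m) → (∀ x ∈ V, x < m) →
        ncSumOpen (fun B => f (wordOn w B)) (fun C => g (wordOn w C)) V Q m S =
          M (wordOn w V) (wordOn w Q) (w m :: wordOn w S)) := by
  induction n using Nat.strong_induction_on with
  | _ n ih =>
  intro S hS
  -- The open sum over `S` uses the closed sum over `S` itself, hence `≤ n`. The closed sum in turn
  -- needs open sums only after the minimum has been removed.
  have hN : ∀ S : Finset α, S.card ≤ n → ∀ Q : Finset α, (∀ x ∈ Q, ∀ y ∈ S, x < y) →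
      (Q.Nonempty ∨ S.Nonempty) →
        ncSum (fun B => f (wordOn w B)) (fun C => g (wordOn w C)) Q S =
          N (wordOn w Q) (wordOn w S) := by
    intro S hS Q hQ hne
    rcases S.eq_empty_or_nonempty with rfl | hSne
    · rw [ncSum_empty _ _ (hne.resolve_right (by simp)), wordOn_empty, h.N_nil]
    · have hmS := min'_mem S hSne
      have hlt : ∀ x ∈ S.erase (S.min' hSne), S.min' hSne < x := fun x hx =>
        min'_lt_of_mem_erase_min' _ _ hx
      have hcard : (S.erase (S.min' hSne)).card < n :=
        (card_erase_lt_of_mem hmS).trans_le hS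
      have := (ih _ hcard _ rfl).2 ∅ Q (S.min' hSne) hlt (fun x hx => hQ x hx _ hmS) (by simp)
      rw [← insert_erase hmS, ncSum_insert, this, wordOn_empty, wordOn_insert w hlt, h.N_cons]
  refine ⟨hN S hS.le, fun V Q m hm hQ hV => ?_⟩
  have hVm : wordOn w (V ∪ {m}) = wordOn w V ++ [w m] := by
    rw [wordOn_union w (fun x hx y hy => mem_singleton.1 hy ▸ hV x hx), wordOn_singleton]
  have hQm : wordOn w (insert m Q) = wordOn w Q ++ [w m] := by
    rw [insert_eq, union_comm, wordOn_union w (fun x hx y hy => mem_singleton.1 hy ▸ hQ x hx),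
      wordOn_singleton]
  rw [ncSumOpen_eq _ _ hm hQ, h.M_cons, conv_wordOn w _ _ (h.M_nil _ _), hVm,
    hN S hS.le (insert m Q) ?_ (Or.inl (insert_nonempty _ _)), hQm]
  · congr 1
    refine sum_congr rfl fun k hk => ?_
    have hmk := hm k hk
    rw [hN _ ((card_filter_le _ _).trans hS.le) {m} ?_ (Or.inl (singleton_nonempty _)),
      (ih _ ?_ (S.filter (k < ·)) rfl).2 _ _ _ ?_ ?_ ?_, hVm, wordOn_singleton]
    · rw [← hS]
      exact card_lt_card (filter_ssubset.2 ⟨k, hk, lt_irrefl _⟩)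
    · exact fun x hx => (mem_filter.1 hx).2
    · exact fun x hx => (hQ x hx).trans hmk
    · intro x hx
      rcases mem_union.1 hx with hx | hx
      · exact (hV x hx).trans hmk
      · exact mem_singleton.1 hx ▸ hmk
    · intro x hx y hy
      exact mem_singleton.1 hx ▸ hm y (mem_filter.1 hy).1
  · intro x hx y hy
    rcases mem_insert.1 hx with rfl | hx
    · exact hm y hy
    · exact (hQ x hx).trans (hm y hy)

end Recursion

theorem isNCPart_parts {n : ℕ} (π : Finpartition (univ : Finset (Fin n)))
    (h : IsNoncrossing π) : IsNCPart π.parts univ := by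
  constructor
  · exact fun B hB => π.nonempty_of_mem_parts hB
  · exact fun B _ => subset_univ B
  · exact fun x hx => π.exists_mem hx
  · exact fun B hB C hC x hxB hxC => π.eq_of_mem_parts hB hC hxB hxC
  · exact h

theorem parts_kreweras {n : ℕ} (π : Finpartition (univ : Finset (Fin n))) :
    (kreweras π).parts = krewerasClasses univ π.parts := by
  classical
  rw [kreweras, Finpartition.ofSetoid, Finpartition.ofSetSetoid_parts, krewerasClasses]
  refine image_congr fun x _ => ?_
  ext y
  simp only [mem_filter]
  rfl

theorem box_eq_ncSum {s : ℕ} {R : Type*} [CommRing R] (f g : Series s R) (w : NWord s) :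
    box f g w = ncSum (fun B => coeff f (wordOn w.1.get B)) (fun C => coeff g (wordOn w.1.get C))
      ∅ univ := by
  classical
  rw [box, ncSum]
  refine sum_bij' (fun π _ => π.parts) (fun P hP => Finpartition.mk P
      (by
        rw [mem_ncParts] at hP
        rw [supIndep_iff_pairwiseDisjoint]
        intro B hB C hC hne
        rw [Function.onFun, disjoint_left]
        exact fun x hxB hxC => hne (hP.unique B hB C hC x hxB hxC))
      (by
        rw [mem_ncParts] at hP
        ext x
        simpa [mem_sup] using hP.cover x (mem_univ x))
      (by
        rw [mem_ncParts] at hP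
        intro h0
        simpa using hP.nonempty _ h0)) ?_ ?_ ?_ ?_ ?_
  · intro π hπ
    rw [mem_ncParts]
    exact isNCPart_parts π (by simpa using hπ)
  · intro P hP
    rw [mem_ncParts] at hP
    simp only [mem_filter, mem_univ, true_and]
    exact hP.noncrossing
  · intro π _
    rfl
  · intro P _
    rfl
  · intro π _
    rw [parts_kreweras, empty_union]
    rfl

theorem wordOn_get_univ {A : Type*} (w : List A) : wordOn w.get univ = w := by
  rw [wordOn, Fin.sort_univ, ← List.ofFn_eq_map, List.ofFn_get]

/-- The boxed convolution is computed by the recursion. -/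
theorem IsBoxSystem.box_eq {s : ℕ} {R : Type*} [CommRing R] {f g : Series s R}
    {N : List (Fin s) → List (Fin s) → R} {M : List (Fin s) → List (Fin s) → List (Fin s) → R}
    (h : IsBoxSystem (coeff f) (coeff g) N M) (w : NWord s) : box f g w = N [] w.1 := by
  rw [box_eq_ncSum, (h.ncSum_eq _ univ rfl).1 ∅ (by simp), wordOn_empty, wordOn_get_univ]
  right
  have := List.length_pos_iff.2 w.2
  exact ⟨⟨0, this⟩, mem_univ _⟩

set_option linter.unusedSectionVars false

/-! ### Formal power series in non-commuting variables -/

/-- Formal power series in the non-commuting variables `A`, as functions of words. -/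
structure WSeries (A R : Type*) where
  /-- The coefficient of a word. -/
  toFun : List A → R

namespace WSeries

variable {A R : Type*}

instance : CoeFun (WSeries A R) fun _ => List A → R := ⟨toFun⟩

@[ext]
theorem ext {a b : WSeries A R} (h : ∀ w, a w = b w) : a = b := by
  cases a
  cases b
  congr
  exact funext h

/-- The left shift `u ↦ a (i :: u)`. -/
def shift (i : A) (a : WSeries A R) : WSeries A R := ⟨fun u => a (i :: u)⟩

/-- The right shift `u ↦ a (u ++ [i])`. -/
def shiftR (i : A) (a : WSeries A R) : WSeries A R := ⟨fun u => a (u ++ [i])⟩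

/-- The constant series. -/
def C [Zero R] (r : R) : WSeries A R := ⟨fun w => match w with
  | [] => r
  | _ :: _ => 0⟩

variable [CommRing R]

instance : Add (WSeries A R) := ⟨fun a b => ⟨fun w => a w + b w⟩⟩

instance : Zero (WSeries A R) := ⟨⟨fun _ => 0⟩⟩

instance : Neg (WSeries A R) := ⟨fun a => ⟨fun w => -a w⟩⟩

instance : Mul (WSeries A R) := ⟨fun a b => ⟨conv a b⟩⟩

instance : One (WSeries A R) := ⟨C 1⟩

theorem add_apply (a b : WSeries A R) (w : List A) : (a + b) w = a w + b w := rfl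

theorem zero_apply (w : List A) : (0 : WSeries A R) w = 0 := rfl

theorem mul_nil (a b : WSeries A R) : (a * b) [] = a [] * b [] := rfl

theorem mul_cons (a b : WSeries A R) (i : A) (u : List A) :
    (a * b) (i :: u) = a [] * b (i :: u) + (shift i a * b) u := rfl

@[simp] theorem C_nil (r : R) : (C r : WSeries A R) [] = r := rfl

@[simp] theorem C_cons (r : R) (i : A) (u : List A) : (C r : WSeries A R) (i :: u) = 0 := rfl

theorem shift_C (i : A) (r : R) : shift i (C r) = (0 : WSeries A R) := rfl

protected theorem add_mul (a b c : WSeries A R) : (a + b) * c = a * c + b * c := by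
  ext w
  induction w generalizing a b with
  | nil => simp only [mul_nil, add_apply, _root_.add_mul]
  | cons i u ih =>
    have : shift i (a + b) = shift i a + shift i b := rfl
    simp only [mul_cons, add_apply, this, ih]
    ring

protected theorem mul_add (a b c : WSeries A R) : a * (b + c) = a * b + a * c := by
  ext w
  induction w generalizing a with
  | nil => simp only [mul_nil, add_apply, _root_.mul_add]
  | cons i u ih =>
    simp only [mul_cons, add_apply, ih]
    ring

protected theorem zero_mul (a : WSeries A R) : 0 * a = 0 := by
  ext w
  induction w with
  | nil => simp only [mul_nil, zero_apply, MulZeroClass.zero_mul]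
  | cons i u ih =>
    have : shift i (0 : WSeries A R) = 0 := rfl
    simp only [mul_cons, zero_apply, this, ih]
    ring

protected theorem mul_zero (a : WSeries A R) : a * 0 = 0 := by
  ext w
  induction w generalizing a with
  | nil => simp only [mul_nil, zero_apply, MulZeroClass.mul_zero]
  | cons i u ih =>
    simp only [mul_cons, zero_apply, ih]
    ring

theorem C_mul_apply (r : R) (a : WSeries A R) (w : List A) :
    (C r * a : WSeries A R) w = r * a w := by
  cases w with
  | nil => rfl
  | cons i u => rw [mul_cons, shift_C, WSeries.zero_mul, zero_apply, add_zero, C_nil]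

theorem mul_C_apply (r : R) (a : WSeries A R) (w : List A) :
    (a * C r : WSeries A R) w = a w * r := by
  induction w generalizing a with
  | nil => rfl
  | cons i u ih =>
    rw [mul_cons, ih, C_cons, MulZeroClass.mul_zero, zero_add]
    rfl

theorem shift_mul (i : A) (a b : WSeries A R) :
    shift i (a * b) = C (a []) * shift i b + shift i a * b := by
  ext u
  rw [add_apply, C_mul_apply]
  rfl

protected theorem mul_assoc (a b c : WSeries A R) : a * b * c = a * (b * c) := by
  ext w
  induction w generalizing a b with
  | nil => simp only [mul_nil, _root_.mul_assoc]
  | cons i u ih =>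
    rw [mul_cons, shift_mul, WSeries.add_mul, add_apply, ih, C_mul_apply, ih, mul_nil,
      mul_cons, mul_cons]
    ring

instance : Ring (WSeries A R) :=
  { add_assoc := fun a b c => by ext w; exact add_assoc _ _ _
    zero_add := fun a => by ext w; exact zero_add _
    add_zero := fun a => by ext w; exact add_zero _
    add_comm := fun a b => by ext w; exact add_comm _ _
    neg_add_cancel := fun a => by ext w; exact neg_add_cancel _
    nsmul := nsmulRec
    zsmul := zsmulRec
    left_distrib := WSeries.mul_add
    right_distrib := WSeries.add_mul
    zero_mul := WSeries.zero_mul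
    mul_zero := WSeries.mul_zero
    mul_assoc := WSeries.mul_assoc
    one_mul := fun a => by
      ext w
      exact (C_mul_apply 1 a w).trans (one_mul _)
    mul_one := fun a => by
      ext w
      exact (mul_C_apply 1 a w).trans (mul_one _) }

theorem sum_apply {ι : Type*} (t : Finset ι) (a : ι → WSeries A R) (w : List A) :
    (∑ i ∈ t, a i) w = ∑ i ∈ t, a i w := by
  classical
  induction t using Finset.induction_on with
  | empty => rfl
  | insert i t hi ih => rw [sum_insert hi, sum_insert hi, add_apply, ih]

theorem one_def : (1 : WSeries A R) = C 1 := rfl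

theorem C_mul_C_mul (r : R) (a b : WSeries A R) : a * (C r * b) = C r * (a * b) := by
  rw [← mul_assoc, ← mul_assoc]
  congr 1
  ext w
  rw [C_mul_apply, mul_C_apply, mul_comm]

theorem C_mul_C (r t : R) : (C (r * t) : WSeries A R) = C r * C t := by
  ext w
  rw [C_mul_apply]
  cases w <;> simp

/-! #### Agreement up to a given degree -/

/-- `a` and `b` have the same coefficients at words of length less than `n`. -/
def Agree (n : ℕ) (a b : WSeries A R) : Prop := ∀ w : List A, w.length < n → a w = b w

theorem Agree.refl (n : ℕ) (a : WSeries A R) : Agree n a a := fun _ _ => rfl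

theorem Agree.symm {n : ℕ} {a b : WSeries A R} (h : Agree n a b) : Agree n b a :=
  fun w hw => (h w hw).symm

theorem Agree.trans {n : ℕ} {a b c : WSeries A R} (h : Agree n a b) (h' : Agree n b c) :
    Agree n a c := fun w hw => (h w hw).trans (h' w hw)

theorem Agree.mono {n m : ℕ} {a b : WSeries A R} (h : Agree n a b) (hm : m ≤ n) : Agree m a b :=
  fun w hw => h w (hw.trans_le hm)

theorem Agree.add {n : ℕ} {a b c d : WSeries A R} (h : Agree n a b) (h' : Agree n c d) :
    Agree n (a + c) (b + d) := fun w hw => by rw [add_apply, add_apply, h w hw, h' w hw]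

theorem Agree.sum {n : ℕ} {ι : Type*} {t : Finset ι} {a b : ι → WSeries A R}
    (h : ∀ i ∈ t, Agree n (a i) (b i)) : Agree n (∑ i ∈ t, a i) (∑ i ∈ t, b i) := fun w hw => by
  rw [sum_apply, sum_apply]
  exact sum_congr rfl fun i hi => h i hi w hw

theorem Agree.mul {n : ℕ} {a b c d : WSeries A R} (h : Agree n a b) (h' : Agree n c d) :
    Agree n (a * c) (b * d) := by
  intro w hw
  induction w generalizing a b n with
  | nil => rw [mul_nil, mul_nil, h _ hw, h' _ hw]
  | cons i u ih =>
    obtain _ | n := n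
    · simp at hw
    have hu : u.length < n := by simpa using hw
    rw [mul_cons, mul_cons, h [] (Nat.zero_lt_succ n), h' _ hw]
    congr 1
    exact ih (n := n) (fun w hw' => h _ (by simpa using hw')) (h'.mono n.le_succ) hu

/-- If the first factor has no constant term, the second one enters only through strictly shorter
words. This gain of one degree is what makes the equations below contractive. -/
theorem Agree.mul_of_nil_left {n : ℕ} {a b c d : WSeries A R} (h : Agree (n + 1) a b)
    (h' : Agree n c d) (ha : a [] = 0) : Agree (n + 1) (a * c) (b * d) := by
  have hb : b [] = 0 := by rw [← h [] (Nat.zero_lt_succ n), ha]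
  intro w hw
  cases w with
  | nil => rw [mul_nil, mul_nil, ha, hb, zero_mul, zero_mul]
  | cons i u =>
    rw [mul_cons, mul_cons, ha, hb, zero_mul, zero_mul]
    congr 1
    exact Agree.mul (n := n) (fun w hw' => h (i :: w) (by simpa using hw')) h' u (by simpa using hw)

theorem Agree.mul_of_nil_right {n : ℕ} {a b c d : WSeries A R} (h : Agree n a b)
    (h' : Agree (n + 1) c d) (hc : c [] = 0) : Agree (n + 1) (a * c) (b * d) := by
  have hd : d [] = 0 := by rw [← h' [] (Nat.zero_lt_succ n), hc]
  intro w hw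
  induction w generalizing a b n with
  | nil => rw [mul_nil, mul_nil, hc, hd, mul_zero, mul_zero]
  | cons i u ih =>
    obtain _ | n := n
    · simp at hw
    rw [mul_cons, mul_cons, h [] (Nat.zero_lt_succ n), h' _ hw]
    congr 1
    exact ih (n := n) (fun w hw' => h _ (by rw [List.length_cons]; omega)) (h'.mono (Nat.le_succ _))
      (by simpa using hw)

theorem eq_of_agree {a b : WSeries A R} (h : ∀ n, Agree n a b) : a = b := by
  ext w
  exact h (w.length + 1) w (Nat.lt_succ_self _)

/-- Two families solving the same contractive equation agree. -/
theorem eq_of_contract {ι : Type*} {a b : ι → WSeries A R}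
    (h : ∀ n, (∀ i, Agree n (a i) (b i)) → ∀ i, Agree (n + 1) (a i) (b i)) : a = b := by
  have key : ∀ n, ∀ i, Agree n (a i) (b i) := by
    intro n
    induction n with
    | zero => exact fun i w hw => absurd hw (Nat.not_lt_zero _)
    | succ n ih => exact h n ih
  exact funext fun i => eq_of_agree fun n => key n i

/-! #### Variables -/

variable [DecidableEq A]

/-- The variable `i`. -/
def X (i : A) : WSeries A R := ⟨fun w => if w = [i] then 1 else 0⟩

@[simp] theorem X_nil (i : A) : (X i : WSeries A R) [] = 0 := by simp [X]

theorem shift_X (i j : A) : shift j (X i : WSeries A R) = if j = i then 1 else 0 := by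
  ext w
  unfold shift X
  by_cases h : j = i
  · cases w <;> simp [h, one_def]
  · simp [h, zero_apply]

theorem X_mul_nil (i : A) (a : WSeries A R) : (X i * a : WSeries A R) [] = 0 := by
  rw [mul_nil, X_nil, zero_mul]

theorem mul_X_nil (i : A) (a : WSeries A R) : (a * X i : WSeries A R) [] = 0 := by
  rw [mul_nil, X_nil, mul_zero]

theorem shift_X_mul (i j : A) (a : WSeries A R) :
    shift j (X i * a) = if j = i then a else 0 := by
  rw [shift_mul, shift_X, X_nil]
  have : (C 0 : WSeries A R) = 0 := by ext w; cases w <;> rfl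
  rw [this, zero_mul, zero_add]
  split_ifs <;> simp

theorem shiftR_mul_X (i j : A) (a : WSeries A R) :
    shiftR j (a * X i) = if j = i then a else 0 := by
  ext w
  induction w generalizing a with
  | nil =>
    change (a * X i : WSeries A R) (j :: []) = _
    rw [mul_cons, mul_X_nil, add_zero]
    split_ifs with h
    · simp [X, h]
    · simp [X, h, zero_apply]
  | cons k u ih =>
    change (a * X i : WSeries A R) (k :: (u ++ [j])) = _
    rw [mul_cons]
    have h1 : X i (k :: (u ++ [j])) = (0 : R) := by simp [X]
    rw [h1, mul_zero, zero_add]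
    refine (ih (shift k a)).trans ?_
    split_ifs <;> rfl

theorem Agree.X_mul {n : ℕ} {a b : WSeries A R} (h : Agree n a b) (i : A) :
    Agree (n + 1) (X i * a) (X i * b) := (Agree.refl _ _).mul_of_nil_left h (X_nil i)

theorem Agree.mul_X {n : ℕ} {a b : WSeries A R} (h : Agree n a b) (i : A) :
    Agree (n + 1) (a * X i : WSeries A R) (b * X i) := h.mul_of_nil_right (Agree.refl _ _) (X_nil i)

variable [Fintype A]

theorem eq_C_add_sum_X_mul (a : WSeries A R) : a = C (a []) + ∑ i, X i * shift i a := by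
  ext w
  rw [add_apply, sum_apply]
  cases w with
  | nil => simp [X_mul_nil]
  | cons j u =>
    have : ∀ i, (X i * shift i a : WSeries A R) (j :: u) =
        if i = j then a (j :: u) else 0 := fun i => by
      change shift j (X i * shift i a) u = _
      rw [shift_X_mul]
      by_cases h : j = i
      · subst h; simp [shift]
      · simp [h, Ne.symm h, zero_apply]
    simp [this]

/-! #### Substitution -/

/-- The approximations of `subst`. -/
def substAux (E : A → WSeries A R) : ℕ → WSeries A R → WSeries A R
  | 0, f => C (f [])
  | n + 1, f => C (f []) + ∑ i, E i * substAux E n (shift i f)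

/-- The substitution of the series `E i`, without constant term, for the variables of `f`. -/
def subst (E : A → WSeries A R) (f : WSeries A R) : WSeries A R :=
  ⟨fun w => substAux E w.length f w⟩

variable {E D : A → WSeries A R}

/-- Each unfolding multiplies by some `E i` without constant term, so the coefficients at words of
length at most `n` are final after `n` unfoldings. This justifies the depth `w.length` in `subst`.
-/
theorem substAux_agree (hE : ∀ i, E i [] = 0) {n m : ℕ} (h : n ≤ m) (f : WSeries A R) :
    Agree (n + 1) (substAux E m f) (substAux E n f) := by
  induction n generalizing m f with
  | zero =>
    intro w hw
    have : w = [] := List.length_eq_zero_iff.1 (by omega)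
    subst this
    cases m with
    | zero => rfl
    | succ m => simp [substAux, add_apply, sum_apply, mul_nil, hE]
  | succ n ih =>
    obtain _ | m := m
    · omega
    exact (Agree.refl _ _).add <| Agree.sum fun i _ =>
      (Agree.refl _ _).mul_of_nil_left (ih (by omega) _) (hE i)

theorem subst_agree (hE : ∀ i, E i [] = 0) (n : ℕ) (f : WSeries A R) :
    Agree (n + 1) (subst E f) (substAux E n f) := fun w hw =>
  (substAux_agree hE (Nat.lt_succ_iff.1 hw) f w (Nat.lt_succ_self _)).symm

theorem subst_eq (hE : ∀ i, E i [] = 0) (f : WSeries A R) :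
    subst E f = C (f []) + ∑ i, E i * subst E (shift i f) := by
  refine eq_of_agree fun n => ?_
  refine ((subst_agree hE (n + 1) f).mono (by omega)).trans ?_
  refine Agree.mono (n := n + 1) ?_ (by omega)
  exact (Agree.refl _ _).add <| Agree.sum fun i _ =>
      (Agree.refl _ _).mul_of_nil_left ((subst_agree hE n _).symm.mono n.le_succ) (hE i)

theorem subst_nil (f : WSeries A R) : subst E f [] = f [] := rfl

/-- A family of series that satisfies the recursion of `subst` is equal to it. -/
theorem eq_subst_of_eq (hE : ∀ i, E i [] = 0) {ι : Type*} (φ a : ι → WSeries A R)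
    (σ : A → ι → ι) (hφ : ∀ i x, shift i (φ x) = φ (σ i x))
    (ha : ∀ x, a x = C (φ x []) + ∑ i, E i * a (σ i x)) (x : ι) : a x = subst E (φ x) := by
  refine congrFun (eq_of_contract (a := a) (b := fun x => subst E (φ x)) fun n ih x => ?_) x
  rw [ha x]
  rw [subst_eq hE (φ x)]
  refine (Agree.refl _ _).add (Agree.sum fun i _ => ?_)
  refine (Agree.refl _ _).mul_of_nil_left ?_ (hE i)
  rw [hφ]
  exact ih _

theorem Agree.subst {n : ℕ} (hE : ∀ i, E i [] = 0) (hD : ∀ i, D i [] = 0)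
    (h : ∀ i, Agree n (E i) (D i)) (f : WSeries A R) :
    Agree n (subst E f) (subst D f) := by
  induction n generalizing f with
  | zero => exact fun w hw => absurd hw (Nat.not_lt_zero _)
  | succ n ih =>
    rw [subst_eq hE, subst_eq hD]
    exact (Agree.refl _ _).add <| Agree.sum fun i _ =>
      (h i).mul_of_nil_left (ih (fun i => (h i).mono n.le_succ) _) (hE i)

theorem C_zero : (C 0 : WSeries A R) = 0 := by ext w; cases w <;> rfl

theorem subst_C (hE : ∀ i, E i [] = 0) (r : R) : subst E (C r) = C r := by
  have h0 : ∀ x : Unit, (fun _ => (0 : WSeries A R)) x = subst E ((fun _ => 0) x) := fun x =>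
    eq_subst_of_eq hE (fun _ => 0) (fun _ => 0) (fun _ x => x) (fun _ _ => rfl)
      (fun x => by simp [zero_apply, C_zero]) x
  rw [subst_eq hE]
  simp only [shift_C, ← h0 ()]
  simp

theorem subst_add (hE : ∀ i, E i [] = 0) (f g : WSeries A R) :
    subst E (f + g) = subst E f + subst E g := by
  symm
  refine eq_subst_of_eq hE (fun p : WSeries A R × WSeries A R => p.1 + p.2)
    (fun p => subst E p.1 + subst E p.2) (fun i p => (shift i p.1, shift i p.2))
    (fun _ _ => rfl) (fun p => ?_) (f, g)
  have : (C ((p.1 + p.2) []) : WSeries A R) = C (p.1 []) + C (p.2 []) := by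
    ext w; cases w <;> simp [add_apply]
  rw [this]
  conv_lhs => rw [subst_eq hE p.1, subst_eq hE p.2]
  simp only [mul_add, sum_add_distrib]
  abel

theorem subst_X (hE : ∀ i, E i [] = 0) (i : A) : subst E (X i) = E i := by
  rw [subst_eq hE, X_nil, C_zero, zero_add, sum_eq_single i]
  · rw [shift_X, if_pos rfl, one_def, subst_C hE, ← one_def, mul_one]
  · intro j _ hj
    rw [shift_X, if_neg hj, ← C_zero, subst_C hE, C_zero, mul_zero]
  · simp

theorem subst_variables (f : WSeries A R) : subst X f = f :=
  (eq_subst_of_eq (X_nil (R := R)) (fun f : WSeries A R => f) (fun f => f) (fun i f => shift i f)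
    (fun _ _ => rfl) eq_C_add_sum_X_mul f).symm

theorem subst_C_mul (hE : ∀ i, E i [] = 0) (r : R) (f : WSeries A R) :
    subst E (C r * f) = C r * subst E f := by
  symm
  refine eq_subst_of_eq hE (fun f : WSeries A R => C r * f) (fun f => C r * subst E f)
    (fun i f => shift i f) (fun i f => ?_) (fun f => ?_) f
  · rw [shift_mul, shift_C, zero_mul, add_zero, C_nil]
  · conv_lhs => rw [subst_eq hE f]
    rw [C_mul_apply, C_mul_C, mul_add, mul_sum]
    simp only [C_mul_C_mul]

/-- As functions of `f`, both sides solve `Φ f = C (f []) * subst E g + ∑ i, E i * Φ (shift i f)`,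
which is contractive. -/
theorem subst_mul (hE : ∀ i, E i [] = 0) (f g : WSeries A R) :
    subst E (f * g) = subst E f * subst E g := by
  refine congrFun (eq_of_contract (a := fun f => subst E (f * g))
    (b := fun f => subst E f * subst E g) fun n ih f => ?_) f
  have h1 : subst E (f * g) = C (f []) * subst E g + ∑ i, E i * subst E (shift i f * g) := by
    rw [subst_eq hE (f * g)]
    conv_rhs => rw [subst_eq hE g]
    rw [mul_add, mul_nil, C_mul_C, mul_sum, add_assoc, ← sum_add_distrib]
    congr 1
    refine sum_congr rfl fun i _ => ?_
    rw [shift_mul, subst_add hE, subst_C_mul hE, mul_add, C_mul_C_mul]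
  have h2 : subst E f * subst E g =
      C (f []) * subst E g + ∑ i, E i * (subst E (shift i f) * subst E g) := by
    conv_lhs => rw [subst_eq hE f]
    rw [add_mul, sum_mul]
    simp only [mul_assoc]
  rw [h1, h2]
  exact (Agree.refl _ _).add <| Agree.sum fun i _ =>
    (Agree.refl _ _).mul_of_nil_left (ih _) (hE i)

theorem subst_sum (hE : ∀ i, E i [] = 0) {ι : Type*} (t : Finset ι) (f : ι → WSeries A R) :
    subst E (∑ i ∈ t, f i) = ∑ i ∈ t, subst E (f i) := by
  classical
  induction t using Finset.induction_on with
  | empty => rw [sum_empty, sum_empty, ← C_zero, subst_C hE]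
  | insert i t hi ih => rw [sum_insert hi, sum_insert hi, subst_add hE, ih]

/-- Since `subst D` is multiplicative, it turns the recursion of `subst E` into that of the composed
family. -/
theorem subst_subst (hE : ∀ i, E i [] = 0) (hD : ∀ i, D i [] = 0) (f : WSeries A R) :
    subst D (subst E f) = subst (fun i => subst D (E i)) f := by
  have hDE : ∀ i, subst D (E i) [] = 0 := fun i => by rw [subst_nil, hE]
  refine eq_subst_of_eq hDE (fun f : WSeries A R => f) (fun f => subst D (subst E f))
    (fun i f => shift i f) (fun _ _ => rfl) (fun f => ?_) f
  rw [subst_eq hE f, subst_add hD, subst_C hD, subst_sum hD]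
  simp only [subst_mul hD]

/-- Left and right shifts commute, so the expansion by last letters satisfies the recursion by first
letters that characterizes substitution. -/
theorem subst_eq_right (hE : ∀ i, E i [] = 0) (f : WSeries A R) :
    subst E f = C (f []) + ∑ i, subst E (shiftR i f) * E i := by
  symm
  refine congrFun (eq_of_contract (a := fun f => C (f []) + ∑ i, subst E (shiftR i f) * E i)
    (b := fun f => subst E f) fun n ih f => ?_) f
  have h1 : C (f []) + ∑ i, subst E (shiftR i f) * E i =
      C (f []) + ∑ j, E j * (C (shift j f []) + ∑ i, subst E (shiftR i (shift j f)) * E i) := by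
    congr 1
    have : ∀ i, subst E (shiftR i f) * E i =
        C (f [i]) * E i + ∑ j, E j * (subst E (shiftR i (shift j f)) * E i) := by
      intro i
      conv_lhs => rw [subst_eq hE, add_mul, sum_mul]
      simp only [mul_assoc]
      rfl
    simp only [this, sum_add_distrib, mul_add, mul_sum]
    rw [sum_comm]
    congr 1
    refine sum_congr rfl fun i _ => ?_
    ext w
    rw [C_mul_apply, mul_C_apply, mul_comm]
    rfl
  rw [h1, subst_eq hE f]
  exact (Agree.refl _ _).add <| Agree.sum fun i _ =>
    (Agree.refl _ _).mul_of_nil_left (ih _) (hE i)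

theorem shiftR_eq (B : A → WSeries A R) (r : R) (j : A) :
    shiftR j (C r + ∑ i, B i * X i) = B j := by
  have : shiftR j (C r + ∑ i, B i * X i) = ∑ i, shiftR j (B i * X i) := by
    ext w
    rw [sum_apply]
    change (C r + ∑ i, B i * X i) (w ++ [j]) = ∑ i, (B i * X i : WSeries A R) (w ++ [j])
    rw [add_apply, sum_apply]
    cases w <;> simp
  rw [this]
  simp [shiftR_mul_X]

theorem shift_eq (B : A → WSeries A R) (r : R) (j : A) :
    shift j (C r + ∑ i, X i * B i) = B j := by
  have : shift j (C r + ∑ i, X i * B i) = ∑ i, shift j (X i * B i) := by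
    ext w
    rw [sum_apply]
    change (C r + ∑ i, X i * B i) (j :: w) = ∑ i, (X i * B i : WSeries A R) (j :: w)
    rw [add_apply, sum_apply, C_cons, zero_add]
  rw [this]
  simp [shift_X_mul]

end WSeries

/-! ### Factor pairs and associativity of the composition they define -/

namespace WSeries

variable {A R : Type*} [CommRing R] [DecidableEq A] [Fintype A]

theorem shiftR_subst_mul_X (a : A → WSeries A R) (g : WSeries A R) (i : A) :
    shiftR i (subst (fun j => a j * X j) g) =
    subst (fun j => a j * X j) (shiftR i g) * a i := by
  conv_lhs => rw [subst_eq_right (fun i => mul_X_nil i _) g]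
  simp only [← mul_assoc]
  exact shiftR_eq (fun i => subst (fun j => a j * X j) (shiftR i g) * a i) _ i

theorem shift_subst_X_mul (h : A → WSeries A R) (f : WSeries A R) (i : A) :
    shift i (subst (fun j => X j * h j) f) =
    h i * subst (fun j => X j * h j) (shift i f) := by
  conv_lhs => rw [subst_eq (fun i => X_mul_nil i _) f]
  simp only [mul_assoc]
  exact shift_eq (fun i => h i * subst (fun j => X j * h j) (shift i f)) _ i

/-- The pair of families `a`, `h` of series with `a i = f^{[i]}(X h)` and `h i = g_{[i]}(a X)`,
where `f^{[i]}` and `g_{[i]}` are the right and left shifts. -/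
structure IsFactorPair (f g : WSeries A R) (a h : A → WSeries A R) : Prop where
  left : ∀ i, a i = subst (fun j => X j * h j) (shiftR i f)
  right : ∀ i, h i = subst (fun j => a j * X j) (shift i g)

namespace IsFactorPair

variable {f g : WSeries A R} {a h : A → WSeries A R} (H : IsFactorPair f g a h)
include H

theorem subst_left : subst (fun j => X j * h j) f = C (f []) + ∑ i, a i * X i * h i := by
  rw [subst_eq_right (fun i => X_mul_nil i _) f]
  simp only [← H.left, mul_assoc]

theorem subst_right : subst (fun j => a j * X j) g = C (g []) + ∑ i, a i * X i * h i := by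
  rw [subst_eq (fun i => mul_X_nil i _) g]
  simp only [← H.right]

end IsFactorPair

/-- Every substituted series contains a factor `X j`, so agreement of the four families below degree
`n` improves to agreement below degree `n + 1`. -/
theorem system_unique {f g h : WSeries A R} {a e b k a' e' b' k' : A → WSeries A R}
    (ha : ∀ i, a i = subst (fun j => X j * k j * e j) (shiftR i f))
    (he : ∀ i, e i = subst (fun j => a j * X j * k j) (shift i g))
    (hb : ∀ i, b i = subst (fun j => a j * X j * k j) (shiftR i g))
    (hk : ∀ i, k i = subst (fun j => b j * a j * X j) (shift i h))
    (ha' : ∀ i, a' i = subst (fun j => X j * k' j * e' j) (shiftR i f))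
    (he' : ∀ i, e' i = subst (fun j => a' j * X j * k' j) (shift i g))
    (hb' : ∀ i, b' i = subst (fun j => a' j * X j * k' j) (shiftR i g))
    (hk' : ∀ i, k' i = subst (fun j => b' j * a' j * X j) (shift i h)) :
    a = a' ∧ b = b' := by
  have key := eq_of_contract (ι := A × Fin 4)
    (a := fun p => ![a p.1, e p.1, b p.1, k p.1] p.2)
    (b := fun p => ![a' p.1, e' p.1, b' p.1, k' p.1] p.2) fun n ih => by
      have ia : ∀ i, Agree n (a i) (a' i) := fun i => ih (i, 0)
      have ie : ∀ i, Agree n (e i) (e' i) := fun i => ih (i, 1)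
      have ib : ∀ i, Agree n (b i) (b' i) := fun i => ih (i, 2)
      have ik : ∀ i, Agree n (k i) (k' i) := fun i => ih (i, 3)
      rintro ⟨i, j⟩
      fin_cases j
      · change Agree (n + 1) (a i) (a' i)
        rw [ha, ha']
        refine Agree.subst (fun j => by rw [mul_assoc, X_mul_nil])
          (fun j => by rw [mul_assoc, X_mul_nil]) (fun j => ?_) _
        rw [mul_assoc, mul_assoc]
        exact ((ik j).mul (ie j)).X_mul j
      · change Agree (n + 1) (e i) (e' i)
        rw [he, he']
        refine Agree.subst (fun j => by rw [mul_nil, mul_X_nil, zero_mul])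
          (fun j => by rw [mul_nil, mul_X_nil, zero_mul]) (fun j => ?_) _
        exact ((ia j).mul_X j).mul_of_nil_left (ik j) (mul_X_nil _ _)
      · change Agree (n + 1) (b i) (b' i)
        rw [hb, hb']
        refine Agree.subst (fun j => by rw [mul_nil, mul_X_nil, zero_mul])
          (fun j => by rw [mul_nil, mul_X_nil, zero_mul]) (fun j => ?_) _
        exact ((ia j).mul_X j).mul_of_nil_left (ik j) (mul_X_nil _ _)
      · change Agree (n + 1) (k i) (k' i)
        rw [hk, hk']
        exact Agree.subst (fun j => mul_X_nil _ _) (fun j => mul_X_nil _ _)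
          (fun j => ((ib j).mul (ia j)).mul_X j) _
  exact ⟨funext fun i => congrFun key (i, 0), funext fun i => congrFun key (i, 2)⟩

/-- Associativity of the composition of series through factor pairs. -/
theorem IsFactorPair.assoc {f g h p q : WSeries A R}
    {a₁ h₁ a₂ h₂ a₃ h₃ a₄ h₄ : A → WSeries A R}
    (H₁ : IsFactorPair f g a₁ h₁) (H₂ : IsFactorPair p h a₂ h₂)
    (H₃ : IsFactorPair g h a₃ h₃) (H₄ : IsFactorPair f q a₄ h₄)
    (hp : p = subst (fun j => a₁ j * X j) g) (hq : q = subst (fun j => a₃ j * X j) h)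
    (hq' : q = subst (fun j => X j * h₃ j) g) :
    subst (fun j => a₂ j * X j) h = subst (fun j => a₄ j * X j) q := by
  have z₂ : ∀ i, (X i * h₂ i : WSeries A R) [] = 0 := fun i => X_mul_nil _ _
  have z₄ : ∀ i, (a₄ i * X i : WSeries A R) [] = 0 := fun i => mul_X_nil _ _
  have z₁' : ∀ i, (a₁ i * X i : WSeries A R) [] = 0 := fun i => mul_X_nil _ _
  have z₁ : ∀ i, (X i * h₁ i : WSeries A R) [] = 0 := fun i => X_mul_nil _ _
  have z₃' : ∀ i, (a₃ i * X i : WSeries A R) [] = 0 := fun i => mul_X_nil _ _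
  have z₃ : ∀ i, (X i * h₃ i : WSeries A R) [] = 0 := fun i => X_mul_nil _ _
  -- Both bracketings are brought to the system of `system_unique`. In the first, the factors of `f`
  -- and `g` are evaluated at `X h₂`, and `k` is `h₂`; in the second, the factors of `g` and `h` are
  -- evaluated at `a₄ X`, and `a'` is `a₄`. Either way the triple product is `h` evaluated at `b a
  -- X`.
  set a := fun i => subst (fun j => X j * h₂ j) (a₁ i) with hadef
  set e := fun i => subst (fun j => X j * h₂ j) (h₁ i) with hedef
  set b := fun i => subst (fun j => a j * X j * h₂ j) (shiftR i g) with hbdef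
  set b' := fun i => subst (fun j => a₄ j * X j) (a₃ i) with hbdef'
  set k' := fun i => subst (fun j => a₄ j * X j) (h₃ i) with hkdef'
  set e' := fun i => subst (fun j => a₄ j * X j * k' j) (shift i g) with hedef'
  have ha : ∀ i, a i = subst (fun j => X j * h₂ j * e j) (shiftR i f) := fun i => by
    simp only [hadef, hedef]
    rw [H₁.left, subst_subst z₁ z₂]
    simp only [subst_mul z₂, subst_X z₂]
  have he : ∀ i, e i = subst (fun j => a j * X j * h₂ j) (shift i g) := fun i => by
    simp only [hadef, hedef]
    rw [H₁.right, subst_subst z₁' z₂]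
    simp only [subst_mul z₂, subst_X z₂, mul_assoc]
  have ha₂ : ∀ i, a₂ i = b i * a i := fun i => by
    rw [H₂.left, hp, shiftR_subst_mul_X, subst_mul z₂, subst_subst z₁' z₂]
    simp only [subst_mul z₂, subst_X z₂, hbdef, hadef, mul_assoc]
  have hk : ∀ i, h₂ i = subst (fun j => b j * a j * X j) (shift i h) := fun i => by
    rw [H₂.right]
    simp only [ha₂]
  have hb' : ∀ i, b' i = subst (fun j => a₄ j * X j * k' j) (shiftR i g) := fun i => by
    simp only [hbdef', hkdef']
    rw [H₃.left, subst_subst z₃ z₄]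
    simp only [subst_mul z₄, subst_X z₄]
  have hk' : ∀ i, k' i = subst (fun j => b' j * a₄ j * X j) (shift i h) := fun i => by
    simp only [hbdef', hkdef']
    rw [H₃.right, subst_subst z₃' z₄]
    simp only [subst_mul z₄, subst_X z₄, mul_assoc]
  have hh₄ : ∀ i, h₄ i = k' i * e' i := fun i => by
    rw [H₄.right, hq', shift_subst_X_mul, subst_mul z₄, subst_subst z₃ z₄]
    simp only [subst_mul z₄, subst_X z₄, hedef', hkdef', mul_assoc]
  have ha' : ∀ i, a₄ i = subst (fun j => X j * k' j * e' j) (shiftR i f) := fun i => by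
    rw [H₄.left]
    simp only [hh₄, mul_assoc]
  obtain ⟨e1, e2⟩ := system_unique (b := b) (b' := b') ha he (fun _ => rfl) hk ha'
    (fun _ => rfl) hb' hk'
  rw [hq, subst_subst z₃' z₄]
  congr 1
  funext j
  rw [ha₂, e1, e2, subst_mul z₄, subst_X z₄, ← mul_assoc]

end WSeries

open WSeries

/-! ### Solving the word recursion by power series -/

section BoxSystem

variable {A R : Type*} [CommRing R] [DecidableEq A] [Fintype A]
  {f g : List A → R} {N : List A → List A → R} {M : List A → List A → List A → R}

namespace IsBoxSystem

variable (h : IsBoxSystem f g N M)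
include h

/-- Here `c` is the last letter of the open block. Each earlier letter `j` of the block is followed
by a closed stretch with series `N [j]`, whose first complement point is that of `j`; after `c` the
outer class resumes as `q ++ [c]`. -/
theorem M_eq (p q : List A) : (⟨M p q⟩ : WSeries A R) =
    ∑ c, subst (fun j => X j * ⟨N [j]⟩) ⟨fun v => f (p ++ v ++ [c])⟩ * X c * ⟨N (q ++ [c])⟩ := by
  have z : ∀ i, (X i * ⟨N [i]⟩ : WSeries A R) [] = 0 := fun i => X_mul_nil _ _
  have hM : ∀ p, (⟨M p q⟩ : WSeries A R) =
      ∑ i, X i * (C (f (p ++ [i])) * ⟨N (q ++ [i])⟩ + ⟨N [i]⟩ * ⟨M (p ++ [i]) q⟩) := by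
    intro p
    refine (eq_C_add_sum_X_mul _).trans ?_
    change C (M p q []) + _ = _
    rw [h.M_nil, C_zero, zero_add]
    refine sum_congr rfl fun i _ => ?_
    congr 1
    ext u
    rw [WSeries.add_apply, C_mul_apply]
    exact h.M_cons p q i u
  refine congrFun (eq_of_contract (a := fun p => (⟨M p q⟩ : WSeries A R)) (b := fun p =>
    ∑ c, subst (fun j => X j * ⟨N [j]⟩) ⟨fun v => f (p ++ v ++ [c])⟩ * X c * ⟨N (q ++ [c])⟩)
    fun n ih p => ?_) p
  rw [hM p]
  have h2 : ∑ c, subst (fun j => X j * (⟨N [j]⟩ : WSeries A R)) ⟨fun v => f (p ++ v ++ [c])⟩ *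
      X c * ⟨N (q ++ [c])⟩ = ∑ i, X i * (C (f (p ++ [i])) * ⟨N (q ++ [i])⟩ + ⟨N [i]⟩ *
        ∑ c, subst (fun j => X j * ⟨N [j]⟩) ⟨fun v => f (p ++ [i] ++ v ++ [c])⟩ * X c *
          ⟨N (q ++ [c])⟩) := by
    have h3 : ∀ c, subst (fun j => X j * (⟨N [j]⟩ : WSeries A R)) ⟨fun v => f (p ++ v ++ [c])⟩ *
        X c * ⟨N (q ++ [c])⟩ = X c * (C (f (p ++ [c])) * ⟨N (q ++ [c])⟩) +
        ∑ i, X i * (⟨N [i]⟩ * (subst (fun j => X j * ⟨N [j]⟩)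
          ⟨fun v => f (p ++ [i] ++ v ++ [c])⟩ * X c * ⟨N (q ++ [c])⟩)) := by
      intro c
      conv_lhs => rw [subst_eq z]
      rw [add_mul, add_mul, sum_mul, sum_mul, C_mul_C_mul]
      congr 1
      · simp only [List.append_nil, mul_assoc]
      · refine sum_congr rfl fun i _ => ?_
        simp only [mul_assoc]
        congr 4
        ext v
        simp [shift]
    rw [sum_congr rfl fun c _ => h3 c, sum_add_distrib, sum_comm]
    simp only [mul_add, mul_sum, sum_add_distrib]
  rw [h2]
  refine Agree.sum fun i _ => ?_
  exact ((Agree.refl _ _).add ((Agree.refl _ _).mul (ih _))).X_mul i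

/-- The series of the recursion are the factors of the boxed convolution. -/
theorem isFactorPair : IsFactorPair ⟨f⟩ ⟨g⟩
      (fun i => subst (fun j => X j * ⟨N [j]⟩) (shiftR i ⟨f⟩)) (fun i => ⟨N [i]⟩) ∧
    (⟨N []⟩ : WSeries A R) = subst (fun j =>
      subst (fun j => X j * ⟨N [j]⟩) (shiftR j ⟨f⟩) * X j) ⟨g⟩ := by
  set a : A → WSeries A R := fun i => subst (fun j => X j * ⟨N [j]⟩) (shiftR i ⟨f⟩) with ha
  have hN : ∀ q, (⟨N q⟩ : WSeries A R) = C (g q) + ∑ c, a c * X c * ⟨N (q ++ [c])⟩ := by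
    intro q
    have h1 : (⟨N q⟩ : WSeries A R) = C (g q) + ⟨M [] q⟩ := by
      ext w
      rw [WSeries.add_apply]
      cases w with
      | nil => simp [h.N_nil, h.M_nil]
      | cons i u => simp [h.N_cons]
    rw [h1, h.M_eq]
    rfl
  -- The prefix `q` is the state of the recursion: appending `c` to it amounts to a left shift of `v
  -- ↦ g (q ++ v)`.
  have hN' : ∀ q, (⟨N q⟩ : WSeries A R) = subst (fun j => a j * X j) ⟨fun v => g (q ++ v)⟩ :=
    eq_subst_of_eq (fun j => mul_X_nil _ _) (fun q => ⟨fun v => g (q ++ v)⟩) (fun q => ⟨N q⟩)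
      (fun i q => q ++ [i]) (fun i q => by ext v; simp [shift])
      fun q => by simpa only [List.append_nil] using hN q
  exact ⟨⟨fun i => rfl, fun i => hN' [i]⟩, hN' []⟩

end IsBoxSystem

end BoxSystem

/-! ### The free product of functionals as a sum over stacks -/

section StackSum

variable {A : Type*} {R : Type*} [CommRing R] (κ g : List A → R)

/-- The sum over the non-crossing partitions of the `x`-letters of a word, with weights `κ` of
the blocks and `g` of the words of `y`-letters that are not separated by blocks. The word is read
from the left; `q` holds the `y`-letters of the current gap, and the list holds the open blocks,
each with the `y`-letters of the gap in which it was opened. -/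
def stackSum : List (A ⊕ A) → List A → List (List A × List A) → R
  | [], q, [] => g q
  | [], _, _ :: _ => 0
  | Sum.inr j :: v, q, l => stackSum v (q ++ [j]) l
  | Sum.inl c :: v, q, [] => κ [c] * stackSum v q [] + stackSum v [] [([c], q)]
  | Sum.inl c :: v, q, (p, r) :: l =>
    κ [c] * stackSum v q ((p, r) :: l) + stackSum v [] (([c], q) :: (p, r) :: l) +
      g q * (κ (p ++ [c]) * stackSum v r l + stackSum v [] ((p ++ [c], r) :: l))

/-- `∑ σ u * θ c v` over all factorizations of a word as `u x_c v`. -/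
def splitSum (σ : List (A ⊕ A) → R) (θ : A → List (A ⊕ A) → R) : List (A ⊕ A) → R
  | [] => 0
  | x :: v => Sum.elim (fun c => σ [] * θ c v) (fun _ => 0) x +
      splitSum (fun u => σ (x :: u)) θ v

theorem splitSum_add (σ τ : List (A ⊕ A) → R) (θ : A → List (A ⊕ A) → R) (v : List (A ⊕ A)) :
    splitSum (fun u => σ u + τ u) θ v = splitSum σ θ v + splitSum τ θ v := by
  induction v generalizing σ τ with
  | nil => simp [splitSum]
  | cons x v ih =>
    rw [splitSum, splitSum, splitSum, ih]
    rcases x with x | x <;> simp only [Sum.elim_inl, Sum.elim_inr] <;> ring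

theorem splitSum_mul (r : R) (σ : List (A ⊕ A) → R) (θ : A → List (A ⊕ A) → R)
    (v : List (A ⊕ A)) : splitSum (fun u => r * σ u) θ v = r * splitSum σ θ v := by
  induction v generalizing σ with
  | nil => simp [splitSum]
  | cons x v ih =>
    rw [splitSum, splitSum, ih]
    rcases x with x | x <;> simp only [Sum.elim_inl, Sum.elim_inr] <;> ring

theorem splitSum_mul_right (r : R) (σ : List (A ⊕ A) → R) (θ : A → List (A ⊕ A) → R)
    (v : List (A ⊕ A)) : splitSum σ (fun c u => r * θ c u) v = r * splitSum σ θ v := by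
  induction v generalizing σ with
  | nil => simp [splitSum]
  | cons x v ih =>
    rw [splitSum, splitSum, ih]
    rcases x with x | x <;> simp only [Sum.elim_inl, Sum.elim_inr] <;> ring

theorem splitSum_congr {σ : List (A ⊕ A) → R} {θ θ' : A → List (A ⊕ A) → R}
    {v : List (A ⊕ A)} (h : ∀ a c u, v = a ++ Sum.inl c :: u → θ c u = θ' c u) :
    splitSum σ θ v = splitSum σ θ' v := by
  induction v generalizing σ with
  | nil => rfl
  | cons x v ih =>
    rw [splitSum, splitSum, ih fun a c u e => h (x :: a) c u (by rw [e]; rfl)]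
    rcases x with x | x
    · simp only [Sum.elim_inl]
      rw [h [] x v rfl]
    · rfl

theorem splitSum_eq_zero {σ : List (A ⊕ A) → R} (θ : A → List (A ⊕ A) → R)
    {v : List (A ⊕ A)} (h : ∀ a c u, v = a ++ Sum.inl c :: u → σ a = 0) :
    splitSum σ θ v = 0 := by
  induction v generalizing σ with
  | nil => rfl
  | cons x v ih =>
    rw [splitSum, ih fun a c u e => h (x :: a) c u (by rw [e]; rfl)]
    rcases x with x | x
    · simp only [Sum.elim_inl]
      rw [h [] x v rfl]
      ring
    · simp

theorem splitSum_append (σ : List (A ⊕ A) → R) (θ : A → List (A ⊕ A) → R)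
    (a v : List (A ⊕ A)) : splitSum σ θ (a ++ v) =
      splitSum σ (fun c u => θ c (u ++ v)) a + splitSum (fun u => σ (a ++ u)) θ v := by
  induction a generalizing σ with
  | nil => simp [splitSum]
  | cons x a ih => rw [List.cons_append, splitSum, splitSum, ih, add_assoc]; rfl

/-- The innermost open block but those of `l` continues at some letter `x_c`, or it never does. -/
theorem stackSum_append (p r : List A) (l₂ : List (List A × List A)) (v : List (A ⊕ A))
    (q : List A) (l₁ : List (List A × List A)) :
    stackSum κ g v q (l₁ ++ (p, r) :: l₂) = splitSum (fun u => stackSum κ g u q l₁)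
      (fun c u => κ (p ++ [c]) * stackSum κ g u r l₂ + stackSum κ g u [] ((p ++ [c], r) :: l₂))
      v := by
  induction v generalizing q l₁ with
  | nil => cases l₁ <;> simp [stackSum, splitSum]
  | cons x v ih =>
    rcases x with c | j
    · rcases l₁ with _ | ⟨⟨p₁, r₁⟩, l₁⟩
      · simp only [List.nil_append, splitSum, stackSum, Sum.elim_inl]
        rw [splitSum_add, splitSum_mul, ← ih q [], ← ih [] [([c], q)]]
        simp only [List.nil_append, List.cons_append]
        ring
      · simp only [List.cons_append, splitSum, stackSum, Sum.elim_inl]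
        simp only [splitSum_add, splitSum_mul]
        rw [← ih q ((p₁, r₁) :: l₁), ← ih [] (([c], q) :: (p₁, r₁) :: l₁),
          ← ih r₁ l₁, ← ih [] ((p₁ ++ [c], r₁) :: l₁)]
        simp only [List.cons_append]
        ring
    · simp only [splitSum, stackSum, Sum.elim_inr, zero_add]
      rw [ih]

/-- The word `x_{i_1} y_{i_1} ⋯ x_{i_n} y_{i_n}`. -/
def interleave (w : List A) : List (A ⊕ A) := w.flatMap fun i => [Sum.inl i, Sum.inr i]

theorem interleave_cons (i : A) (w : List A) :
    interleave (i :: w) = Sum.inl i :: Sum.inr i :: interleave w := rfl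

theorem splitSum_interleave (σ : List (A ⊕ A) → R) (θ : A → List (A ⊕ A) → R) (b : List A → R)
    (hb : b [] = 0) (hθ : ∀ c u, θ c (Sum.inr c :: interleave u) = b (c :: u)) (w : List A) :
    splitSum σ θ (interleave w) = conv (fun u => σ (interleave u)) b w := by
  induction w generalizing σ with
  | nil => simp [conv, hb, splitSum, interleave]
  | cons i w ih =>
    rw [interleave_cons, splitSum, splitSum, ih, conv, ← hθ]
    simp only [Sum.elim_inl, Sum.elim_inr, zero_add]
    rfl

/-- The companion of `stackSum` with an open first block. -/
def stackSumOpen (p q : List A) : List A → R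
  | [] => 0
  | i :: u => κ (p ++ [i]) * stackSum κ g (interleave u) (q ++ [i]) [] +
      stackSum κ g (interleave u) [i] [(p ++ [i], q)]

/-- In an interleaved word each `y`-letter stands directly after the `x`-letter of the same index,
which is where the Kreweras complement puts its point. The gaps of `stackSum` are then the
complement classes, so `stackSum` computes the boxed convolution. -/
theorem isBoxSystem_stackSum :
    IsBoxSystem κ g (fun q u => stackSum κ g (interleave u) q []) (stackSumOpen κ g) where
  N_nil q := by simp [interleave, stackSum]
  N_cons q i u := by simp [interleave_cons, stackSum, stackSumOpen]
  M_nil p q := rfl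
  M_cons p q i u := by
    rw [stackSumOpen]
    congr 1
    refine (stackSum_append κ g (p ++ [i]) q [] (interleave u) [i] []).trans ?_
    refine splitSum_interleave _ _ _ rfl (fun c u => ?_) u
    simp [stackSumOpen, stackSum]

/-- The moment-cumulant formula: weight `1` on all gaps has the same effect as having no
`y`-letters, when all gaps are empty and weigh `g [] = 1`. On `x`-words `stackSum` is thus the
functional with cumulants `κ`. -/
theorem stackSum_one_interleave (hg : g [] = 1) (b q : List A) (l : List (List A × List A)) :
    stackSum κ (fun _ => 1) (interleave b) q l =
      stackSum κ g (b.map Sum.inl) [] (l.map fun p => (p.1, [])) := by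
  induction b generalizing q l with
  | nil => cases l <;> simp [interleave, stackSum, hg]
  | cons c b ih =>
    rcases l with _ | ⟨⟨p, r⟩, l⟩
    · simp [interleave_cons, stackSum, ih]
    · simp [interleave_cons, stackSum, ih, hg]

theorem stackSum_inr_append (p : List A) (v : List (A ⊕ A)) (q : List A)
    (l : List (List A × List A)) :
    stackSum κ g (p.map Sum.inr ++ v) q l = stackSum κ g v (q ++ p) l := by
  induction p generalizing q with
  | nil => simp
  | cons j p ih => simp [stackSum, ih]

/-! ### Centered alternating products -/

/-- The value of the linear extension of `ψ` at the product of the `a - φ a` for `a` in a list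
of words. -/
def centered (φ : List (A ⊕ A) → R) : (List (A ⊕ A) → R) → List (List (A ⊕ A)) → R
  | ψ, [] => ψ []
  | ψ, a :: l => centered φ (fun v => ψ (a ++ v)) l - φ a * centered φ ψ l

variable (φ : List (A ⊕ A) → R)

theorem centered_add (ψ χ : List (A ⊕ A) → R) (l : List (List (A ⊕ A))) :
    centered φ (fun v => ψ v + χ v) l = centered φ ψ l + centered φ χ l := by
  induction l generalizing ψ χ with
  | nil => rfl
  | cons a l ih =>
    rw [centered, centered, centered, ih, ih]
    ring

theorem centered_mul (r : R) (ψ : List (A ⊕ A) → R) (l : List (List (A ⊕ A))) :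
    centered φ (fun v => r * ψ v) l = r * centered φ ψ l := by
  induction l generalizing ψ with
  | nil => rfl
  | cons a l ih =>
    rw [centered, centered, ih, ih]
    ring

theorem centered_zero (l : List (List (A ⊕ A))) : centered φ (fun _ => 0) l = 0 := by
  have := centered_mul φ 0 (fun _ => 0) l
  simpa using this

theorem centered_concat (ψ : List (A ⊕ A) → R) (l : List (List (A ⊕ A))) (a : List (A ⊕ A)) :
    centered φ ψ (l ++ [a]) =
      centered φ (fun v => ψ (v ++ a)) l - φ a * centered φ ψ l := by
  induction l generalizing ψ with
  | nil => simp [centered]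
  | cons b l ih =>
    rw [List.cons_append, centered, centered, centered, ih, ih]
    simp only [List.append_assoc]
    ring

theorem centered_splitSum_left (σ : List (A ⊕ A) → R) (θ : A → List (A ⊕ A) → R)
    (l : List (List (A ⊕ A))) (b : List (A ⊕ A)) :
    centered φ (fun v => splitSum σ (fun c u => θ c (u ++ v)) b) l =
      splitSum σ (fun c u => centered φ (fun v => θ c (u ++ v)) l) b := by
  induction b generalizing σ with
  | nil => exact centered_zero φ l
  | cons x b ih =>
    simp only [splitSum]
    rw [centered_add, ih]
    rcases x with c | j
    · simp only [Sum.elim_inl]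
      rw [centered_mul]
    · simp only [Sum.elim_inr]
      rw [centered_zero]

/-- When the product is multiplied out, the splitting letter lies in one word of the list, and the
subtracted scalar of that word does not contribute. What precedes it is the centered product of the
earlier words times the beginning `a` of that word; these are the values assumed to vanish. -/
theorem centered_splitSum_eq_zero (θ : A → List (A ⊕ A) → R) (l : List (List (A ⊕ A)))
    (σ : List (A ⊕ A) → R)
    (h : ∀ l₁ a c b l₂, l = l₁ ++ (a ++ Sum.inl c :: b) :: l₂ →
      centered φ (fun v => σ (v ++ a)) l₁ = 0) :
    centered φ (splitSum σ θ) l = 0 := by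
  induction l generalizing σ with
  | nil => rfl
  | cons a l ih =>
    have h0 : ∀ θ', splitSum σ θ' a = 0 := fun θ' =>
      splitSum_eq_zero θ' fun a' c u e => h [] a' c u l (by rw [e]; rfl)
    have h1 : (fun v => splitSum σ θ (a ++ v)) = splitSum (fun u => σ (a ++ u)) θ := by
      funext v
      rw [splitSum_append, h0, zero_add]
    have h2 := ih (fun v => σ (a ++ v) + (-φ a) * σ v) fun l₁ b c d l₂ e => by
      have := h (a :: l₁) b c d l₂ (by rw [e]; rfl)
      rw [centered] at this
      rw [centered_add, centered_mul]
      simp only [List.append_assoc] at this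
      rw [← this]
      ring
    have h3 : splitSum (fun v => σ (a ++ v) + (-φ a) * σ v) θ =
        fun v => splitSum (fun u => σ (a ++ u)) θ v + (-φ a) * splitSum σ θ v := by
      funext v
      rw [splitSum_add, splitSum_mul]
    rw [h3, centered_add, centered_mul] at h2
    rw [centered, h1, ← h2]
    ring

/-- The words of the list are nonempty and one-coloured, with alternating colours, the first
consisting of `x`-letters iff `c = true`. -/
def IsAlternating : Bool → List (List (A ⊕ A)) → Prop
  | _, [] => True
  | c, a :: l => a ≠ [] ∧ (∀ x ∈ a, x.isLeft = c) ∧ IsAlternating (!c) l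

theorem IsAlternating.prefix {c : Bool} {l₁ l₂ : List (List (A ⊕ A))}
    (h : IsAlternating c (l₁ ++ l₂)) : IsAlternating c l₁ := by
  induction l₁ generalizing c with
  | nil => trivial
  | cons a l ih => exact ⟨h.1, h.2.1, ih h.2.2⟩

theorem IsAlternating.prefix_concat {c : Bool} {l₁ l₂ : List (List (A ⊕ A))}
    {a b : List (A ⊕ A)} (h : IsAlternating c (l₁ ++ (a ++ b) :: l₂)) (ha : a ≠ []) :
    IsAlternating c (l₁ ++ [a]) := by
  induction l₁ generalizing c with
  | nil => exact ⟨ha, fun x hx => h.2.1 x (List.mem_append_left _ hx), trivial⟩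
  | cons a l ih => exact ⟨h.1, h.2.1, ih h.2.2⟩

theorem exists_map_inl {a : List (A ⊕ A)} (h : ∀ x ∈ a, x.isLeft = true) :
    ∃ b : List A, a = b.map Sum.inl := by
  induction a with
  | nil => exact ⟨[], rfl⟩
  | cons x a ih =>
    obtain ⟨b, rfl⟩ := ih fun y hy => h y (List.mem_cons_of_mem _ hy)
    rcases x with x | x
    · exact ⟨x :: b, rfl⟩
    · simpa using h _ List.mem_cons_self

theorem exists_map_inr {a : List (A ⊕ A)} (h : ∀ x ∈ a, x.isLeft = false) :
    ∃ b : List A, a = b.map Sum.inr := by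
  induction a with
  | nil => exact ⟨[], rfl⟩
  | cons x a ih =>
    obtain ⟨b, rfl⟩ := ih fun y hy => h y (List.mem_cons_of_mem _ hy)
    rcases x with x | x
    · simpa using h _ List.mem_cons_self
    · exact ⟨x :: b, rfl⟩

/-- The sum over stacks with an open block `p` that may be closed at once. -/
def stackSumBlock (p q : List A) (v : List (A ⊕ A)) : R :=
  κ p * stackSum κ g v q [] + stackSum κ g v [] [(p, q)]

theorem stackSum_inl (c : A) (v : List (A ⊕ A)) (q : List A) :
    stackSum κ g (Sum.inl c :: v) q [] = stackSumBlock κ g [c] q v := rfl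

theorem stackSumBlock_eq (p q : List A) (v : List (A ⊕ A)) :
    stackSumBlock κ g p q v = κ p * stackSum κ g v q [] +
      splitSum (fun u => stackSum κ g u [] []) (fun c u => stackSumBlock κ g (p ++ [c]) q u) v := by
  rw [stackSumBlock]
  congr 1
  exact stackSum_append κ g p q [] v [] []

variable {κ g φ} (hg : g [] = 1)
  (hx : ∀ b : List A, b ≠ [] → φ (b.map Sum.inl) = stackSum κ g (b.map Sum.inl) [] [])
  (hy : ∀ p : List A, p ≠ [] → φ (p.map Sum.inr) = g p)
include hg hx hy

/-- If the first word consists of `x`'s, the factorization `ih` splits off precisely its value, and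
centering cancels it. If it consists of `y`'s, it only fills the current gap; the remaining product
begins with `x`'s and vanishes for every content of that gap. -/
theorem centered_stackSum_eq_zero_of {n : ℕ}
    (ih : ∀ (l : List (List (A ⊕ A))) (b : List A), IsAlternating false l →
      b.length + l.flatten.length < n → ∀ p q : List A,
      centered φ (fun v => stackSumBlock κ g p q (b.map Sum.inl ++ v)) l =
        stackSumBlock κ g p [] (b.map Sum.inl) * centered φ (fun v => stackSum κ g v q []) l)
    {l : List (List (A ⊕ A))} (hl : l ≠ []) (hn : l.flatten.length ≤ n) :
    (IsAlternating true l → ∀ q, centered φ (fun v => stackSum κ g v q []) l = 0) ∧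
      (IsAlternating false l → centered φ (fun v => stackSum κ g v [] []) l = 0) := by
  have hX : ∀ l : List (List (A ⊕ A)), l ≠ [] → l.flatten.length ≤ n → IsAlternating true l →
      ∀ q, centered φ (fun v => stackSum κ g v q []) l = 0 := by
    intro l hl hn halt q
    obtain _ | ⟨a, l⟩ := l
    · exact absurd rfl hl
    obtain ⟨ha, hal, halt⟩ := halt
    obtain ⟨b, rfl⟩ := exists_map_inl hal
    obtain _ | ⟨i, b⟩ := b
    · exact absurd rfl ha
    have h1 : b.length + l.flatten.length < n := by
      simp only [List.flatten_cons, List.length_append, List.length_map, List.length_cons] at hn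
      omega
    rw [centered, hx _ (by simp)]
    have := ih l b halt h1 [i] q
    simp only [List.map_cons, List.cons_append, stackSum_inl, this]
    ring
  refine ⟨hX l hl hn, fun halt => ?_⟩
  obtain _ | ⟨a, l⟩ := l
  · exact absurd rfl hl
  obtain ⟨ha, hal, halt⟩ := halt
  obtain ⟨p, rfl⟩ := exists_map_inr hal
  have hp : p ≠ [] := by rintro rfl; exact ha rfl
  rw [centered, hy _ hp]
  simp only [stackSum_inr_append, List.nil_append]
  by_cases hl' : l = []
  · subst hl'
    simp [centered, stackSum, hg]
  · have hn' : l.flatten.length ≤ n := by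
      simp only [List.flatten_cons, List.length_append] at hn
      omega
    rw [hX l hl' hn' halt, hX l hl' hn' halt]
    ring

/-- A block begun before the centered list never reaches into it: to continue at a letter of `l`, it
would have to enclose a shorter centered alternating product, whose sum is zero. So the block closes
within `b`, and the sum factorizes. -/
theorem centered_stackSumBlock (n : ℕ) : ∀ (l : List (List (A ⊕ A))) (b : List A),
    IsAlternating false l → b.length + l.flatten.length = n → ∀ p q : List A,
      centered φ (fun v => stackSumBlock κ g p q (b.map Sum.inl ++ v)) l =
        stackSumBlock κ g p [] (b.map Sum.inl) *
          centered φ (fun v => stackSum κ g v q []) l := by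
  induction n using Nat.strong_induction_on with
  | _ n ih =>
  have ih' : ∀ (l : List (List (A ⊕ A))) (b : List A), IsAlternating false l →
      b.length + l.flatten.length < n → ∀ p q : List A,
      centered φ (fun v => stackSumBlock κ g p q (b.map Sum.inl ++ v)) l =
        stackSumBlock κ g p [] (b.map Sum.inl) *
          centered φ (fun v => stackSum κ g v q []) l :=
    fun l b hl hn => ih _ hn l b hl rfl
  have hfac : ∀ (l : List (List (A ⊕ A))) (b : List A), IsAlternating false l →
      b.length + l.flatten.length ≤ n → ∀ q : List A,
      centered φ (fun v => stackSum κ g (b.map Sum.inl ++ v) q []) l =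
        stackSum κ g (b.map Sum.inl) [] [] *
          centered φ (fun v => stackSum κ g v q []) l := by
    intro l b hl hn q
    cases b with
    | nil => simp [stackSum, hg]
    | cons i b =>
      simp only [List.map_cons, List.cons_append, stackSum_inl]
      refine ih' l b hl ?_ [i] q
      simp only [List.length_cons] at hn
      omega
  intro l b hl hn p q
  set K := centered φ (fun v => stackSum κ g v q []) l with hK
  -- The block continues inside `b`: this shortens the prefix, and induction applies.
  have h1 : centered φ (fun v => splitSum (fun u => stackSum κ g u [] [])
      (fun c u => stackSumBlock κ g (p ++ [c]) q (u ++ v)) (b.map Sum.inl)) l =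
      K * splitSum (fun u => stackSum κ g u [] [])
        (fun c u => stackSumBlock κ g (p ++ [c]) [] u) (b.map Sum.inl) := by
    rw [centered_splitSum_left φ _ fun c => stackSumBlock κ g (p ++ [c]) q]
    have : ∀ c u, (∃ a, b.map Sum.inl = a ++ Sum.inl c :: u) →
        centered φ (fun v => stackSumBlock κ g (p ++ [c]) q (u ++ v)) l =
          K * stackSumBlock κ g (p ++ [c]) [] u := by
      rintro c u ⟨a, e⟩
      obtain ⟨b', rfl⟩ : ∃ b' : List A, u = b'.map Sum.inl := exists_map_inl fun x hx => by
        have : x ∈ b.map Sum.inl := by rw [e]; simp [hx]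
        obtain ⟨y, -, rfl⟩ := List.mem_map.1 this
        rfl
      have hlen := congrArg List.length e
      simp only [List.length_map, List.length_append, List.length_cons] at hlen
      rw [ih' l b' hl (by omega), mul_comm]
    rw [splitSum_congr fun a c u e => this c u ⟨a, e⟩]
    exact splitSum_mul_right K _ _ _
  -- The block continues inside `l`. The list before the splitting letter is nonempty, because the
  -- first word of `l` consists of `y`'s.
  have h2 : centered φ (splitSum (fun u => stackSum κ g (b.map Sum.inl ++ u) [] [])
      (fun c u => stackSumBlock κ g (p ++ [c]) q u)) l = 0 := by
    refine centered_splitSum_eq_zero φ _ l _ fun l₁ a c d l₂ e => ?_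
    have hne : l₁ ≠ [] := by
      rintro rfl
      rw [e] at hl
      simpa using hl.2.1 (Sum.inl c) (by simp)
    have hlen : l₁.flatten.length + a.length < l.flatten.length := by
      rw [e]
      simp only [List.flatten_append, List.flatten_cons, List.length_append, List.length_cons]
      omega
    have key : ∀ l', l' ≠ [] → l'.flatten.length < l.flatten.length → IsAlternating false l' →
        centered φ (fun v => stackSum κ g (b.map Sum.inl ++ v) [] []) l' = 0 := by
      intro l' hne' hlen' halt'
      rw [hfac l' b halt' (by omega),
        (centered_stackSum_eq_zero_of hg hx hy ih' hne' (by omega)).2 halt', mul_zero]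
    rw [e] at hl
    have h3 := key l₁ hne (by omega) hl.prefix
    by_cases ha : a = []
    · subst ha
      simpa using h3
    -- The last factor `a` is not centered, but centering it changes the value by a multiple of
    -- `h3`, which is zero.
    · have h4 := key (l₁ ++ [a]) (by simp) (by simpa using hlen) (hl.prefix_concat ha)
      rw [centered_concat, h3, mul_zero, sub_zero] at h4
      exact h4
  have h5 : (fun v => stackSumBlock κ g p q (b.map Sum.inl ++ v)) = fun v =>
      κ p * stackSum κ g (b.map Sum.inl ++ v) q [] +
      (splitSum (fun u => stackSum κ g u [] [])
        (fun c u => stackSumBlock κ g (p ++ [c]) q (u ++ v)) (b.map Sum.inl) +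
      splitSum (fun u => stackSum κ g (b.map Sum.inl ++ u) [] [])
        (fun c u => stackSumBlock κ g (p ++ [c]) q u) v) := by
    funext v
    rw [stackSumBlock_eq, splitSum_append]
  rw [h5, centered_add, centered_add, centered_mul, h1, h2, hfac l b hl hn.le,
    stackSumBlock_eq κ g p []]
  ring

/-- `stackSum` vanishes at centered alternating products. -/
theorem centered_stackSum {c : Bool} {l : List (List (A ⊕ A))} (hl : l ≠ [])
    (h : IsAlternating c l) : centered φ (fun v => stackSum κ g v [] []) l = 0 := by
  have := centered_stackSum_eq_zero_of hg hx hy (n := l.flatten.length)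
    (fun l b hl _ => centered_stackSumBlock hg hx hy _ l b hl rfl) hl le_rfl
  cases c
  · exact this.2 h
  · exact this.1 h []

end StackSum

/-! ### The free product recursion as an expanded centered product -/

section FreeProduct

theorem sum_finset_fin_succ {M : Type*} [AddCommMonoid M] {n : ℕ} (F : Finset (Fin (n + 1)) → M) :
    ∑ I, F I = ∑ J : Finset (Fin n), F (insert 0 (J.map (Fin.succEmb n))) +
      ∑ J : Finset (Fin n), F (J.map (Fin.succEmb n)) := by
  have h0 : ∀ J : Finset (Fin n), (0 : Fin (n + 1)) ∉ J.map (Fin.succEmb n) := fun J h => by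
    obtain ⟨j, -, hj⟩ := mem_map.1 h
    exact Fin.succ_ne_zero j hj
  have hpre : ∀ I : Finset (Fin (n + 1)), 0 ∉ I →
      (univ.filter fun j : Fin n => j.succ ∈ I).map (Fin.succEmb n) = I := fun I hI => by
    ext i
    simp only [mem_map, mem_filter, mem_univ, true_and, Fin.coe_succEmb]
    constructor
    · rintro ⟨j, hj, rfl⟩
      exact hj
    · intro hi
      obtain ⟨j, rfl⟩ := Fin.exists_succ_eq.2 (fun h : i = 0 => hI (h ▸ hi))
      exact ⟨j, hi, rfl⟩
  have hinj : Function.Injective fun J : Finset (Fin n) => J.map (Fin.succEmb n) :=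
    map_injective _
  rw [← sum_filter_add_sum_filter_not univ (fun I : Finset (Fin (n + 1)) => 0 ∈ I)]
  congr 1
  · symm
    refine sum_bij (fun J _ => insert 0 (J.map (Fin.succEmb n))) ?_ ?_ ?_ fun _ _ => rfl
    · intro J _
      simp
    · intro J _ J' _ h
      refine hinj ?_
      have := congrArg (fun I => I.erase 0) h
      simpa [erase_insert (h0 _)] using this
    · intro I hI
      have hI' : (0 : Fin (n + 1)) ∈ I := (mem_filter.1 hI).2
      have := hpre (I.erase 0) (by simp)
      exact ⟨_, mem_univ _, by rw [this, insert_erase hI']⟩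
  · symm
    refine sum_bij (fun J _ => J.map (Fin.succEmb n)) ?_ ?_ ?_ fun _ _ => rfl
    · intro J _
      simp
    · intro J _ J' _ h
      exact hinj h
    · intro I hI
      exact ⟨_, mem_univ _, hpre I (mem_filter.1 hI).2⟩

theorem restrict_cons_map {α : Type*} (a : α) (l : List α) (J : Finset (Fin l.length)) :
    restrict (a :: l) (J.map (Fin.succEmb l.length)) = restrict l J := by
  unfold restrict
  rw [← map_sort (r := (· ≤ ·)) (r' := (· ≤ ·))]
  · rw [List.map_map]
    rfl
  · intro i _ j _
    simp

theorem restrict_cons_insert {α : Type*} (a : α) (l : List α) (J : Finset (Fin l.length)) :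
    restrict (a :: l) (insert (0 : Fin (l.length + 1)) (J.map (Fin.succEmb l.length))) =
      a :: restrict l J := by
  conv_rhs => rw [← restrict_cons_map a l J]
  exact wordOn_insert (a :: l).get (m := (0 : Fin (l.length + 1))) fun x hx => by
    obtain ⟨j, -, rfl⟩ := mem_map.1 hx
    exact Fin.succ_pos j

theorem restrict_univ {α : Type*} (l : List α) : restrict l univ = l := wordOn_get_univ l

variable {A R : Type*} [CommRing R] (φ : List (A ⊕ A) → R)

/-- The product of the `a - φ a` is multiplied out; `I` collects the factors from which the word
itself is taken. -/
theorem centered_eq_sum (ψ : List (A ⊕ A) → R) (l : List (List (A ⊕ A))) :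
    centered φ ψ l = ∑ I : Finset (Fin l.length),
      (-1) ^ (l.length - I.card) * ψ (restrict l I).flatten * ∏ i ∈ Iᶜ, φ (l.get i) := by
  induction l generalizing ψ with
  | nil =>
    have h : ∀ I : Finset (Fin ([] : List (List (A ⊕ A))).length), I = ∅ := fun I =>
      eq_empty_of_forall_notMem fun i => Fin.elim0 i
    rw [Fintype.sum_eq_single ∅ fun I hI => absurd (h I) hI, h ∅ᶜ]
    simp [centered, restrict]
  | cons a l ih =>
    rw [centered, ih, ih]
    refine Eq.trans ?_ (sum_finset_fin_succ (n := l.length) _).symm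
    rw [sub_eq_add_neg, mul_sum, ← sum_neg_distrib]
    have h0 : ∀ J : Finset (Fin l.length), (0 : Fin (l.length + 1)) ∉ J.map (Fin.succEmb _) :=
      fun J h => by
        obtain ⟨j, -, hj⟩ := mem_map.1 h
        exact Fin.succ_ne_zero j hj
    have hc : ∀ J : Finset (Fin l.length),
        (J.map (Fin.succEmb l.length))ᶜ = insert 0 (Jᶜ.map (Fin.succEmb l.length)) := fun J => by
      ext i
      refine Fin.cases ?_ (fun j => ?_) i
      · simp
      · simp [Fin.succ_ne_zero]
    congr 1
    · refine sum_congr rfl fun J _ => ?_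
      rw [restrict_cons_insert, List.flatten_cons, card_insert_of_notMem (h0 J), card_map]
      rw [show (a :: l).length - (J.card + 1) = l.length - J.card by
        rw [List.length_cons]; omega]
      congr 1
      have : (insert (0 : Fin (l.length + 1)) (J.map (Fin.succEmb l.length)))ᶜ =
          Jᶜ.map (Fin.succEmb l.length) := by
        ext i
        refine Fin.cases ?_ (fun j => ?_) i
        · simp
        · simp [Fin.succ_ne_zero]
      refine Eq.trans ?_ (congrArg (fun s => ∏ i ∈ s, φ ((a :: l).get i)) this).symm
      rw [prod_map]
      rfl
    · refine sum_congr rfl fun J _ => ?_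
      have hJ : J.card ≤ l.length := (card_le_univ J).trans_eq (Fintype.card_fin _)
      have e : (a :: l).length - J.card = l.length - J.card + 1 := by
        rw [List.length_cons, Nat.succ_sub hJ]
      rw [restrict_cons_map, card_map, e, pow_succ]
      have hprod : ∏ i ∈ (J.map (Fin.succEmb l.length))ᶜ,
          (fun i : Fin (l.length + 1) => φ ((a :: l).get i)) i =
          φ a * ∏ x ∈ Jᶜ, φ (l.get x) := by
        rw [hc, prod_insert (h0 _), prod_map]
        rfl
      refine Eq.trans ?_ (congrArg (fun t => (-1) ^ (l.length - J.card) * -1 *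
        ψ (restrict l J).flatten * t) hprod).symm
      ring

theorem isAlternating_of_isChain {l : List (List (A ⊕ A))} {c : Bool} (h1 : [] ∉ l)
    (h2 : ∀ a ∈ l, ∀ x ∈ a, ∀ y ∈ a, x.isLeft = y.isLeft)
    (h3 : l.IsChain fun a b => ∀ x ∈ a, ∀ y ∈ b, x.isLeft ≠ y.isLeft)
    (h4 : ∀ a ∈ l.head?, ∀ x ∈ a, x.isLeft = c) : IsAlternating c l := by
  induction l generalizing c with
  | nil => trivial
  | cons a l ih =>
    have ha : a ≠ [] := fun h => h1 (h ▸ List.mem_cons_self)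
    refine ⟨ha, h4 a rfl, ih (fun h => h1 (List.mem_cons_of_mem _ h))
      (fun b hb => h2 b (List.mem_cons_of_mem _ hb)) (List.IsChain.tail h3) ?_⟩
    intro b hb y hy
    obtain ⟨x, hx⟩ := List.exists_mem_of_ne_nil a ha
    have hxc := h4 a rfl x hx
    have : x.isLeft ≠ y.isLeft := by
      cases l with
      | nil => simp at hb
      | cons d l =>
        simp only [List.head?_cons, Option.mem_some_iff] at hb
        subst hb
        exact (List.isChain_cons_cons.1 h3).1 x hx y hy
    rw [hxc] at this
    revert this
    cases c <;> cases y.isLeft <;> simp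

theorem exists_isAlternating_runs {s : ℕ} (v : List (Fin s ⊕ Fin s)) :
    ∃ c, IsAlternating c (runs v) := by
  have hsame : ∀ a ∈ runs v, ∀ x ∈ a, ∀ y ∈ a, x.isLeft = y.isLeft := by
    intro a ha
    have hc := List.isChain_of_mem_splitBy
      (r := fun a b : Fin s ⊕ Fin s => a.isLeft == b.isLeft) ha
    have hp : a.Pairwise fun x y => x.isLeft = y.isLeft := by
      refine List.IsChain.pairwise (R := fun x y : Fin s ⊕ Fin s => x.isLeft = y.isLeft) ?_
      refine hc.imp fun x y h => by simpa using h
    intro x hx y hy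
    by_cases hxy : x = y
    · rw [hxy]
    have : Std.Symm fun x y : Fin s ⊕ Fin s => x.isLeft = y.isLeft := ⟨fun _ _ h => h.symm⟩
    exact hp.forall hx hy hxy
  have hchain := List.isChain_getLast_head_splitBy
    (fun a b : Fin s ⊕ Fin s => a.isLeft == b.isLeft) v
  have hne : [] ∉ runs v := List.nil_notMem_splitBy _ v
  refine ⟨((runs v).head?.bind List.head?).elim true Sum.isLeft,
    isAlternating_of_isChain hne hsame ?_ ?_⟩
  · refine List.IsChain.imp_of_mem_imp ?_ hchain
    rintro a b ha' hb' ⟨ha, hb, h⟩ x hx y hy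
    rw [hsame a ha' x hx _ (List.getLast_mem ha), hsame b hb' y hy _ (List.head_mem hb)]
    simpa using h
  · intro a ha x hx
    have ha' : a ∈ runs v := List.mem_of_mem_head? ha
    rw [Option.mem_def] at ha
    cases a with
    | nil => exact absurd ha' hne
    | cons y a =>
      rw [ha]
      exact hsame _ ha' x hx y List.mem_cons_self

theorem flatten_runs {s : ℕ} (v : List (Fin s ⊕ Fin s)) : (runs v).flatten = v :=
  List.flatten_splitBy _ v

variable {s : ℕ} (a g : Series s R)

theorem coeff_nil (f : Series s R) : coeff f [] = 1 := by simp [coeff]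

theorem coeff_coe (f : Series s R) (w : NWord s) : coeff f w.1 = f w := by
  simp [coeff, w.2]

theorem coeff_zeta : coeff (zeta s R) = fun _ => 1 := by
  funext w
  unfold coeff zeta
  split_ifs <;> rfl

theorem box_eq_stackSum (w : NWord s) :
    box a g w = stackSum (coeff a) (coeff g) (interleave w.1) [] [] :=
  (isBoxSystem_stackSum (coeff a) (coeff g)).box_eq w

theorem coeff_box (w : List (Fin s)) :
    coeff (box a g) w = stackSum (coeff a) (coeff g) (interleave w) [] [] := by
  by_cases h : w = []
  · subst h
    simp [coeff_nil, interleave, stackSum]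
  · rw [← box_eq_stackSum a g ⟨w, h⟩]
    simp [coeff, h]

/-- The free product is given by sums over stacks with the cumulants of the first functional. -/
theorem freeProd_eq_stackSum (v : List (Fin s ⊕ Fin s)) :
    freeProd (box a (zeta s R)) g v = stackSum (coeff a) (coeff g) v [] [] := by
  induction hn : v.length using Nat.strong_induction_on generalizing v with
  | _ n ih =>
  subst hn
  rw [freeProd]
  split_ifs with hv
  · subst hv
    simp [stackSum, coeff_nil]
  set φ := runValue (box a (zeta s R)) g with hφ
  set ψ := fun v => stackSum (coeff a) (coeff g) v [] [] with hψ
  have hx : ∀ b : List (Fin s), b ≠ [] →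
      φ (b.map Sum.inl) = stackSum (coeff a) (coeff g) (b.map Sum.inl) [] [] := by
    intro b _
    have := stackSum_one_interleave (coeff a) (coeff g) (coeff_nil g) b [] []
    rw [List.map_nil] at this
    rw [← this, ← coeff_zeta, ← coeff_box, hφ, runValue, if_pos]
    · rw [List.map_map]
      simp
    · simp
  have hy : ∀ p : List (Fin s), p ≠ [] → φ (p.map Sum.inr) = coeff g p := by
    intro p hp
    rw [hφ, runValue, if_neg]
    · rw [List.map_map]
      simp
    · obtain _ | ⟨i, p⟩ := p
      · exact absurd rfl hp
      · simp
  obtain ⟨c, hc⟩ := exists_isAlternating_runs v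
  have hne : runs v ≠ [] := fun h => hv (by rw [← flatten_runs v, h, List.flatten_nil])
  -- The vanishing is applied to the maximal one-coloured subwords. The term `I = univ` is the value
  -- at `v`; solving for it produces the additional sign in the recursion of `freeProd`.
  have h0 := centered_stackSum (coeff_nil g) hx hy hne hc
  rw [centered_eq_sum, ← add_sum_erase _ _ (mem_univ univ)] at h0
  rw [← add_sum_erase _ _ (mem_univ univ), dif_pos rfl, zero_add]
  rw [restrict_univ, flatten_runs] at h0
  simp only [card_univ, Fintype.card_fin, Nat.sub_self, pow_zero, one_mul, compl_univ,
    prod_empty, mul_one] at h0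
  rw [eq_neg_of_add_eq_zero_left h0, ← sum_neg_distrib]
  refine sum_congr rfl fun I hI => ?_
  have hI' : I ≠ univ := ne_of_mem_erase hI
  rw [dif_neg hI', ih _ ?_ _ rfl, pow_succ]
  · ring
  · have := length_flatten_restrict_lt (runs v) (List.nil_notMem_splitBy _ v) I hI'
    rwa [flatten_runs] at this

/-- The free multiplicative convolution in terms of the cumulants of the first factor. -/
theorem boxV_box_zeta : boxV (box a (zeta s R)) g = box a g := by
  funext w
  rw [boxV, freeProd_eq_stackSum, box_eq_stackSum]
  rfl

end FreeProduct

/-! ### The group of the boxed convolution -/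

section Monoid

open WSeries

variable {s : ℕ} {R : Type*} [CommRing R]

theorem coeff_injective : Function.Injective (coeff : Series s R → List (Fin s) → R) := by
  intro f g h
  funext w
  rw [← coeff_coe f w, ← coeff_coe g w, h]

/-- Both substitutions expand to the constant term plus `∑ a_i X_i h_i`, and both constant terms are
`1`. The two forms let a product enter a further product from either side. -/
theorem exists_isFactorPair_box (f g : Series s R) : ∃ a h : Fin s → WSeries (Fin s) R,
    IsFactorPair ⟨coeff f⟩ ⟨coeff g⟩ a h ∧
    (⟨coeff (box f g)⟩ : WSeries (Fin s) R) = subst (fun j => a j * X j) ⟨coeff g⟩ ∧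
    (⟨coeff (box f g)⟩ : WSeries (Fin s) R) = subst (fun j => X j * h j) ⟨coeff f⟩ := by
  obtain ⟨H, hN⟩ := (isBoxSystem_stackSum (coeff f) (coeff g)).isFactorPair
  refine ⟨_, _, H, ?_⟩
  have h1 : (⟨coeff (box f g)⟩ : WSeries (Fin s) R) = subst (fun j =>
      subst (fun j => X j * ⟨fun u => stackSum (coeff f) (coeff g) (interleave u) [j] []⟩)
        (shiftR j ⟨coeff f⟩) * X j) ⟨coeff g⟩ := by
    rw [← hN]
    ext w
    exact coeff_box f g w
  refine ⟨h1, ?_⟩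
  rw [h1, H.subst_left, H.subst_right]
  simp only [coeff_nil]

theorem box_assoc (f g h : Series s R) : box (box f g) h = box f (box g h) := by
  obtain ⟨a₁, h₁, H₁, e₁, -⟩ := exists_isFactorPair_box f g
  obtain ⟨a₂, h₂, H₂, e₂, -⟩ := exists_isFactorPair_box (box f g) h
  obtain ⟨a₃, h₃, H₃, e₃, e₃'⟩ := exists_isFactorPair_box g h
  obtain ⟨a₄, h₄, H₄, e₄, -⟩ := exists_isFactorPair_box f (box g h)
  have := H₁.assoc H₂ H₃ H₄ e₁ e₃ e₃'
  rw [← e₂, ← e₄] at this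
  exact coeff_injective (congrArg toFun this)

theorem shift_boxUnit (i : Fin s) : shift i ⟨coeff (boxUnit s R)⟩ = 1 := by
  ext u
  cases u <;> simp [shift, coeff, boxUnit, one_def]

theorem shiftR_boxUnit (i : Fin s) : shiftR i ⟨coeff (boxUnit s R)⟩ = 1 := by
  ext u
  cases u <;> simp [shiftR, coeff, boxUnit, one_def]

theorem subst_one (E : Fin s → WSeries (Fin s) R) (hE : ∀ i, E i [] = 0) : subst E 1 = 1 :=
  subst_C hE 1

theorem box_boxUnit (f : Series s R) : box f (boxUnit s R) = f := by
  obtain ⟨a, h, H, -, e⟩ := exists_isFactorPair_box f (boxUnit s R)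
  have h1 : ∀ i, h i = 1 := fun i => by
    rw [H.right, shift_boxUnit, subst_one _ fun i => mul_X_nil _ _]
  simp only [h1, mul_one] at e
  exact coeff_injective (congrArg toFun (e.trans (subst_variables _)))

theorem boxUnit_box (f : Series s R) : box (boxUnit s R) f = f := by
  obtain ⟨a, h, H, e, -⟩ := exists_isFactorPair_box (boxUnit s R) f
  have h1 : ∀ i, a i = 1 := fun i => by
    rw [H.left, shiftR_boxUnit, subst_one _ fun i => X_mul_nil _ _]
  simp only [h1, one_mul] at e
  exact coeff_injective (congrArg toFun (e.trans (subst_variables _)))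

theorem box_mem {f g : Series s R} (hf : f ∈ GPlus s R) (hg : g ∈ GPlus s R) :
    box f g ∈ GPlus s R := by
  rintro ⟨w, hw⟩ hl
  obtain ⟨i, rfl⟩ := List.length_eq_one_iff.1 hl
  have h1 : coeff f [i] = 1 := (coeff_coe f ⟨[i], hw⟩).trans (hf _ hl)
  have h2 : coeff g [i] = 1 := (coeff_coe g ⟨[i], hw⟩).trans (hg _ hl)
  rw [box_eq_stackSum]
  simp [interleave, stackSum, h1, h2]

theorem boxUnit_mem : boxUnit s R ∈ GPlus s R := fun w hw => by simp [boxUnit, hw]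

theorem zeta_mem : zeta s R ∈ GPlus s R := fun _ _ => rfl

end Monoid

/-! ### Unitriangularity of the boxed convolution -/

section Triangular

variable {n : ℕ}

theorem KrewerasRel.trans {α : Type*} [LinearOrder α] {P : Finset (Finset α)} {i j k : α}
    (h : KrewerasRel P i j) (h' : KrewerasRel P j k) : KrewerasRel P i k := by
  intro V hV a ha b hb
  have h1 := h V hV a ha b hb
  have h2 := h' V hV a ha b hb
  tauto

theorem not_krewerasRel {α : Type*} [LinearOrder α] {P : Finset (Finset α)} {B : Finset α}
    (hB : B ∈ P) {a b : α} (ha : a ∈ B) (hb : b ∈ B) (hab : a ≠ b) : ¬ KrewerasRel P a b := by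
  intro h
  rcases lt_or_gt_of_ne hab with hlt | hlt
  · have := h B hB a ha b hb
    simp [hlt, hlt.not_gt] at this
  · have := h B hB a ha b hb
    simp [hlt, hlt.not_gt] at this

theorem krewerasClasses_singleton_univ {C : Finset (Fin n)}
    (hC : C ∈ krewerasClasses univ {univ}) : C.card = 1 := by
  classical
  obtain ⟨x, -, rfl⟩ := mem_image.1 hC
  rw [card_eq_one]
  refine ⟨x, ?_⟩
  ext y
  simp only [mem_filter, mem_univ, true_and, mem_singleton]
  constructor
  · intro h
    by_contra hne
    exact not_krewerasRel (mem_singleton_self _) (mem_univ x) (mem_univ y) (Ne.symm hne) h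
  · rintro rfl
    exact KrewerasRel.refl _ _

theorem IsNCPart.eq_singleton_univ {P : Finset (Finset (Fin n))} (h : IsNCPart P univ)
    (hP : univ ∈ P) : P = {univ} := by
  ext B
  rw [mem_singleton]
  constructor
  · intro hB
    obtain ⟨x, hx⟩ := h.nonempty B hB
    exact h.unique B hB univ hP x hx (mem_univ x)
  · rintro rfl
    exact hP

/-- The partition into singletons. -/
def singletons (n : ℕ) : Finset (Finset (Fin n)) := univ.image fun i => {i}

theorem card_of_mem_singletons {B : Finset (Fin n)} (hB : B ∈ singletons n) : B.card = 1 := by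
  obtain ⟨i, -, rfl⟩ := mem_image.1 hB
  simp

/-- Two distinct points of a block are never complement-equivalent, so a single complement class
leaves room only for singleton blocks. -/
theorem IsNCPart.eq_singletons {P : Finset (Finset (Fin n))} (h : IsNCPart P univ)
    (hP : univ ∈ krewerasClasses univ P) : P = singletons n := by
  classical
  obtain ⟨x, -, hx⟩ := mem_image.1 hP
  have hrel : ∀ i j, KrewerasRel P i j := fun i j => by
    have hi : i ∈ univ.filter fun y => KrewerasRel P x y := by rw [hx]; exact mem_univ i
    have hj : j ∈ univ.filter fun y => KrewerasRel P x y := by rw [hx]; exact mem_univ j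
    exact (mem_filter.1 hi).2.symm.trans (mem_filter.1 hj).2
  have hB : ∀ B ∈ P, ∀ i ∈ B, B = {i} := fun B hB i hi => by
    ext j
    rw [mem_singleton]
    constructor
    · intro hj
      by_contra hne
      exact not_krewerasRel hB hj hi hne (hrel j i)
    · rintro rfl
      exact hi
  ext B
  simp only [singletons, mem_image, mem_univ, true_and]
  constructor
  · intro h'
    obtain ⟨i, hi⟩ := h.nonempty B h'
    exact ⟨i, (hB B h' i hi).symm⟩
  · rintro ⟨i, rfl⟩
    obtain ⟨B, hB', hi⟩ := h.cover i (mem_univ i)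
    rwa [← hB B hB' i hi]

theorem krewerasClasses_singletons (hn : 0 < n) :
    krewerasClasses univ (singletons n) = {univ} := by
  classical
  have hrel : ∀ i j, KrewerasRel (singletons n) i j := by
    intro i j V hV a ha b hb
    obtain ⟨c, -, rfl⟩ := mem_image.1 hV
    rw [mem_singleton] at ha hb
    subst ha
    subst hb
    simp
  ext C
  simp only [krewerasClasses, hrel, mem_image, mem_univ, true_and, mem_singleton]
  constructor
  · rintro ⟨i, h⟩
    simpa using h.symm
  · rintro rfl
    exact ⟨⟨0, hn⟩, by simp⟩

theorem isNCPart_singleton_univ (hn : 0 < n) :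
    IsNCPart ({univ} : Finset (Finset (Fin n))) univ := by
  constructor
  · intro B hB
    rw [mem_singleton.1 hB]
    exact ⟨⟨0, hn⟩, mem_univ _⟩
  · exact fun B _ => subset_univ B
  · exact fun x _ => ⟨univ, mem_singleton_self _, mem_univ x⟩
  · intro B hB C hC x _ _
    rw [mem_singleton.1 hB, mem_singleton.1 hC]
  · intro a b c d _ _ _ U hU V hV _ _ _ _
    rw [mem_singleton.1 hU, mem_singleton.1 hV]

theorem isNCPart_singletons : IsNCPart (singletons n) univ := by
  have h : ∀ B ∈ singletons n, ∀ x ∈ B, B = {x} := fun B hB x hx => by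
    obtain ⟨i, -, rfl⟩ := mem_image.1 hB
    rw [mem_singleton.1 hx]
  constructor
  · exact fun B hB => card_pos.1 (by rw [card_of_mem_singletons hB]; exact one_pos)
  · exact fun B _ => subset_univ B
  · exact fun x _ => ⟨{x}, mem_image_of_mem _ (mem_univ x), mem_singleton_self x⟩
  · intro B hB C hC x hx hx'
    rw [h B hB x hx, h C hC x hx']
  · intro a b c d hab hbc _ U hU V hV ha hc _ _
    have := h U hU a ha ▸ hc
    rw [mem_singleton] at this
    exact absurd (hab.trans hbc) (by simp [this])

variable {s : ℕ} {R : Type*} [CommRing R]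

theorem coeff_wordOn_card_one {f : Series s R} (hf : f ∈ GPlus s R) (w : List (Fin s))
    {B : Finset (Fin w.length)} (hB : B.card = 1) : coeff f (wordOn w.get B) = 1 := by
  obtain ⟨i, rfl⟩ := card_eq_one.1 hB
  rw [wordOn_singleton]
  exact (coeff_coe f ⟨_, by simp⟩).trans (hf _ rfl)

theorem length_wordOn {α A : Type*} [LinearOrder α] (w : α → A) (B : Finset α) :
    (wordOn w B).length = B.card := by simp [wordOn]

theorem coeff_congr_of_length {f f' : Series s R} {m : ℕ}
    (h : ∀ v : NWord s, v.1.length < m → f v = f' v) {v : List (Fin s)} (hv : v.length < m) :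
    coeff f v = coeff f' v := by
  unfold coeff
  split_ifs with h0
  · rfl
  · exact h _ hv

/-- The coefficient of the boxed convolution at `w` is the sum of the coefficients of the
factors up to a function of the coefficients at shorter words. -/
theorem box_sub_box {f f' g g' : Series s R} (hf : f ∈ GPlus s R) (hf' : f' ∈ GPlus s R)
    (hg : g ∈ GPlus s R) (hg' : g' ∈ GPlus s R) {w : NWord s} (hw : 2 ≤ w.1.length)
    (hff' : ∀ v : NWord s, v.1.length < w.1.length → f v = f' v)
    (hgg' : ∀ v : NWord s, v.1.length < w.1.length → g v = g' v) :
    box f g w - box f' g' w = (f w - f' w) + (g w - g' w) := by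
  classical
  have hn : 0 < w.1.length := by omega
  have hne : ({univ} : Finset (Finset (Fin w.1.length))) ≠ singletons w.1.length := by
    intro h
    have : univ ∈ singletons w.1.length := h ▸ mem_singleton_self _
    have := card_of_mem_singletons this
    rw [card_univ, Fintype.card_fin] at this
    omega
  have hFG : ∀ (f f' : Series s R), (∀ v : NWord s, v.1.length < w.1.length → f v = f' v) →
      ∀ B : Finset (Fin w.1.length), B ≠ univ →
        coeff f (wordOn w.1.get B) = coeff f' (wordOn w.1.get B) := fun f f' h B hB => by
    refine coeff_congr_of_length h ?_
    rw [length_wordOn]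
    have := card_lt_card (ssubset_univ_iff.2 hB)
    rwa [card_univ, Fintype.card_fin] at this
  -- The whole word occurs only for the one-block partition, whose complement consists of
  -- singletons, and for the partition into singletons, whose complement is one block. Singletons
  -- weigh `1`, and every other term involves shorter words alone.
  have key : ∀ P ∈ ncParts (univ : Finset (Fin w.1.length)),
      (∏ B ∈ P, coeff f (wordOn w.1.get B)) *
          ∏ C ∈ krewerasClasses (∅ ∪ univ) P, coeff g (wordOn w.1.get C) -
        (∏ B ∈ P, coeff f' (wordOn w.1.get B)) *
          ∏ C ∈ krewerasClasses (∅ ∪ univ) P, coeff g' (wordOn w.1.get C) =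
      (if P = {univ} then f w - f' w else 0) +
        (if P = singletons w.1.length then g w - g' w else 0) := by
    intro P hP
    rw [mem_ncParts] at hP
    rw [empty_union]
    by_cases h1 : P = {univ}
    · rw [if_pos h1, if_neg (h1 ▸ hne), add_zero, h1, prod_singleton, prod_singleton,
        prod_eq_one fun C hC => coeff_wordOn_card_one hg w.1 (krewerasClasses_singleton_univ hC),
        prod_eq_one fun C hC => coeff_wordOn_card_one hg' w.1 (krewerasClasses_singleton_univ hC),
        wordOn_get_univ, coeff_coe, coeff_coe, mul_one, mul_one]
    · by_cases h2 : P = singletons w.1.length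
      · rw [if_neg h1, if_pos h2, zero_add, h2, krewerasClasses_singletons hn, prod_singleton,
          prod_singleton,
          prod_eq_one fun C hC => coeff_wordOn_card_one hf w.1 (card_of_mem_singletons hC),
          prod_eq_one fun C hC => coeff_wordOn_card_one hf' w.1 (card_of_mem_singletons hC),
          wordOn_get_univ, coeff_coe, coeff_coe, one_mul, one_mul]
      · rw [if_neg h1, if_neg h2, add_zero, sub_eq_zero]
        congr 1
        · refine prod_congr rfl fun B hB => hFG f f' hff' B ?_
          rintro rfl
          exact h1 (hP.eq_singleton_univ hB)
        · refine prod_congr rfl fun C hC => hFG g g' hgg' C ?_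
          rintro rfl
          exact h2 (hP.eq_singletons hC)
  rw [box_eq_ncSum, box_eq_ncSum, ncSum, ncSum, ← sum_sub_distrib, sum_congr rfl key,
    sum_add_distrib, sum_ite_eq', sum_ite_eq', if_pos, if_pos]
  · exact mem_ncParts.2 isNCPart_singletons
  · exact mem_ncParts.2 (isNCPart_singleton_univ hn)

end Triangular

/-! ### Inverting unitriangular maps -/

section UnitriangularMaps

/-- A map on co-ordinates whose component at `w` is the co-ordinate at `w` up to a function of
the co-ordinates at shorter words. -/
def IsUnitriangular {s : ℕ} {R : Type*} [CommRing R] (Φ : Coord s R → Coord s R) : Prop :=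
  ∀ X X' : Coord s R, ∀ w : LWord s, (∀ v : LWord s, v.1.length < w.1.length → X v = X' v) →
    Φ X w - Φ X' w = X w - X' w

variable {s : ℕ} {R : Type*} [CommRing R] {Φ : Coord s R → Coord s R}

theorem IsUnitriangular.injective (h : IsUnitriangular Φ) : Function.Injective Φ := by
  intro X X' e
  have key : ∀ n : ℕ, ∀ w : LWord s, w.1.length = n → X w = X' w := by
    intro n
    induction n using Nat.strong_induction_on with
    | _ n ih =>
    intro w hw
    have := h X X' w fun v hv => ih _ (hw ▸ hv) v rfl
    rw [e, sub_self] at this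
    exact (sub_eq_zero.1 this.symm)
  exact funext fun w => key _ w rfl

/-- The approximations of a preimage under a unitriangular map. -/
def preimageAux (Φ : Coord s R → Coord s R) (Y : Coord s R) : ℕ → Coord s R
  | 0 => 0
  | n + 1 => fun w => Y w - (Φ (preimageAux Φ Y n) w - preimageAux Φ Y n w)

theorem IsUnitriangular.surjective (h : IsUnitriangular Φ) : Function.Surjective Φ := by
  intro Y
  -- The correction `Φ X w - X w` depends only on shorter words, so the `n`-th approximation is
  -- final at words of length less than `n`; the preimage is read off diagonally.
  have h1 : ∀ n m : ℕ, n ≤ m → ∀ w : LWord s, w.1.length < n →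
      preimageAux Φ Y n w = preimageAux Φ Y m w := by
    intro n
    induction n with
    | zero => exact fun m _ w hw => absurd hw (Nat.not_lt_zero _)
    | succ n ih =>
      intro m hm w hw
      obtain _ | m := m
      · omega
      have := h (preimageAux Φ Y n) (preimageAux Φ Y m) w fun v hv =>
        ih m (by omega) v (by omega)
      simp only [preimageAux]
      linear_combination -this
  refine ⟨fun w => preimageAux Φ Y (w.1.length + 1) w, funext fun w => ?_⟩
  have := h (fun w => preimageAux Φ Y (w.1.length + 1) w) (preimageAux Φ Y w.1.length) w
    fun v hv => h1 _ _ hv v (Nat.lt_succ_self _)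
  have e : preimageAux Φ Y (w.1.length + 1) w =
    Y w - (Φ (preimageAux Φ Y w.1.length) w - preimageAux Φ Y w.1.length w) := rfl
  linear_combination this + e

end UnitriangularMaps

/-! ### Inverses, the Moebius series, and the transform `𝓡` -/

section Group

variable {s : ℕ} {R : Type*} [CommRing R]

/-- The co-ordinates centred at `e`. -/
def coords (e f : Series s R) : Coord s R := fun w => f w.toNWord - e w.toNWord

theorem point_toNWord (e : Series s R) (X : Coord s R) (w : LWord s) :
    point e X w.toNWord = e w.toNWord + X w := by
  unfold point
  rw [dif_pos (show 2 ≤ w.toNWord.1.length from w.2)]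
  rfl

theorem coords_point (e : Series s R) (X : Coord s R) : coords e (point e X) = X := by
  funext w
  rw [coords, point_toNWord]
  ring

theorem point_coords (e : Series s R) {f : Series s R} (hf : f ∈ GPlus s R) :
    point e (coords e f) = f := by
  funext w
  unfold point
  split_ifs with h
  · simp [coords, LWord.toNWord]
  · refine (hf w ?_).symm
    have := List.length_pos_iff.2 w.2
    omega

theorem point_congr (e : Series s R) {X X' : Coord s R} {n : ℕ}
    (h : ∀ v : LWord s, v.1.length < n → X v = X' v) (v : NWord s) (hv : v.1.length < n) :
    point e X v = point e X' v := by
  unfold point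
  split_ifs with h2
  · rw [h _ hv]
  · rfl

theorem isUnitriangular_box_right {f : Series s R} (hf : f ∈ GPlus s R) (e e' : Series s R) :
    IsUnitriangular fun X => coords e' (box f (point e X)) := by
  intro X X' w h
  have := box_sub_box hf hf (point_mem e X) (point_mem e X') (w := w.toNWord) w.2
    (fun _ _ => rfl) (point_congr e h)
  rw [point_toNWord, point_toNWord] at this
  simp only [coords]
  linear_combination this

theorem isUnitriangular_box_left {f : Series s R} (hf : f ∈ GPlus s R) (e e' : Series s R) :
    IsUnitriangular fun X => coords e' (box (point e X) f) := by
  intro X X' w h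
  have := box_sub_box (point_mem e X) (point_mem e X') hf hf (w := w.toNWord) w.2
    (point_congr e h) (fun _ _ => rfl)
  rw [point_toNWord, point_toNWord] at this
  simp only [coords]
  linear_combination this

theorem exists_box_eq {f h : Series s R} (hf : f ∈ GPlus s R) (hh : h ∈ GPlus s R) :
    ∃ g ∈ GPlus s R, box f g = h := by
  obtain ⟨X, hX⟩ := (isUnitriangular_box_right hf (boxUnit s R) (boxUnit s R)).surjective
    (coords (boxUnit s R) h)
  exact ⟨point (boxUnit s R) X, point_mem _ X, (point_coords (boxUnit s R)
    (box_mem hf (point_mem _ X))).symm.trans ((congrArg (point _) hX).trans (point_coords _ hh))⟩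

/-- The right inverse for the boxed convolution. -/
noncomputable def boxInv (f : GPlus s R) : GPlus s R :=
  ⟨_, (exists_box_eq f.2 (boxUnit_mem (s := s))).choose_spec.1⟩

theorem box_boxInv (f : GPlus s R) : box f.1 (boxInv f).1 = boxUnit s R :=
  (exists_box_eq f.2 (boxUnit_mem (s := s))).choose_spec.2

variable (s R) in
/-- The group of the boxed convolution. -/
noncomputable abbrev boxGroup : Group (GPlus s R) :=
  letI : Mul (GPlus s R) := ⟨fun f g => ⟨box f.1 g.1, box_mem f.2 g.2⟩⟩
  letI : One (GPlus s R) := ⟨⟨boxUnit s R, boxUnit_mem⟩⟩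
  letI : Inv (GPlus s R) := ⟨boxInv⟩
  Group.ofRightAxioms (fun f g h => Subtype.ext (box_assoc f.1 g.1 h.1))
    (fun f => Subtype.ext (box_boxUnit f.1)) (fun f => Subtype.ext (box_boxInv f))

theorem boxInv_box (f : GPlus s R) : box (boxInv f).1 f.1 = boxUnit s R :=
  congrArg Subtype.val ((boxGroup s R).inv_mul_cancel f)

theorem moeb_spec : box (zeta s R) (moeb s R) = boxUnit s R ∧
    box (moeb s R) (zeta s R) = boxUnit s R :=
  Classical.epsilon_spec (p := fun m => box (zeta s R) m = boxUnit s R ∧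
    box m (zeta s R) = boxUnit s R)
    ⟨_, box_boxInv ⟨zeta s R, zeta_mem⟩, boxInv_box ⟨zeta s R, zeta_mem⟩⟩

theorem zeta_box_moeb : box (zeta s R) (moeb s R) = boxUnit s R := moeb_spec.1

theorem moeb_box_zeta : box (moeb s R) (zeta s R) = boxUnit s R := moeb_spec.2

theorem eq_moeb {m : Series s R} (h : box (zeta s R) m = boxUnit s R) : m = moeb s R := by
  rw [← boxUnit_box m, ← moeb_box_zeta, box_assoc, h, box_boxUnit]

theorem moeb_mem : moeb s R ∈ GPlus s R := by
  rw [← eq_moeb (box_boxInv ⟨zeta s R, zeta_mem⟩)]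
  exact (boxInv _).2

theorem rTransform_mem {f : Series s R} (hf : f ∈ GPlus s R) : rTransform f ∈ GPlus s R :=
  box_mem hf moeb_mem

theorem rTransform_zeta : rTransform (zeta s R) = boxUnit s R := zeta_box_moeb

theorem rTransform_box_zeta (f : Series s R) : box (rTransform f) (zeta s R) = f := by
  rw [rTransform, box_assoc, moeb_box_zeta, box_boxUnit]

/-- By Moebius inversion, `f` has cumulants `𝓡(f)`, and the free product was computed from the
cumulants of its first factor. -/
theorem boxV_eq (f g : Series s R) : boxV f g = box (rTransform f) g := by
  conv_lhs => rw [← rTransform_box_zeta f]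
  exact boxV_box_zeta _ _

theorem rTransform_boxV (f g : Series s R) :
    rTransform (boxV f g) = box (rTransform f) (rTransform g) := by
  rw [boxV_eq, rTransform, box_assoc]
  rfl

theorem boxV_mem {f g : Series s R} (hf : f ∈ GPlus s R) (hg : g ∈ GPlus s R) :
    boxV f g ∈ GPlus s R := by
  rw [boxV_eq]
  exact box_mem (rTransform_mem hf) hg

theorem boxV_zeta (f : Series s R) : boxV f (zeta s R) = f := by
  rw [boxV_eq, rTransform_box_zeta]

theorem zeta_boxV (f : Series s R) : boxV (zeta s R) f = f := by
  rw [boxV_eq, rTransform_zeta, boxUnit_box]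

variable (s R) in
/-- The transform `f ↦ f ⊠ Moeb`, as a bijection. -/
noncomputable def rEquiv : GPlus s R ≃ GPlus s R where
  toFun f := ⟨rTransform f.1, rTransform_mem f.2⟩
  invFun f := ⟨box f.1 (zeta s R), box_mem f.2 zeta_mem⟩
  left_inv f := Subtype.ext (rTransform_box_zeta f.1)
  right_inv f := Subtype.ext (by
    simp only [rTransform]
    rw [box_assoc, zeta_box_moeb, box_boxUnit])

end Group

/-! ### Compatibility with ring homomorphisms -/

section Naturality

variable {s : ℕ} {R S : Type*} [CommRing R] [CommRing S] (φ : R →+* S)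

theorem map_coeff (f : Series s R) (w : List (Fin s)) :
    φ (coeff f w) = coeff (fun v => φ (f v)) w := by
  unfold coeff
  split_ifs <;> simp

theorem map_box (f g : Series s R) (w : NWord s) :
    φ (box f g w) = box (fun v => φ (f v)) (fun v => φ (g v)) w := by
  simp only [box, map_sum, map_mul, map_prod, map_coeff]

theorem map_boxUnit (w : NWord s) : φ (boxUnit s R w) = boxUnit s S w := by
  unfold boxUnit
  split_ifs <;> simp

theorem map_zeta (w : NWord s) : φ (zeta s R w) = zeta s S w := map_one φ

/-- Moeb is chosen separately over each ring, so naturality comes from the uniqueness of a right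
inverse of Zeta. -/
theorem map_moeb (w : NWord s) : φ (moeb s R w) = moeb s S w := by
  refine congrFun (eq_moeb (m := fun w => φ (moeb s R w)) ?_) w
  funext w
  have := map_box φ (zeta s R) (moeb s R) w
  rw [zeta_box_moeb, map_boxUnit] at this
  rw [this]
  congr 1
  funext v
  exact (map_zeta φ v).symm

theorem map_rTransform (f : Series s R) (w : NWord s) :
    φ (rTransform f w) = rTransform (fun v => φ (f v)) w := by
  rw [rTransform, map_box, rTransform]
  congr 1
  funext v
  exact map_moeb φ v

theorem map_boxV (f g : Series s R) (w : NWord s) :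
    φ (boxV f g w) = boxV (fun v => φ (f v)) (fun v => φ (g v)) w := by
  rw [boxV_eq, map_box, boxV_eq]
  congr 1
  funext v
  exact map_rTransform φ f v

theorem map_point (e : Series s R) (X : Coord s R) (w : NWord s) :
    φ (point e X w) = point (fun v => φ (e v)) (fun v => φ (X v)) w := by
  unfold point
  split_ifs <;> simp

end Naturality

/-! ### Ring homomorphisms on dual numbers -/

section DualNumbers

variable {R S : Type*} [CommRing R] [CommRing S]

open TrivSqZeroExt

/-- The homomorphism of dual numbers induced by a homomorphism of the coefficients. -/
def dualMap (φ : R →+* S) : DualNumber R →+* DualNumber S where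
  toFun x := inl (φ x.fst) + inr (φ x.snd)
  map_one' := by ext <;> simp
  map_zero' := by ext <;> simp
  map_add' x y := by ext <;> simp
  map_mul' x y := by ext <;> simp

@[simp] theorem fst_dualMap (φ : R →+* S) (x : DualNumber R) : (dualMap φ x).fst = φ x.fst := by
  simp [dualMap]

@[simp] theorem snd_dualMap (φ : R →+* S) (x : DualNumber R) : (dualMap φ x).snd = φ x.snd := by
  simp [dualMap]

/-- The evaluation of dual numbers at an element of square zero. -/
def dualEval (c : R) (hc : c * c = 0) : DualNumber R →+* R where
  toFun x := x.fst + c * x.snd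
  map_one' := by simp
  map_zero' := by simp
  map_add' x y := by simp only [fst_add, snd_add]; ring
  map_mul' x y := by
    simp only [fst_mul, snd_mul, smul_eq_mul, MulOpposite.smul_eq_mul_unop, MulOpposite.unop_op]
    linear_combination -(x.snd * y.snd) * hc

theorem dualEval_apply (c : R) (hc : c * c = 0) (x : DualNumber R) :
    dualEval c hc x = x.fst + c * x.snd := rfl

variable (R) in
/-- The exchange of the two infinitesimals. -/
def dualSwap : DualNumber (DualNumber R) →+* DualNumber (DualNumber R) where
  toFun x := inl (inl x.fst.fst + inr x.snd.fst) + inr (inl x.fst.snd + inr x.snd.snd)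
  map_one' := by ext <;> simp
  map_zero' := by ext <;> simp
  map_add' x y := by ext <;> simp
  map_mul' x y := by ext <;> simp; ring

/-- The Taylor homomorphism `p ↦ p + ε p'`. -/
noncomputable def taylorDual (R : Type*) [CommRing R] :
    Polynomial R →+* DualNumber (Polynomial R) where
  toFun p := inl p + inr (Polynomial.derivative p)
  map_one' := by ext1 <;> simp
  map_zero' := by ext1 <;> simp
  map_add' p q := by ext1 <;> simp
  map_mul' p q := by
    ext1
    · simp
    · simp [Polynomial.derivative_mul]; ring

end DualNumbers

/-! ### Unipotent laws: Jacobians, brackets and the BCH series -/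

section Unipotent

open TrivSqZeroExt

variable {s : ℕ}

/-- A law which is natural in the ring, unital, and unitriangular for the length of words. -/
structure Law.IsUnipotent (L : Law.{u} s) : Prop where
  mul_sub_mul : ∀ {R : Type u} [CommRing R] {X X' Y Y' : Coord s R} {w : LWord s},
    (∀ v : LWord s, v.1.length < w.1.length → X v = X' v) →
    (∀ v : LWord s, v.1.length < w.1.length → Y v = Y' v) →
    L.mul X Y w - L.mul X' Y' w = (X w - X' w) + (Y w - Y' w)
  mul_zero : ∀ {R : Type u} [CommRing R] (X : Coord s R), L.mul X 0 = X
  zero_mul : ∀ {R : Type u} [CommRing R] (Y : Coord s R), L.mul 0 Y = Y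
  map_mul : ∀ {R S : Type u} [CommRing R] [CommRing S] (φ : R →+* S) (X Y : Coord s R)
    (w : LWord s), φ (L.mul X Y w) = L.mul (fun v => φ (X v)) (fun v => φ (Y v)) w

namespace Law.IsUnipotent

variable {L : Law.{u} s} (H : L.IsUnipotent)
include H

section Ring

variable {R : Type u} [CommRing R]

theorem leftJac_sub_leftJac {x x' ξ ξ' : Coord s R} {w : LWord s}
    (hx : ∀ v : LWord s, v.1.length < w.1.length → x v = x' v)
    (hξ : ∀ v : LWord s, v.1.length < w.1.length → ξ v = ξ' v) :
    L.leftJac x ξ w - L.leftJac x' ξ' w = ξ w - ξ' w := by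
  have := H.mul_sub_mul (R := DualNumber R) (X := fun v => inl (x v)) (X' := fun v => inl (x' v))
    (Y := fun v => inr (ξ v)) (Y' := fun v => inr (ξ' v)) (w := w)
    (fun v hv => by rw [hx v hv]) (fun v hv => by rw [hξ v hv])
  simpa [leftJac] using congrArg snd this

theorem leftJac_zero_left (ξ : Coord s R) : L.leftJac 0 ξ = ξ := by
  funext w
  have : (fun _ => inl 0 : Coord s (DualNumber R)) = 0 := funext fun _ => inl_zero _
  simp only [leftJac, Pi.zero_apply, this, H.zero_mul, snd_inr]

theorem leftJac_zero_right (x : Coord s R) : L.leftJac x 0 = 0 := by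
  funext w
  have : (fun _ => inr 0 : Coord s (DualNumber R)) = 0 := funext fun _ => inr_zero _
  simp only [leftJac, Pi.zero_apply, this, H.mul_zero, snd_inl]

theorem mul_inl_inr (x ξ : Coord s R) (w : LWord s) :
    L.mul (R := DualNumber R) (fun v => inl (x v)) (fun v => inr (ξ v)) w =
      inl (x w) + inr (L.leftJac x ξ w) := by
  ext
  · have := H.map_mul (fstHom R R R).toRingHom (fun v => inl (x v)) (fun v => inr (ξ v)) w
    simp only [AlgHom.toRingHom_eq_coe, RingHom.coe_coe, fstHom_apply, fst_inl, fst_inr] at this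
    rw [this, fst_add, fst_inl, fst_inr, add_zero]
    exact congrFun (H.mul_zero x) w
  · simp [leftJac]

theorem map_leftJac {S : Type u} [CommRing S] (φ : R →+* S) (x ξ : Coord s R) (w : LWord s) :
    φ (L.leftJac x ξ w) = L.leftJac (fun v => φ (x v)) (fun v => φ (ξ v)) w := by
  have := H.map_mul (dualMap φ) (fun v => inl (x v)) (fun v => inr (ξ v)) w
  have h1 : ∀ a, dualMap φ (inl a) = inl (φ a) := fun a => by ext <;> simp
  have h2 : ∀ a, dualMap φ (inr a) = inr (φ a) := fun a => by ext <;> simp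
  simp only [h1, h2] at this
  simpa [leftJac] using congrArg snd this

end Ring

section Field

variable {k : Type u} [Field k]

/-- At `w`, the Jacobian field depends on `Y w` only through the summand `Y w`, which has no
`ε`-part, and on `X w` not at all. Thus the bracket at `w` sees only shorter words. -/
theorem bilin_congr {X X' Y Y' : Coord s k} {w : LWord s}
    (hX : ∀ v : LWord s, v.1.length < w.1.length → X v = X' v)
    (hY : ∀ v : LWord s, v.1.length < w.1.length → Y v = Y' v) :
    L.bilin X Y w = L.bilin X' Y' w := by
  have := H.leftJac_sub_leftJac (R := DualNumber k) (x := fun v => inr (X v))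
    (x' := fun v => inr (X' v)) (ξ := fun v => inl (Y v)) (ξ' := fun v => inl (Y' v)) (w := w)
    (fun v hv => by rw [hX v hv]) (fun v hv => by rw [hY v hv])
  have := congrArg snd this
  simp only [snd_sub, snd_inl, sub_self] at this
  exact sub_eq_zero.1 this

theorem bilin_zero_left (Y : Coord s k) : L.bilin 0 Y = 0 := by
  funext w
  have : (fun _ => inr 0 : Coord s (DualNumber k)) = 0 := funext fun _ => inr_zero _
  simp only [bilin, Pi.zero_apply, this, H.leftJac_zero_left, snd_inl]

theorem bilin_zero_right (X : Coord s k) : L.bilin X 0 = 0 := by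
  funext w
  have : (fun _ => inl 0 : Coord s (DualNumber k)) = 0 := funext fun _ => inl_zero _
  simp only [bilin, Pi.zero_apply, this, H.leftJac_zero_right, snd_zero]

/-- With two independent infinitesimals, `bilin` becomes the mixed second order term of the group
law; this form can be pushed through a homomorphism. -/
theorem mul_inl_inr_inr_inl (X Y : Coord s k) (w : LWord s) :
    L.mul (R := DualNumber (DualNumber k)) (fun v => inl (inr (X v))) (fun v => inr (inl (Y v))) w
      = inl (inr (X w)) + inr (inl (Y w) + inr (L.bilin X Y w)) := by
  rw [H.mul_inl_inr]
  congr 2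
  ext
  · have := H.map_leftJac (fstHom k k k).toRingHom (fun v => inr (X v)) (fun v => inl (Y v)) w
    simp only [AlgHom.toRingHom_eq_coe, RingHom.coe_coe, fstHom_apply, fst_inl, fst_inr] at this
    rw [this, fst_add, fst_inl, fst_inr, add_zero]
    exact congrFun (H.leftJac_zero_left Y) w
  · simp [bilin]

/-- Each bracket raises the shortest word in the support by at least one letter, starting from
length two for a single element. -/
theorem nested_eq_zero (l : List (Coord s k)) (w : LWord s) (hw : w.1.length ≤ l.length) :
    L.nested l w = 0 := by
  induction l generalizing w with
  | nil => exact absurd (w.2.trans hw) (by simp)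
  | cons Z l ih =>
    obtain _ | ⟨Z', l⟩ := l
    · exact absurd (w.2.trans hw) (by simp)
    · have h0 : ∀ v : LWord s, v.1.length < w.1.length → L.nested (Z' :: l) v = 0 :=
        fun v hv => ih v (by rw [List.length_cons] at hw; omega)
      have h1 : L.bilin Z (L.nested (Z' :: l)) w = 0 := by
        rw [H.bilin_congr (fun _ _ => rfl) (Y' := 0) h0, H.bilin_zero_right, Pi.zero_apply]
      have h2 : L.bilin (L.nested (Z' :: l)) Z w = 0 := by
        rw [H.bilin_congr (X' := 0) h0 (fun _ _ => rfl), H.bilin_zero_left, Pi.zero_apply]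
      simp [nested, bracket, h1, h2]

theorem bchPart_eq_zero (X Y : Coord s k) (w : LWord s) {N : ℕ} (hw : w.1.length ≤ N) :
    L.bchPart N X Y w = 0 := by
  unfold bchPart
  rw [Finset.sum_apply]
  refine sum_eq_zero fun n _ => ?_
  rw [Finset.sum_apply]
  refine sum_eq_zero fun p hp => ?_
  rw [Pi.smul_apply, H.nested_eq_zero, smul_zero]
  rw [List.length_flatMap, List.map_ofFn, List.sum_ofFn]
  simp only [Function.comp_apply, List.length_append, List.length_replicate]
  rw [(mem_filter.1 hp).2.2]
  exact hw

theorem bch_apply (X Y : Coord s k) (w : LWord s) {n : ℕ} (hw : w.1.length ≤ n) :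
    L.bch X Y w = ∑ N ∈ range n, L.bchPart N X Y w := by
  refine finsum_eq_sum_of_support_subset _ fun N hN => ?_
  rw [coe_range, Set.mem_Iio]
  by_contra h
  exact hN (H.bchPart_eq_zero X Y w (hw.trans (not_lt.1 h)))

/-! ### The exponential map -/

variable [CharZero k]

/-- At shorter words the curves coincide by induction, so at `w` their derivatives differ by the
constant `ξ w - ξ' w`. The case `ξ = ξ'` is uniqueness of the flow; evaluation at `1` is
unitriangularity of `EXP`. -/
theorem IsFlow.sub_eq {ξ ξ' : Coord s k} {γ γ' : Coord s (Polynomial k)} (hγ : L.IsFlow ξ γ)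
    (hγ' : L.IsFlow ξ' γ') {w : LWord s}
    (h : ∀ v : LWord s, v.1.length < w.1.length → ξ v = ξ' v) :
    γ w - γ' w = Polynomial.C (ξ w - ξ' w) * Polynomial.X := by
  induction hn : w.1.length using Nat.strong_induction_on generalizing w with
  | _ n ih =>
  have h1 : ∀ v : LWord s, v.1.length < w.1.length → γ v = γ' v := fun v hv => by
    have := ih _ (hn ▸ hv) (w := v) (fun u hu => h u (hu.trans hv)) rfl
    rw [h v hv, sub_self, Polynomial.C_0, MulZeroClass.zero_mul] at this
    exact sub_eq_zero.1 this
  have h2 := H.leftJac_sub_leftJac (R := Polynomial k) (ξ := fun v => Polynomial.C (ξ v))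
    (ξ' := fun v => Polynomial.C (ξ' v)) h1 (fun v hv => by rw [h v hv])
  rw [← hγ.2, ← hγ'.2] at h2
  have h3 : Polynomial.derivative (γ w - γ' w - Polynomial.C (ξ w - ξ' w) * Polynomial.X) = 0 := by
    simp [h2]
  have h4 := Polynomial.eq_C_of_derivative_eq_zero h3
  have h5 := congrArg (Polynomial.eval 0) h4
  simp only [Polynomial.eval_sub, hγ.1, hγ'.1, Polynomial.eval_mul, Polynomial.eval_X,
    MulZeroClass.mul_zero, Polynomial.eval_C, sub_self] at h5
  rw [← h5, Polynomial.C_0] at h4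
  exact sub_eq_zero.1 h4

omit H in
theorem exists_antiderivative (p : Polynomial k) : ∃ q : Polynomial k,
    Polynomial.derivative q = p ∧ q.eval 0 = 0 := by
  induction p using Polynomial.induction_on' with
  | add p q hp hq =>
    obtain ⟨p', h1, h2⟩ := hp
    obtain ⟨q', h3, h4⟩ := hq
    exact ⟨p' + q', by simp [h1, h3], by simp [h2, h4]⟩
  | monomial n a =>
    refine ⟨Polynomial.monomial (n + 1) (a / (n + 1)), ?_, ?_⟩
    · have : (n : k) + 1 ≠ 0 := Nat.cast_add_one_ne_zero n
      rw [Polynomial.derivative_monomial]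
      simp [this]
    · simp [Polynomial.eval_monomial]

/-- The approximations of the integral curve. -/
noncomputable def flowAux (L : Law.{u} s) (ξ : Coord s k) : ℕ → Coord s (Polynomial k)
  | 0 => 0
  | n + 1 => fun w => (exists_antiderivative
      (L.leftJac (flowAux L ξ n) (fun v => Polynomial.C (ξ v)) w)).choose

theorem flowAux_eq (ξ : Coord s k) (n m : ℕ) (hm : n ≤ m) (w : LWord s) (hw : w.1.length < n) :
    flowAux L ξ n w = flowAux L ξ m w := by
  induction n generalizing m w with
  | zero => exact absurd hw (Nat.not_lt_zero _)
  | succ n ih =>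
    obtain _ | m := m
    · omega
    have := H.leftJac_sub_leftJac (R := Polynomial k) (x := flowAux L ξ n) (x' := flowAux L ξ m)
      (ξ := fun v => Polynomial.C (ξ v)) (w := w)
      (fun v hv => ih m (by omega) v (by omega)) fun _ _ => rfl
    rw [sub_self, sub_eq_zero] at this
    simp only [flowAux, this]

theorem exists_isFlow (ξ : Coord s k) : ∃ γ, L.IsFlow ξ γ := by
  refine ⟨fun w => flowAux L ξ (w.1.length + 1) w, fun w => ?_, fun w => ?_⟩
  · exact (exists_antiderivative _).choose_spec.2
  · refine (exists_antiderivative _).choose_spec.1.trans ?_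
    have := H.leftJac_sub_leftJac (R := Polynomial k) (x := flowAux L ξ w.1.length)
      (x' := fun w => flowAux L ξ (w.1.length + 1) w) (ξ := fun v => Polynomial.C (ξ v)) (w := w)
      (fun v hv => (H.flowAux_eq ξ _ _ hv v (Nat.lt_succ_self _)).symm) fun _ _ => rfl
    rwa [sub_self, sub_eq_zero] at this

theorem existsUnique_isFlow (ξ : Coord s k) : ∃! γ, L.IsFlow ξ γ := by
  obtain ⟨γ, hγ⟩ := H.exists_isFlow ξ
  refine ⟨γ, hγ, fun γ' hγ' => funext fun w => ?_⟩
  have := IsFlow.sub_eq H hγ' hγ (w := w) fun _ _ => rfl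
  rw [sub_self, Polynomial.C_0, MulZeroClass.zero_mul] at this
  exact sub_eq_zero.1 this

theorem EXP_eq {ξ : Coord s k} {γ : Coord s (Polynomial k)} (hγ : L.IsFlow ξ γ) :
    (L.EXP ξ : Series s k) = point (L.unit k) fun w => (γ w).eval 1 := by
  have : Classical.epsilon (L.IsFlow ξ) = γ :=
    (H.existsUnique_isFlow ξ).unique (Classical.epsilon_spec ⟨γ, hγ⟩) hγ
  simp only [EXP, this]

theorem isUnitriangular_EXP :
    IsUnitriangular fun ξ : Coord s k => coords (L.unit k) (L.EXP ξ).1 := by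
  intro ξ ξ' w h
  obtain ⟨γ, hγ⟩ := H.exists_isFlow ξ
  obtain ⟨γ', hγ'⟩ := H.exists_isFlow ξ'
  have := congrArg (Polynomial.eval 1) (IsFlow.sub_eq H hγ hγ' h)
  simp only [H.EXP_eq hγ, H.EXP_eq hγ', coords_point]
  simpa using this

theorem bijective_EXP : Function.Bijective (L.EXP (k := k)) := by
  have h := H.isUnitriangular_EXP (k := k)
  constructor
  · intro ξ ξ' e
    exact h.injective (by simp only [e])
  · intro f
    obtain ⟨ξ, hξ⟩ := h.surjective (coords (L.unit k) f.1)
    refine ⟨ξ, Subtype.ext ?_⟩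
    have := congrArg (point (L.unit k)) hξ
    rwa [point_coords _ f.2, point_coords _ (L.EXP ξ).2] at this

end Field

end Law.IsUnipotent

end Unipotent

/-! ### Homomorphisms of laws and their differentials -/

section Homomorphisms

open TrivSqZeroExt

variable {s : ℕ}

/-- A natural homomorphism of laws, in co-ordinates, which is unitriangular for the length of
words. -/
structure Law.Hom (L M : Law.{u} s) where
  toFun : ∀ {R : Type u} [CommRing R], Coord s R → Coord s R
  map_mul : ∀ {R : Type u} [CommRing R] (X Y : Coord s R),
    toFun (L.mul X Y) = M.mul (toFun X) (toFun Y)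
  map_zero : ∀ {R : Type u} [CommRing R], toFun (0 : Coord s R) = 0
  map_ringHom : ∀ {R S : Type u} [CommRing R] [CommRing S] (φ : R →+* S) (X : Coord s R)
    (w : LWord s), φ (toFun X w) = toFun (fun v => φ (X v)) w
  isUnitriangular : ∀ {R : Type u} [CommRing R], IsUnitriangular (toFun (R := R))

namespace Law.Hom

variable {L M : Law.{u} s} (Φ : Law.Hom L M)

section Differential

variable {k : Type u} [CommRing k]

/-- The differential at the unit. -/
def diff (ξ : Coord s k) : Coord s k := fun w =>
  (Φ.toFun (R := DualNumber k) (fun v => inr (ξ v)) w).snd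

theorem toFun_inr (ξ : Coord s k) (w : LWord s) :
    Φ.toFun (R := DualNumber k) (fun v => inr (ξ v)) w = inr (Φ.diff ξ w) := by
  ext
  · have := Φ.map_ringHom (fstHom k k k).toRingHom (fun v => inr (ξ v)) w
    simp only [AlgHom.toRingHom_eq_coe, RingHom.coe_coe, fstHom_apply, fst_inr] at this
    rw [this, fst_inr]
    exact congrFun Φ.map_zero w
  · simp [diff]

theorem toFun_map_inr {S : Type u} [CommRing S] (φ : DualNumber k →+* S) (ξ : Coord s k)
    (w : LWord s) : Φ.toFun (fun v => φ (inr (ξ v))) w = φ (inr (Φ.diff ξ w)) := by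
  rw [← Φ.toFun_inr, Φ.map_ringHom]

/-- First order Taylor expansion at a base point `a` other than the unit: it is read off over
`DualNumber R`, with `ε` specialized to `c`. Where `ψ` kills `a`, the derivative reduces to the
differential at the unit. -/
theorem toFun_add_mul {R : Type u} [CommRing R] {c : R} (hc : c * c = 0)
    (ψ : R →+* k) (a b : Coord s R) (ha : ∀ v, ψ (a v) = 0) (w : LWord s) :
    ∃ t, ψ t = Φ.diff (fun v => ψ (b v)) w ∧
      Φ.toFun (fun v => a v + c * b v) w = Φ.toFun a w + c * t := by
  let F : Coord s (DualNumber R) := fun v => inl (a v) + inr (b v)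
  refine ⟨(Φ.toFun F w).snd, ?_, ?_⟩
  · have h := Φ.map_ringHom (R := DualNumber R) (S := DualNumber k) (dualMap ψ) F w
    have e : (fun v => dualMap ψ (F v)) = fun v => inr (ψ (b v)) := by
      funext v
      ext1 <;> simp [F, ha]
    rw [e, Φ.toFun_inr] at h
    simpa using congrArg snd h
  · have h1 := Φ.map_ringHom (R := DualNumber R) (S := R) (dualEval c hc) F w
    have h2 := Φ.map_ringHom (R := DualNumber R) (S := R) (fstHom R R R).toRingHom F w
    have e1 : (fun v => dualEval c hc (F v)) = fun v => a v + c * b v := by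
      funext v
      simp [F, dualEval_apply]
    have e2 : (fun v => (fstHom R R R).toRingHom (F v)) = a := by
      funext v
      simp [F]
    rw [e1, dualEval_apply] at h1
    rw [e2] at h2
    rw [← h1, ← h2]
    rfl

/-- Over the square-zero extension by `k × k`, every linear form on `k × k` induces a homomorphism
to the dual numbers. By naturality a single value of `Φ` there yields the differentials of `ξ`, of
`η` and of their combination. -/
theorem diff_linear (a b : k) (ξ η : Coord s k) :
    Φ.diff (a • ξ + b • η) = a • Φ.diff ξ + b • Φ.diff η := by
  funext w
  have key : ∀ f : k × k →ₗ[k] k, Φ.diff (fun v => f (ξ v, η v)) w =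
      f (Φ.toFun (R := TrivSqZeroExt k (k × k)) (fun v => inr (ξ v, η v)) w).snd := fun f => by
    have := Φ.map_ringHom (TrivSqZeroExt.map f).toRingHom (fun v => inr (ξ v, η v)) w
    simp only [AlgHom.toRingHom_eq_coe, RingHom.coe_coe, map_inr] at this
    rw [← snd_map, this]
    rfl
  have h1 := key (LinearMap.fst k k k)
  have h2 := key (LinearMap.snd k k k)
  have h3 := key (a • LinearMap.fst k k k + b • LinearMap.snd k k k)
  simp only [LinearMap.add_apply, LinearMap.smul_apply] at h3
  rw [← h1, ← h2] at h3
  exact h3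

/-- The differential at the unit, as a linear map. -/
def diffHom : Coord s k →ₗ[k] Coord s k where
  toFun := Φ.diff
  map_add' ξ η := by simpa using Φ.diff_linear 1 1 ξ η
  map_smul' a ξ := by simpa using Φ.diff_linear a 0 ξ 0

@[simp] theorem diffHom_apply (ξ : Coord s k) : Φ.diffHom ξ = Φ.diff ξ := rfl

theorem isUnitriangular_diff : IsUnitriangular (Φ.diff (k := k)) := by
  intro ξ ξ' w h
  have := Φ.isUnitriangular (R := DualNumber k) (fun v => inr (ξ v)) (fun v => inr (ξ' v)) w
    fun v hv => by rw [h v hv]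
  simpa [diff] using congrArg snd this

theorem diff_congr {ξ ξ' : Coord s k} {w : LWord s}
    (h : ∀ v : LWord s, v.1.length ≤ w.1.length → ξ v = ξ' v) : Φ.diff ξ w = Φ.diff ξ' w := by
  have := Φ.isUnitriangular_diff ξ ξ' w fun v hv => h v hv.le
  rw [h w le_rfl, sub_self] at this
  exact sub_eq_zero.1 this

theorem diff_zero : Φ.diff (0 : Coord s k) = 0 := Φ.diffHom.map_zero

theorem finite_setOf_length_le (s n : ℕ) : {v : LWord s | v.1.length ≤ n}.Finite :=
  (List.finite_length_le (Fin s) n).preimage Subtype.val_injective.injOn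

theorem diff_single_eq_zero [DecidableEq (LWord s)] {w v : LWord s} (hv : v ≠ w)
    (h : w.1.length ≤ v.1.length) : Φ.diff (Pi.single v (1 : k)) w = 0 := by
  have := Φ.isUnitriangular_diff (Pi.single v (1 : k)) 0 w fun u hu =>
    Pi.single_eq_of_ne (by rintro rfl; omega) 1
  rwa [Φ.diff_zero, Pi.single_eq_of_ne hv.symm, Pi.zero_apply, sub_self, sub_zero] at this

theorem diff_single_self [DecidableEq (LWord s)] (w : LWord s) :
    Φ.diff (Pi.single w (1 : k)) w = 1 := by
  have := Φ.isUnitriangular_diff (Pi.single w (1 : k)) 0 w fun u hu =>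
    Pi.single_eq_of_ne (by rintro rfl; omega) 1
  rwa [Φ.diff_zero, Pi.single_eq_same, Pi.zero_apply, sub_zero, sub_zero] at this

/-- The matrix of the differential is lower triangular with unit diagonal. -/
theorem exists_matrix : ∃ A : LWord s → LWord s →₀ k, (∀ w, A w w = 1) ∧
    (∀ w v, v ≠ w → w.1.length ≤ v.1.length → A w v = 0) ∧
    ∀ (ξ : Coord s k) (w : LWord s), Φ.diff ξ w = (A w).sum fun v a => a * ξ v := by
  classical
  -- The alphabet is finite, and the differential at `w` sees only words of length at most `|w|`, so
  -- each row has finite support.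
  let T : ℕ → Finset (LWord s) := fun n => (finite_setOf_length_le s n).toFinset
  have hT : ∀ n v, v ∈ T n ↔ v.1.length ≤ n := fun n v => by simp [T]
  let A : LWord s → LWord s →₀ k := fun w => Finsupp.onFinset (T w.1.length)
    (fun v => Φ.diff (Pi.single v (1 : k)) w) fun v hv => by
      by_contra h
      rw [hT] at h
      exact hv (Φ.diff_single_eq_zero (by rintro rfl; omega) (by omega))
  refine ⟨A, fun w => Φ.diff_single_self w, fun w v hv h => Φ.diff_single_eq_zero hv h,
    fun ξ w => ?_⟩
  have h1 : Φ.diff ξ w =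
      Φ.diffHom (∑ v ∈ T w.1.length, ξ v • Pi.single v (1 : k)) w := by
    refine Φ.diff_congr fun u hu => ?_
    rw [Finset.sum_apply, sum_eq_single u]
    · simp
    · intro v _ hv
      simp [Pi.single_eq_of_ne hv.symm]
    · exact fun h => absurd ((hT _ _).2 hu) h
  rw [h1, map_sum, Finset.sum_apply,
    Finsupp.sum_of_support_subset _ Finsupp.support_onFinset_subset _ fun _ _ => zero_mul _]
  refine sum_congr rfl fun v _ => ?_
  rw [map_smul, Pi.smul_apply, smul_eq_mul, mul_comm]
  rfl

end Differential

section Field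

variable {k : Type u} [Field k]

/-- A homomorphism of laws carries integral curves into integral curves. -/
theorem map_isFlow (hL : L.IsUnipotent) (hM : M.IsUnipotent) {ξ : Coord s k}
    {γ : Coord s (Polynomial k)} (hγ : L.IsFlow ξ γ) : M.IsFlow (Φ.diff ξ) (Φ.toFun γ) := by
  constructor
  · intro w
    have := Φ.map_ringHom (Polynomial.evalRingHom 0) γ w
    simp only [Polynomial.coe_evalRingHom, hγ.1] at this
    rw [this]
    exact congrFun Φ.map_zero w
  · intro w
    -- The flow equation says that `γ ∘ (ε ξ)` equals `γ + ε γ'`, the image of `γ` under the Taylor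
    -- homomorphism. Applying `Φ` yields the same equation for `Φ γ`.
    have h1 : L.mul (R := DualNumber (Polynomial k)) (fun v => inl (γ v))
        (fun v => inr (Polynomial.C (ξ v))) = fun v => taylorDual k (γ v) := by
      funext v
      rw [hL.mul_inl_inr, ← hγ.2]
      rfl
    have h2 := congrFun (Φ.map_mul (R := DualNumber (Polynomial k)) (fun v => inl (γ v))
      (fun v => inr (Polynomial.C (ξ v)))) w
    have h3 : Φ.toFun (R := DualNumber (Polynomial k)) (fun v => inl (γ v)) =
        fun v => inl (Φ.toFun γ v) :=
      funext fun v => (Φ.map_ringHom (inlHom (Polynomial k) (Polynomial k)) γ v).symm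
    have h4 : Φ.toFun (R := DualNumber (Polynomial k)) (fun v => inr (Polynomial.C (ξ v))) =
        fun v => inr (Polynomial.C (Φ.diff ξ v)) := by
      have e : ∀ a : k, dualMap Polynomial.C (inr a) = inr (Polynomial.C a) := fun a => by
        ext1 <;> simp
      funext v
      rw [← e, ← Φ.toFun_map_inr]
      simp only [e]
    rw [h1, ← Φ.map_ringHom, h3, h4, hM.mul_inl_inr] at h2
    simpa [taylorDual] using congrArg snd h2

theorem coe_EXP_diff [CharZero k] (hL : L.IsUnipotent) (hM : M.IsUnipotent) (ξ : Coord s k) :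
    (M.EXP (Φ.diff ξ) : Series s k) =
      point (M.unit k) (Φ.toFun (coords (L.unit k) (L.EXP ξ).1)) := by
  obtain ⟨γ, hγ⟩ := hL.exists_isFlow ξ
  rw [hM.EXP_eq (Φ.map_isFlow hL hM hγ), hL.EXP_eq hγ, coords_point]
  congr 1
  funext w
  exact Φ.map_ringHom (Polynomial.evalRingHom 1) γ w

theorem toFun_second_order (X Y Z W : Coord s k) (w : LWord s) :
    (Φ.toFun (R := DualNumber (DualNumber k))
      (fun v => inl (inr (X v)) + inr (inl (Y v) + inr (Z v + W v))) w).snd.snd =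
    (Φ.toFun (R := DualNumber (DualNumber k))
      (fun v => inl (inr (X v)) + inr (inl (Y v) + inr (Z v))) w).snd.snd + Φ.diff W w := by
  have hc : (inr (inr 1) : DualNumber (DualNumber k)) * inr (inr 1) = 0 := by ext <;> simp
  obtain ⟨t, h1, h2⟩ := Φ.toFun_add_mul hc ((fstHom k k k).toRingHom.comp
    (fstHom (DualNumber k) (DualNumber k) (DualNumber k)).toRingHom)
    (fun v => inl (inr (X v)) + inr (inl (Y v) + inr (Z v))) (fun v => inl (inl (W v)))
    (fun v => by simp) w
  have e : (fun v => inl (inr (X v)) + inr (inl (Y v) + inr (Z v)) +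
      inr (inr 1) * inl (inl (W v)) : Coord s (DualNumber (DualNumber k))) =
      fun v => inl (inr (X v)) + inr (inl (Y v) + inr (Z v + W v)) := by
    funext v
    ext <;> simp
  rw [e] at h2
  simp at h1
  rw [h2]
  simp [h1]

theorem toFun_bilin (hL : L.IsUnipotent) (hM : M.IsUnipotent) (X Y : Coord s k) (w : LWord s) :
    Φ.toFun (R := DualNumber (DualNumber k))
      (fun v => inl (inr (X v)) + inr (inl (Y v) + inr (L.bilin X Y v))) w =
    inl (inr (Φ.diff X w)) +
      inr (inl (Φ.diff Y w) + inr (M.bilin (Φ.diff X) (Φ.diff Y) w)) := by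
  have h1 := congrFun (Φ.map_mul (R := DualNumber (DualNumber k)) (fun v => inl (inr (X v)))
    (fun v => inr (inl (Y v)))) w
  have h2 : Φ.toFun (R := DualNumber (DualNumber k)) (fun v => inl (inr (X v))) =
      fun v => inl (inr (Φ.diff X v)) :=
    funext fun v =>
      Φ.toFun_map_inr (S := DualNumber (DualNumber k)) (inlHom (DualNumber k) (DualNumber k)) X v
  have h3 : Φ.toFun (R := DualNumber (DualNumber k)) (fun v => inr (inl (Y v))) =
      fun v => inr (inl (Φ.diff Y v)) := by
    have e : ∀ a : k, dualMap (inlHom k k) (inr a) = inr (inl a) := fun a => by ext1 <;> simp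
    funext v
    have := Φ.toFun_map_inr (S := DualNumber (DualNumber k)) (dualMap (inlHom k k)) Y v
    simpa only [e] using this
  rw [h2, h3, hM.mul_inl_inr_inr_inl, funext (hL.mul_inl_inr_inr_inl X Y)] at h1
  exact h1

/-- The second derivative of `Φ` is symmetric and drops out. Exchanging the infinitesimals in the
formula for `(Y, X)` gives an argument that differs from the one for `(X, Y)` only by `[X, Y]` in
the mixed term, where `Φ` acts through its differential. -/
theorem map_bracket (hL : L.IsUnipotent) (hM : M.IsUnipotent) (X Y : Coord s k) :
    Φ.diff (L.bracket X Y) = M.bracket (Φ.diff X) (Φ.diff Y) := by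
  funext w
  have h1 := congrArg (fun x => x.snd.snd) (Φ.toFun_bilin hL hM X Y w)
  have h2 := congrArg (fun x => x.snd.snd) (Φ.toFun_bilin hL hM Y X w)
  have h3 := Φ.map_ringHom (R := DualNumber (DualNumber k))
    (S := DualNumber (DualNumber k)) (dualSwap k)
    (fun v => inl (inr (Y v)) + inr (inl (X v) + inr (L.bilin Y X v))) w
  have e : (fun v => dualSwap k (inl (inr (Y v)) + inr (inl (X v) + inr (L.bilin Y X v)))) =
      fun v => inl (inr (X v)) + inr (inl (Y v) + inr (L.bilin Y X v)) := by
    funext v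
    ext <;> simp [dualSwap]
  have h4 := Φ.toFun_second_order X Y (L.bilin Y X) (L.bracket X Y) w
  have e' : ∀ v, L.bilin Y X v + L.bracket X Y v = L.bilin X Y v := fun v => by simp [bracket]
  simp only [e'] at h4
  rw [e] at h3
  rw [← h3] at h4
  simp [dualSwap] at h1 h2 h4
  rw [h1, h2] at h4
  rw [show M.bracket (Φ.diff X) (Φ.diff Y) w =
    M.bilin (Φ.diff X) (Φ.diff Y) w - M.bilin (Φ.diff Y) (Φ.diff X) w from rfl]
  linear_combination -h4

theorem map_nested (hL : L.IsUnipotent) (hM : M.IsUnipotent) (l : List (Coord s k)) :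
    Φ.diff (L.nested l) = M.nested (l.map Φ.diff) := by
  induction l with
  | nil => exact Φ.diff_zero
  | cons Z l ih =>
    obtain _ | ⟨Z', l⟩ := l
    · rfl
    · rw [nested, Φ.map_bracket hL hM, ih]
      rfl

theorem map_bchPart (hL : L.IsUnipotent) (hM : M.IsUnipotent) (N : ℕ) (X Y : Coord s k) :
    Φ.diff (L.bchPart N X Y) = M.bchPart N (Φ.diff X) (Φ.diff Y) := by
  rw [← Φ.diffHom_apply]
  simp only [bchPart, map_sum, map_smul, diffHom_apply, Φ.map_nested hL hM, List.map_flatMap,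
    List.map_append, List.map_replicate]

/-- Linearity covers finite sums only. Since the differential at `w` sees words of length at most
`|w|`, the series may first be truncated. -/
theorem map_bch (hL : L.IsUnipotent) (hM : M.IsUnipotent) (X Y : Coord s k) :
    Φ.diff (L.bch X Y) = M.bch (Φ.diff X) (Φ.diff Y) := by
  funext w
  have h : Φ.diff (L.bch X Y) w =
      Φ.diffHom (∑ N ∈ range w.1.length, L.bchPart N X Y) w :=
    Φ.diff_congr fun v hv => by rw [hL.bch_apply X Y v hv, Finset.sum_apply]
  rw [h, hM.bch_apply _ _ w le_rfl, map_sum, Finset.sum_apply]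
  exact sum_congr rfl fun N _ => congrFun (Φ.map_bchPart hL hM N X Y) w

end Field

end Law.Hom

end Homomorphisms

/-! ### The two convolutions -/

section Convolutions

variable {s : ℕ}

theorem point_zero {R : Type*} [CommRing R] {e : Series s R} (he : e ∈ GPlus s R) :
    point e 0 = e := by
  rw [show (0 : Coord s R) = coords e e from funext fun _ => (sub_self _).symm, point_coords e he]

theorem lawBox_mul {R : Type u} [CommRing R] (X Y : Coord s R) : (lawBox.{u} s).mul X Y =
    coords (boxUnit s R) (box (point (boxUnit s R) X) (point (boxUnit s R) Y)) := rfl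

theorem lawBoxV_mul {R : Type u} [CommRing R] (X Y : Coord s R) : (lawBoxV.{u} s).mul X Y =
    coords (zeta s R) (boxV (point (zeta s R) X) (point (zeta s R) Y)) := rfl

theorem isUnipotent_lawBox : (lawBox.{u} s).IsUnipotent where
  mul_sub_mul {R} _ X X' Y Y' w hX hY := by
    have := box_sub_box (point_mem _ X) (point_mem _ X') (point_mem _ Y) (point_mem _ Y')
      (w := w.toNWord) w.2 (point_congr (boxUnit s R) hX) (point_congr (boxUnit s R) hY)
    simp only [point_toNWord] at this
    simp only [lawBox_mul, coords]
    linear_combination this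
  mul_zero X := by rw [lawBox_mul, point_zero boxUnit_mem, box_boxUnit, coords_point]
  zero_mul Y := by rw [lawBox_mul, point_zero boxUnit_mem, boxUnit_box, coords_point]
  map_mul φ X Y w := by
    simp only [lawBox_mul, coords, map_sub, map_box, map_boxUnit, map_point]

theorem isUnitriangular_rTransform {R : Type*} [CommRing R] (e e' : Series s R) :
    IsUnitriangular fun X => coords e' (rTransform (point e X)) :=
  isUnitriangular_box_left moeb_mem e e'

theorem rTransform_congr {R : Type*} [CommRing R] {f f' : Series s R} (hf : f ∈ GPlus s R)
    (hf' : f' ∈ GPlus s R) {n : ℕ} (h : ∀ v : NWord s, v.1.length < n → f v = f' v) (v : NWord s)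
    (hv : v.1.length < n) : rTransform f v = rTransform f' v := by
  by_cases h2 : 2 ≤ v.1.length
  · have := box_sub_box hf hf' moeb_mem moeb_mem h2 (fun u hu => h u (hu.trans hv))
      fun _ _ => rfl
    rw [h v hv, sub_self, sub_self, add_zero] at this
    exact sub_eq_zero.1 this
  · have h1 : v.1.length = 1 := by
      have := List.length_pos_iff.2 v.2
      omega
    rw [rTransform_mem hf v h1, rTransform_mem hf' v h1]

theorem isUnipotent_lawBoxV : (lawBoxV.{u} s).IsUnipotent where
  mul_sub_mul {R} _ X X' Y Y' w hX hY := by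
    have h1 := box_sub_box (rTransform_mem (point_mem (zeta s R) X))
      (rTransform_mem (point_mem (zeta s R) X')) (point_mem (zeta s R) Y)
      (point_mem (zeta s R) Y') (w := w.toNWord) w.2
      (rTransform_congr (point_mem _ X) (point_mem _ X') (point_congr (zeta s R) hX))
      (point_congr (zeta s R) hY)
    have h2 := isUnitriangular_rTransform (zeta s R) (zeta s R) X X' w hX
    simp only [point_toNWord] at h1
    simp only [coords] at h2
    simp only [lawBoxV_mul, coords, boxV_eq]
    linear_combination h1 + h2
  mul_zero X := by rw [lawBoxV_mul, point_zero zeta_mem, boxV_zeta, coords_point]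
  zero_mul Y := by rw [lawBoxV_mul, point_zero zeta_mem, zeta_boxV, coords_point]
  map_mul φ X Y w := by
    simp only [lawBoxV_mul, coords, map_sub, map_boxV, map_zeta, map_point]

variable (s) in
/-- The transform `f ↦ f ⊠ Moeb`, as a homomorphism of laws. -/
noncomputable def rHom : Law.Hom (lawBoxV.{u} s) (lawBox.{u} s) where
  toFun {R} _ X := coords (boxUnit s R) (rTransform (point (zeta s R) X))
  map_mul {R} _ X Y := by
    rw [lawBoxV_mul, lawBox_mul, point_coords _ (boxV_mem (point_mem _ X) (point_mem _ Y)),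
      rTransform_boxV, point_coords _ (rTransform_mem (point_mem _ X)),
      point_coords _ (rTransform_mem (point_mem _ Y))]
  map_zero {R} _ := by
    rw [point_zero zeta_mem, rTransform_zeta]
    funext w
    exact sub_self _
  map_ringHom φ X w := by
    simp only [coords, map_sub, map_rTransform, map_boxUnit, map_zeta, map_point]
  isUnitriangular := isUnitriangular_rTransform _ _

theorem rHom_diff {k : Type u} [Field k] (ξ : Coord s k) : (rHom.{u} s).diff ξ = dR ξ := by
  funext w
  simp only [Law.Hom.diff, rHom, coords, dR, TrivSqZeroExt.snd_sub]
  rw [sub_eq_self]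
  unfold boxUnit
  split_ifs <;> simp

theorem coe_EXP_dR {k : Type u} [Field k] [CharZero k] (ξ : Coord s k) :
    ((lawBox s).EXP (dR ξ) : Series s k) = rTransform ((lawBoxV s).EXP ξ).1 := by
  have := (rHom s).coe_EXP_diff isUnipotent_lawBoxV isUnipotent_lawBox ξ
  rw [rHom_diff] at this
  rw [this]
  change point (boxUnit s k) (coords (boxUnit s k) (rTransform (point (zeta s k)
    (coords (zeta s k) ((lawBoxV s).EXP ξ).1)))) = _
  rw [point_coords (zeta s k) ((lawBoxV s).EXP ξ).2,
    point_coords _ (rTransform_mem ((lawBoxV s).EXP ξ).2)]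

end Convolutions

/-! ### The group of `⊠_V`, transported along `𝓡` -/

section Groups

variable (s : ℕ) (R : Type*) [CommRing R]

/-- The group of the free multiplicative convolution. -/
noncomputable abbrev boxVGroup : Group (GPlus s R) :=
  letI := boxGroup s R
  (rEquiv s R).group

theorem boxVGroup_mul (f g : GPlus s R) :
    ((boxVGroup s R).mul f g : Series s R) = boxV f.1 g.1 := by
  change box (box (rTransform f.1) (rTransform g.1)) (zeta s R) = _
  rw [← rTransform_boxV, rTransform_box_zeta]

theorem boxVGroup_one : ((boxVGroup s R).one : Series s R) = zeta s R :=
  boxUnit_box _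

end Groups

end FreeMul

theorem mainTheorem9 {k : Type u} [Field k] [CharZero k] (s : ℕ) :
    -- the Moebius series is the inverse of the Zeta series
    (FreeMul.box (FreeMul.zeta s k) (FreeMul.moeb s k) = FreeMul.boxUnit s k ∧
      FreeMul.box (FreeMul.moeb s k) (FreeMul.zeta s k) = FreeMul.boxUnit s k) ∧
    -- both convolutions are group laws and the transform is an isomorphism of groups
    (∃ (GV GB : Group (FreeMul.GPlus s k))
        (e : @MulEquiv (FreeMul.GPlus s k) (FreeMul.GPlus s k) GV.toMul GB.toMul),
      (∀ f g : FreeMul.GPlus s k, (GV.mul f g : FreeMul.Series s k) = FreeMul.boxV f.1 g.1) ∧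
      (GV.one : FreeMul.Series s k) = FreeMul.zeta s k ∧
      (∀ f g : FreeMul.GPlus s k, (GB.mul f g : FreeMul.Series s k) = FreeMul.box f.1 g.1) ∧
      (GB.one : FreeMul.Series s k) = FreeMul.boxUnit s k ∧
      (∀ f : FreeMul.GPlus s k, (e f : FreeMul.Series s k) = FreeMul.rTransform f.1)) ∧
    -- exponential, logarithm and the BCH series are well defined for both groups
    (∀ L : FreeMul.Law.{u} s, L = FreeMul.lawBoxV s ∨ L = FreeMul.lawBox s →
      (∀ ξ : FreeMul.Coord s k, ∃! γ, L.IsFlow ξ γ) ∧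
      Function.Bijective (L.EXP (k := k)) ∧
      (∀ (X Y : FreeMul.Coord s k) (w : FreeMul.LWord s) (N : ℕ), w.1.length ≤ N →
        L.bchPart N X Y w = 0)) ∧
    -- the differential is lower triangular with unit diagonal
    (∃ A : FreeMul.LWord s → FreeMul.LWord s →₀ k,
      (∀ w, A w w = 1) ∧
      (∀ w v, v ≠ w → w.1.length ≤ v.1.length → A w v = 0) ∧
      ∀ (ξ : FreeMul.Coord s k) (w : FreeMul.LWord s),
        FreeMul.dR ξ w = (A w).sum fun v a => a * ξ v) ∧
    -- it transforms one BCH law into the other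
    (∀ X Y : FreeMul.Coord s k,
      FreeMul.dR ((FreeMul.lawBoxV s).bch X Y)
        = (FreeMul.lawBox s).bch (FreeMul.dR X) (FreeMul.dR Y)) ∧
    -- `EXP ∘ d𝓡 ∘ LOG = 𝓡`
    (∀ f : FreeMul.GPlus s k,
      ((FreeMul.lawBox s).EXP (FreeMul.dR ((FreeMul.lawBoxV s).LOG f)) : FreeMul.Series s k)
        = FreeMul.rTransform f.1) := by
  refine ⟨FreeMul.moeb_spec, ⟨FreeMul.boxVGroup s k, FreeMul.boxGroup s k,
    @MulEquiv.mk _ _ (FreeMul.boxVGroup s k).toMul (FreeMul.boxGroup s k).toMul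
      (FreeMul.rEquiv s k) fun f g => ?_, FreeMul.boxVGroup_mul s k, FreeMul.boxVGroup_one s k,
      fun _ _ => rfl, rfl, fun _ => rfl⟩, ?_, ?_, ?_, ?_⟩
  -- The transported product is the preimage under `𝓡` of the `⊠`-product of the images, so
  -- multiplicativity is cancellation.
  · exact (FreeMul.rEquiv s k).apply_symm_apply _
  · intro L hL
    have H : L.IsUnipotent := by
      rcases hL with rfl | rfl
      · exact FreeMul.isUnipotent_lawBoxV
      · exact FreeMul.isUnipotent_lawBox
    exact ⟨H.existsUnique_isFlow, H.bijective_EXP, fun X Y w N hN => H.bchPart_eq_zero X Y w hN⟩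
  · obtain ⟨A, h1, h2, h3⟩ := (FreeMul.rHom.{u} s).exists_matrix (k := k)
    exact ⟨A, h1, h2, fun ξ w => by rw [← FreeMul.rHom_diff, h3]⟩
  · intro X Y
    simp only [← FreeMul.rHom_diff]
    exact (FreeMul.rHom s).map_bch FreeMul.isUnipotent_lawBoxV FreeMul.isUnipotent_lawBox X Y
  · intro f
    rw [FreeMul.coe_EXP_dR, FreeMul.Law.LOG,
      Function.rightInverse_invFun FreeMul.isUnipotent_lawBoxV.bijective_EXP.2 f]
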